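/- **Game.** On a finite connected graph $G$, $k$ zombies are placed on independent uniformly random vertices; then the survivor chooses a starting vertex. In each round every zombie first moves to a neighbour of its vertex that is closer to the survivor, chosen uniformly at random among all such neighbours and independently of the other zombies; then the survivor moves to a neighbouring vertex or passes. The survivor is eaten if he ever shares a vertex with a zombie; otherwise he wins. Let $s_k(G)$ be the supremum, over the survivor's strategies, of the probability that he wins, and let $z(G)=\min\{k\ge c(G): s_k(G)\le 1/2\}$, where $c(G)$ is the cop number of $G$. **Torus.** Let $T_n=C_n\,\square\,C_n$, with vertex set $\mathbb Z_n\times\mathbb Z_n$. For $n$ large enough, let $B$ be a box of $\lfloor K\log n\rfloor\times\lfloor K\log n\rfloor$ vertices in $T_n$, where $K=5\cdot 10^4$. Write $u_t$ for the survivor's position after round $t$. A survivor strategy is *$B$-boxed* during $[0,4n]$ if $u_0\in B$ is chosen independently of the zombies, the survivor stays in $B$ during $[0,4n]$ whatever the zombies do, and his moves in that period do not depend on the positions of zombies at times when they are outside $B$. The trajectory $(u_t)_{0\le t\le 4n}$ is *stable* if each of its steps goes to a neighbouring vertex (no passing), no two consecutive steps are opposite to each other, and any two distinct turning points are at least $\lfloor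 20\log n\rfloor$ apart; here the turning points are $0$, $4n$, and every $j$ with $0<j<4n$ and $u_j-u_{j-1}\ne u_{j+1}-u_j$. **Theorem 5.2.** Let $\omega=\omega(n)\to\infty$ as $n\to\infty$. 1. For all sufficiently large $n$, $$z(T_n)\ \ge\ \frac{\sqrt n}{\omega\log n}.$$ 2. Against $k=\lfloor \sqrt n/(\omega\log n)\rfloor$ zombies on $T_n$, and for every choice of the box $B$, the survivor has a strategy that is $B$-boxed during $[0,4n]$ and for which, with probability tending to $1$ as $n\to\infty$ (uniformly in $B$), all of the following hold: his trajectory is stable on $[0,4n]$; at time $4n$ every zombie is straight behind him at distance $2$ or $3$, that is, on $u_{4n}-2d$ or on $u_{4n}-3d$, where $d=u_{4n}-u_{4n-1}$; and he is never eaten. -/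

import Mathlib

open MeasureTheory ProbabilityTheory Filter Topology
open scoped ENNReal

noncomputable section

/-! ### The cop number -/

/-- `CopsCatch G c r`: in the game of Cops and Robbers on `G`, with the cops on the vertices `c`, the
robber on the vertex `r`, and the cops to move, the cops can force the capture of the robber. -/
inductive CopsCatch {V : Type*} (G : SimpleGraph V) {k : ℕ} : (Fin k → V) → V → Prop
  | caught (c : Fin k → V) (r : V) (i : Fin k) (h : c i = r) : CopsCatch G c r
  | capture (c c' : Fin k → V) (r : V) (hc : ∀ i, c' i = c i ∨ G.Adj (c i) (c' i))
      (i : Fin k) (h : c' i = r) : CopsCatch G c r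
  | chase (c c' : Fin k → V) (r : V) (hc : ∀ i, c' i = c i ∨ G.Adj (c i) (c' i))
      (h : ∀ r', (r' = r ∨ G.Adj r r') → CopsCatch G c' r') : CopsCatch G c r

/-- The cop number `c(G)`: the least number of cops that can choose initial vertices from which they
capture the robber wherever he starts. -/
def copNumber {V : Type*} (G : SimpleGraph V) : ℕ :=
  sInf {k | ∃ c : Fin k → V, ∀ r, CopsCatch G c r}

/-! ### Zombies and Survivors -/

/-- The positions of the `k` zombies at one time-step. -/
def Config (V : Type*) (k : ℕ) : Type _ := Fin k → V

instance {V : Type*} {k : ℕ} : MeasurableSpace (Config V k) := ⊤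

instance {V : Type*} {k : ℕ} : DiscreteMeasurableSpace (Config V k) := ⟨fun _ => trivial⟩

instance {V : Type*} [Finite V] {k : ℕ} : Finite (Config V k) :=
  inferInstanceAs (Finite (Fin k → V))

/-- The zombies' positions at the time-steps `0, …, t`. -/
abbrev History (V : Type*) (k t : ℕ) : Type _ := (i : Finset.Iic t) → Config V k

open scoped Classical in
/-- The vertices to which a zombie on `v` may move when the survivor is on `u`: the neighbours of `v`
that are closer to `u`. If there is none (in a connected graph: if `v = u`), it does not move. -/
def zombieOptions {V : Type*} (G : SimpleGraph V) (u v : V) : Set V :=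
  if {w | G.Adj v w ∧ G.dist w u < G.dist v u}.Nonempty then
    {w | G.Adj v w ∧ G.dist w u < G.dist v u}
  else {v}

/-- The possible joint moves of all zombies, from the configuration `c` with the survivor on `u`. -/
def jointOptions {V : Type*} (G : SimpleGraph V) {k : ℕ} (u : V) (c : Config V k) :
    Set (Config V k) :=
  {c' | ∀ i, c' i ∈ zombieOptions G u (c i)}

theorem zombieOptions_nonempty {V : Type*} (G : SimpleGraph V) (u v : V) :
    (zombieOptions G u v).Nonempty := by
  unfold zombieOptions
  split_ifs with h
  · exact h
  · exact Set.singleton_nonempty v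

theorem jointOptions_nonempty {V : Type*} (G : SimpleGraph V) {k : ℕ} (u : V) (c : Config V k) :
    (jointOptions G u c).Nonempty :=
  ⟨fun i => (zombieOptions_nonempty G u (c i)).some,
    fun i => (zombieOptions_nonempty G u (c i)).some_mem⟩

/-- A strategy of the survivor against `k` zombies on `G`. The position `pos t h` of the survivor after
round `t` is decided from the positions `h` of the zombies at the times `0, …, t` (his own earlier
positions are functions of the same data); `pos 0` is his choice of a starting vertex after the zombies
have been placed. In each round he moves to a neighbouring vertex or passes. -/
structure SurvivorStrategy {V : Type*} (G : SimpleGraph V) (k : ℕ) where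
  pos : (t : ℕ) → History V k t → V
  move : ∀ (t : ℕ) (z : ℕ → Config V k),
    pos (t + 1) (Preorder.frestrictLe (π := fun _ => Config V k) (t + 1) z)
        = pos t (Preorder.frestrictLe (π := fun _ => Config V k) t z) ∨
      G.Adj (pos t (Preorder.frestrictLe (π := fun _ => Config V k) t z))
        (pos (t + 1) (Preorder.frestrictLe (π := fun _ => Config V k) (t + 1) z))

namespace SurvivorStrategy

variable {V : Type*} {G : SimpleGraph V} {k : ℕ}

/-- The position of the survivor at time `t`, if the zombies' positions are `z 0, z 1, z 2, …`. -/
def traj (S : SurvivorStrategy G k) (z : ℕ → Config V k) (t : ℕ) : V :=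
  S.pos t (Preorder.frestrictLe (π := fun _ => Config V k) t z)

/-- The survivor is never eaten: at no time does he share a vertex with a zombie, neither after his own
move (or choice of a starting vertex) nor after the zombies' move of the next round. -/
def Survives (S : SurvivorStrategy G k) (z : ℕ → Config V k) : Prop :=
  ∀ t i, z t i ≠ S.traj z t ∧ z (t + 1) i ≠ S.traj z t

/-- The zombies' move in round `t + 1`: each zombie, independently of the others, chooses one of its
options uniformly at random, that is, the joint move is uniform on the product of the sets of
options. -/
def zombieKernel [Finite V] (S : SurvivorStrategy G k) (t : ℕ) :
    Kernel (History V k t) (Config V k) :=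
  Kernel.ofFunOfCountable fun h =>
    uniformOn (jointOptions G (S.pos t h) (h ⟨t, Finset.mem_Iic.2 le_rfl⟩))

instance [Finite V] (S : SurvivorStrategy G k) (t : ℕ) : IsMarkovKernel (S.zombieKernel t) :=
  ⟨fun _ => isProbabilityMeasure_uniformOn (Set.toFinite _) (jointOptions_nonempty G _ _)⟩

/-- The law of the zombies' positions `z 0, z 1, z 2, …` over the whole game against the strategy `S`:
the initial positions are independent and uniform, and then the zombies move at random as above. -/
def law [Finite V] (S : SurvivorStrategy G k) : Measure (ℕ → Config V k) :=
  Kernel.trajMeasure (X := fun _ => Config V k) (uniformOn Set.univ) S.zombieKernel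

end SurvivorStrategy

/-- `s_k(G)`: the probability that the survivor wins against `k` zombies if he plays optimally. -/
def survivalProb {V : Type*} [Finite V] (G : SimpleGraph V) (k : ℕ) : ℝ≥0∞ :=
  ⨆ S : SurvivorStrategy G k, S.law {z | S.Survives z}

/-- The zombie number `z(G)`. -/
def zombieNumber {V : Type*} [Finite V] (G : SimpleGraph V) : ℕ :=
  sInf {k | copNumber G ≤ k ∧ survivalProb G k ≤ 1 / 2}

/-! ### The toroidal grid -/

/-- The toroidal grid `T_n = C_n □ C_n`. -/
def torusGrid (n : ℕ) : SimpleGraph (Fin n × Fin n) :=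
  (SimpleGraph.cycleGraph n).boxProd (SimpleGraph.cycleGraph n)

/-- The `m × m` box with corner `p` in the `n × n` torus; coordinates are added modulo `n`. -/
def torusBox {n : ℕ} [NeZero n] (p : Fin n × Fin n) (m : ℕ) : Set (Fin n × Fin n) :=
  {v | ∃ i j : ℕ, i < m ∧ j < m ∧ v = (p.1 + Fin.ofNat n i, p.2 + Fin.ofNat n j)}

/-- The strategy `S` is `B`-boxed during the time period `[0, T]`: the starting vertex is in `B` and does
not depend on the zombies; the survivor stays in `B`, whatever the zombies do; and his moves do not
depend on the positions of zombies outside `B`. -/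
def SurvivorStrategy.IsBoxed {V : Type*} {G : SimpleGraph V} {k : ℕ} (S : SurvivorStrategy G k)
    (B : Set V) (T : ℕ) : Prop :=
  (∃ u₀ ∈ B, ∀ h, S.pos 0 h = u₀) ∧
  (∀ t ≤ T, ∀ h, S.pos t h ∈ B) ∧
  ∀ t ≤ T, ∀ h h' : History V k t,
    (∀ s i, h s i = h' s i ∨ (h s i ∉ B ∧ h' s i ∉ B)) → S.pos t h = S.pos t h'

/-- `j` is a turning point of the trajectory `u` on the time interval `[a, b]`. The first and the last
index count as turning points. -/
def IsTurningPoint {n : ℕ} [NeZero n] (u : ℕ → Fin n × Fin n) (a b j : ℕ) : Prop :=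
  j = a ∨ j = b ∨ (a < j ∧ j < b ∧ u j - u (j - 1) ≠ u (j + 1) - u j)

/-- The trajectory `u` on the torus is stable on the time interval `[a, b]`: every step goes to a
neighbouring vertex, no turn is by 180 degrees, and distinct turning points are at least
`⌊20 log n⌋` steps apart. -/
def IsStableTrajectory {n : ℕ} [NeZero n] (u : ℕ → Fin n × Fin n) (a b : ℕ) : Prop :=
  (∀ t, a ≤ t → t < b → (torusGrid n).Adj (u t) (u (t + 1))) ∧
  (∀ j, a < j → j < b → u j - u (j - 1) ≠ u (j + 1) - u j →
    u j - u (j - 1) ≠ -(u (j + 1) - u j)) ∧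
  ∀ j j', IsTurningPoint u a b j → IsTurningPoint u a b j' → j < j' →
    ⌊20 * Real.log n⌋₊ ≤ j' - j

/-- At time `t ≥ 1` every zombie is lined up behind the survivor, at distance `2` or `3`: if `d` is the
step by which the survivor arrived at his position `u t`, then each zombie is on the vertex `u t - 2 d`
or on the vertex `u t - 3 d`, and these vertices are at distance `2` and `3` from `u t`. -/
def LinedUpBehind {n k : ℕ} [NeZero n] (u : ℕ → Fin n × Fin n) (z : ℕ → Config (Fin n × Fin n) k)
    (t : ℕ) : Prop :=
  ∀ i, (z t i = u t - 2 • (u t - u (t - 1)) ∧ (torusGrid n).dist (z t i) (u t) = 2) ∨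
    (z t i = u t - 3 • (u t - u (t - 1)) ∧ (torusGrid n).dist (z t i) (u t) = 3)

end

/-! Put `g = ⌊20 log n⌋`. In coordinates centred in the box, the survivor runs counterclockwise
round the square `[-3g, 3g]²`. A zombie straight behind him at distance 2 or 3 keeps its distance
while he walks straight. If he turns left it steps up while he steps aside, so the distance is again
the same, and the lateral offset of at most 2 is used up by its next moves along that axis, long
before the next turn. Such a zombie is harmless forever (`Trails.straight`, `Trails.turn`). A new
zombie is put on the trail head-on: the survivor walks towards it until the gap is 2 or 3 and turns
left just after it has moved (`trails_of_head_on`). Then he returns to his circle; all this takes at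
most `200g` rounds.

The manoeuvre handles one zombie at a time, and the zombie must arrive near the middle of a side of
`[-80g, 80g]²`. The latter is automatic for a zombie that has had one coordinate in the range of the
square for a while: as the survivor circles, that coordinate is drawn into `[-3g, 3g]`
(`lat_le_of_circling`, `facing_of_entry`). `TameChase` lists what is needed: balanced coins, entries
more than `600g` apart, no entry near a corner. Its consequences are the invariant `inPhase`, the
final line-up `lined_up`, and `two_le_dist`, by which nobody is eaten.

Tame chases are typical by a count of starting points. For a zombie `j`, fix everything else and let
the survivor ignore `j`; until `j` enters, the true game looks the same (`play_eq_of_no_entry`). His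
path no longer depends on where `j` starts, and starting points with equal lateral coordinate are
driven in parallel until they enter from a given direction (`drive_agree`). Hence a lateral
coordinate and an entry time leave at most one starting point, and at most `4(k+1)n(600g+1)` of the
`n²` starting points of `j` are bad (`card_badEntry_le`). Summed over `j` this is of order `k² log n
/ n`, which vanishes for `k ≤ √n/(ω log n)`. A Chernoff bound handles the coins.

A zombie's move on the torus is a fair coin flip between at most two planar moves as long as nothing
wraps around (`zombieOptions_place`), so the law of the game dominates the count of pairs of starts
and coins (`card_le_law`). After time `4n` the survivor walks straight on forever. The bound on
`z(T_n)` follows because the success probability exceeds `1/2` for every `k` up to the threshold. -/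

/-! ### Planar frames -/

/-- The coordinate of `v` in the direction `d`. -/
def fwd (d v : ℤ × ℤ) : ℤ := d.1 * v.1 + d.2 * v.2

/-- The coordinate of `v` in the direction to the left of `d`. -/
def lat (d v : ℤ × ℤ) : ℤ := d.1 * v.2 - d.2 * v.1

/-- The direction `d` rotated to the left by a right angle. -/
def turnLeft (d : ℤ × ℤ) : ℤ × ℤ := (-d.2, d.1)

/-- `d` is one of the four unit steps of the grid. -/
def IsUnitStep (d : ℤ × ℤ) : Prop := d = (1, 0) ∨ d = (0, 1) ∨ d = (-1, 0) ∨ d = (0, -1)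

/-- The square `[-r, r]²`. -/
def InSquare (r : ℤ) (v : ℤ × ℤ) : Prop := |v.1| ≤ r ∧ |v.2| ≤ r

theorem IsUnitStep.turnLeft {d : ℤ × ℤ} (hd : IsUnitStep d) : IsUnitStep (turnLeft d) := by
  rcases hd with rfl | rfl | rfl | rfl <;> simp [IsUnitStep, _root_.turnLeft]

theorem fwd_add (d v w : ℤ × ℤ) : fwd d (v + w) = fwd d v + fwd d w := by
  simp only [fwd, Prod.fst_add, Prod.snd_add]; ring

theorem lat_add (d v w : ℤ × ℤ) : lat d (v + w) = lat d v + lat d w := by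
  simp only [lat, Prod.fst_add, Prod.snd_add]; ring

theorem fwd_turnLeft (d v : ℤ × ℤ) : fwd (turnLeft d) v = lat d v := by
  simp only [fwd, lat, turnLeft]; ring

theorem lat_turnLeft (d v : ℤ × ℤ) : lat (turnLeft d) v = -fwd d v := by
  simp only [fwd, lat, turnLeft]; ring

theorem IsUnitStep.fwd_self {d : ℤ × ℤ} (hd : IsUnitStep d) : fwd d d = 1 := by
  rcases hd with rfl | rfl | rfl | rfl <;> simp [fwd]

theorem lat_self (d : ℤ × ℤ) : lat d d = 0 := by simp only [lat]; ring

theorem IsUnitStep.inSquare_iff {d : ℤ × ℤ} (hd : IsUnitStep d) (r : ℤ) (v : ℤ × ℤ) :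
    InSquare r v ↔ |fwd d v| ≤ r ∧ |lat d v| ≤ r := by
  rcases hd with rfl | rfl | rfl | rfl <;> simp [fwd, lat, InSquare, and_comm]

theorem InSquare.mono {r r' : ℤ} {v : ℤ × ℤ} (h : InSquare r v) (hr : r ≤ r') : InSquare r' v :=
  ⟨h.1.trans hr, h.2.trans hr⟩

/-! ### The move of a zombie -/

/-- The move towards `u` from `z`; the coin `true` prefers the first axis. -/
def chaseStep (u z : ℤ × ℤ) (c : Bool) : ℤ × ℤ :=
  if z.1 ≠ u.1 ∧ (c = true ∨ z.2 = u.2) then (z.1 + Int.sign (u.1 - z.1), z.2)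
  else (z.1, z.2 + Int.sign (u.2 - z.2))

/-- The value of the coin that prefers the axis perpendicular to `d`. -/
def latCoin (d : ℤ × ℤ) : Bool := decide (d.1 = 0)

/-- The chase rule treats the two axes alike, so in any of the four frames it keeps its form; only
the coin value that prefers the lateral axis changes, to `latCoin d`. -/
theorem IsUnitStep.chaseStep_frame {d : ℤ × ℤ} (hd : IsUnitStep d) (u z : ℤ × ℤ) (c : Bool) :
    (lat d z ≠ lat d u ∧ (c = latCoin d ∨ fwd d z = fwd d u) ∧
      fwd d (chaseStep u z c) = fwd d z ∧
      lat d (chaseStep u z c) = lat d z + Int.sign (lat d u - lat d z)) ∨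
    ((lat d z = lat d u ∨ (c ≠ latCoin d ∧ fwd d z ≠ fwd d u)) ∧
      lat d (chaseStep u z c) = lat d z ∧
      fwd d (chaseStep u z c) = fwd d z + Int.sign (fwd d u - fwd d z)) := by
  obtain ⟨z1, z2⟩ := z
  obtain ⟨u1, u2⟩ := u
  have e1 : ∀ a b : ℤ, Int.sign (-a + b) = - Int.sign (-b + a) := fun a b => by
    rw [← Int.sign_neg]; congr 1; ring
  rcases hd with rfl | rfl | rfl | rfl <;> cases c <;> by_cases h1 : z1 = u1 <;> by_cases h2 : z2 = u2 <;>
    simp [fwd, lat, chaseStep, latCoin, h1, h2, sub_eq_add_neg] <;> (rw [e1]; ring_nf)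

theorem sign_cases (a : ℤ) :
    (0 < a ∧ Int.sign a = 1) ∨ (a = 0 ∧ Int.sign a = 0) ∨ (a < 0 ∧ Int.sign a = -1) := by
  rcases lt_trichotomy a 0 with h | h | h
  · exact Or.inr (Or.inr ⟨h, Int.sign_eq_neg_one_of_neg h⟩)
  · subst h; simp
  · exact Or.inl ⟨h, Int.sign_eq_one_of_pos h⟩

/-- One move, as seen in the frame of `d`, in a form suited to linear arithmetic. -/
theorem IsUnitStep.chaseStep_cases {d : ℤ × ℤ} (hd : IsUnitStep d) (u z : ℤ × ℤ) (c : Bool) :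
    (fwd d (chaseStep u z c) = fwd d z ∧
      ((lat d z < lat d u ∧ lat d (chaseStep u z c) = lat d z + 1) ∨
       (lat d u < lat d z ∧ lat d (chaseStep u z c) = lat d z - 1)) ∧
      (c = latCoin d ∨ fwd d z = fwd d u)) ∨
    (lat d (chaseStep u z c) = lat d z ∧
      ((fwd d z < fwd d u ∧ fwd d (chaseStep u z c) = fwd d z + 1) ∨
       (fwd d u < fwd d z ∧ fwd d (chaseStep u z c) = fwd d z - 1) ∨
       (fwd d z = fwd d u ∧ fwd d (chaseStep u z c) = fwd d z ∧ lat d z = lat d u)) ∧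
      (lat d z = lat d u ∨ c ≠ latCoin d)) := by
  rcases hd.chaseStep_frame u z c with ⟨h1, h2, h3, h4⟩ | ⟨h1, h2, h3⟩
  · left
    refine ⟨h3, ?_, h2⟩
    rcases sign_cases (lat d u - lat d z) with h | h | h <;> omega
  · right
    refine ⟨h2, ?_, h1.imp_right And.left⟩
    rcases sign_cases (fwd d u - fwd d z) with h | h | h
    · left; omega
    · right; right
      refine ⟨by omega, by omega, ?_⟩
      rcases h1 with h1 | h1
      · exact h1
      · exact absurd (by omega) h1.2
    · right; left; omega

/-- The number of coins of value `b` in the time interval `[s, t)`. -/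
def coinCount (c : ℕ → Bool) (b : Bool) (s t : ℕ) : ℕ := ((Finset.Ico s t).filter (c · = b)).card

theorem coinCount_self (c : ℕ → Bool) (b : Bool) (s : ℕ) : coinCount c b s s = 0 := by
  simp [coinCount]

theorem coinCount_of_le (c : ℕ → Bool) (b : Bool) {s t : ℕ} (h : t ≤ s) : coinCount c b s t = 0 := by
  simp [coinCount, Finset.Ico_eq_empty_of_le h]

theorem coinCount_succ (c : ℕ → Bool) (b : Bool) {s t : ℕ} (h : s ≤ t) :
    coinCount c b s (t + 1) = coinCount c b s t + if c t = b then 1 else 0 := by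
  unfold coinCount
  rw [← Finset.insert_Ico_right_eq_Ico_add_one h, Finset.filter_insert]
  split_ifs with hc
  · rw [Finset.card_insert_of_notMem (by simp)]
  · simp

theorem coinCount_succ_le (c : ℕ → Bool) (b : Bool) (s t : ℕ) :
    coinCount c b s (t + 1) ≤ coinCount c b s t + if c t = b then 1 else 0 := by
  rcases le_or_gt s t with h | h
  · exact (coinCount_succ c b h).le
  · rw [coinCount_of_le c b (by omega)]; omega

theorem coinCount_add (c : ℕ → Bool) (b : Bool) {r s t : ℕ} (h : r ≤ s) (h' : s ≤ t) :
    coinCount c b r t = coinCount c b r s + coinCount c b s t := by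
  unfold coinCount
  rw [← Finset.Ico_union_Ico_eq_Ico h h', Finset.filter_union, Finset.card_union_of_disjoint]
  exact Finset.disjoint_filter_filter (Finset.Ico_disjoint_Ico_consecutive r s t)

theorem coinCount_mono (c : ℕ → Bool) (b : Bool) {r s t : ℕ} (h' : s ≤ t) :
    coinCount c b r s ≤ coinCount c b r t :=
  Finset.card_le_card (Finset.filter_subset_filter _ (Finset.Ico_subset_Ico_right h'))

/-- Up to time `T`, each of the two values makes up at least a quarter of the coins in all intervals of
length `4 g`. -/
def BalancedCoins (g T : ℕ) (c : ℕ → Bool) : Prop :=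
  ∀ b a, a + 4 * g ≤ T → g ≤ coinCount c b a (a + 4 * g)

theorem BalancedCoins.mul_le {g T : ℕ} {c : ℕ → Bool} (h : BalancedCoins g T c) (b : Bool) (a m : ℕ)
    (ha : a + 4 * g * m ≤ T) : g * m ≤ coinCount c b a (a + 4 * g * m) := by
  induction m with
  | zero => simp
  | succ m ih =>
    have e : a + 4 * g * (m + 1) = a + 4 * g * m + 4 * g := by ring
    rw [e] at ha ⊢
    have := h b (a + 4 * g * m) (by omega)
    rw [coinCount_add c b (show a ≤ a + 4 * g * m by omega) (by omega)]
    have := ih (by omega)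
    rw [mul_add]
    omega

/-! ### The survivor's route -/

/-- The condition for a left turn of the survivor with position `s.1` and direction `s.2` at time `t`,
with the zombies on the vertices of `P`. -/
def TurnsLeft (g T t : ℕ) (P : Set (ℤ × ℤ)) (s : (ℤ × ℤ) × (ℤ × ℤ)) : Prop :=
  t + 5 * g ≤ T ∧ 3 * (g : ℤ) ≤ fwd s.2 s.1 ∧
    ∀ v ∈ P, InSquare (80 * g) v → fwd s.2 v - fwd s.2 s.1 < 3

open scoped Classical in
/-- The survivor's position and direction at time `t + 1`. -/
noncomputable def advance (g T t : ℕ) (P : Set (ℤ × ℤ)) (s : (ℤ × ℤ) × (ℤ × ℤ)) : (ℤ × ℤ) × (ℤ × ℤ) :=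
  if TurnsLeft g T t P s then (s.1 + turnLeft s.2, turnLeft s.2) else (s.1 + s.2, s.2)

/-- The survivor's position and direction if the zombies at time `t` are on the vertices of `P t`. -/
noncomputable def route (g T : ℕ) (P : ℕ → Set (ℤ × ℤ)) : ℕ → (ℤ × ℤ) × (ℤ × ℤ)
  | 0 => ((-3 * g, -3 * g), (1, 0))
  | t + 1 => advance g T t (P (t + 1)) (route g T P t)

section route

variable (g T : ℕ) (P : ℕ → Set (ℤ × ℤ))

theorem route_turn {t : ℕ} (h : TurnsLeft g T t (P (t + 1)) (route g T P t)) :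
    (route g T P (t + 1)).2 = turnLeft (route g T P t).2 ∧
    (route g T P (t + 1)).1 = (route g T P t).1 + turnLeft (route g T P t).2 := by
  simp [route, advance, h]

theorem route_straight {t : ℕ} (h : ¬ TurnsLeft g T t (P (t + 1)) (route g T P t)) :
    (route g T P (t + 1)).2 = (route g T P t).2 ∧
    (route g T P (t + 1)).1 = (route g T P t).1 + (route g T P t).2 := by
  simp [route, advance, h]

theorem route_fst_succ (t : ℕ) :
    (route g T P (t + 1)).1 = (route g T P t).1 + (route g T P (t + 1)).2 := by
  by_cases h : TurnsLeft g T t (P (t + 1)) (route g T P t)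
  · rw [(route_turn g T P h).1, (route_turn g T P h).2]
  · rw [(route_straight g T P h).1, (route_straight g T P h).2]

theorem isUnitStep_route (t : ℕ) : IsUnitStep (route g T P t).2 := by
  induction t with
  | zero => simp [route, IsUnitStep]
  | succ t ih =>
    by_cases h : TurnsLeft g T t (P (t + 1)) (route g T P t)
    · rw [(route_turn g T P h).1]; exact ih.turnLeft
    · rw [(route_straight g T P h).1]; exact ih

/-- The frame coordinates after a turn. -/
theorem route_turn_frame {t : ℕ} (h : TurnsLeft g T t (P (t + 1)) (route g T P t)) :
    fwd (route g T P (t + 1)).2 (route g T P (t + 1)).1 =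
      lat (route g T P t).2 (route g T P t).1 + 1 ∧
    lat (route g T P (t + 1)).2 (route g T P (t + 1)).1 =
      -fwd (route g T P t).2 (route g T P t).1 := by
  have hd := (isUnitStep_route g T P t).turnLeft
  rw [(route_turn g T P h).1, (route_turn g T P h).2, fwd_add, lat_add, hd.fwd_self, lat_self,
    fwd_turnLeft, lat_turnLeft]
  simp

/-- The frame coordinates after a step straight ahead. -/
theorem route_straight_frame {t : ℕ} (h : ¬ TurnsLeft g T t (P (t + 1)) (route g T P t)) :
    fwd (route g T P (t + 1)).2 (route g T P (t + 1)).1 =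
      fwd (route g T P t).2 (route g T P t).1 + 1 ∧
    lat (route g T P (t + 1)).2 (route g T P (t + 1)).1 =
      lat (route g T P t).2 (route g T P t).1 := by
  have hd := isUnitStep_route g T P t
  rw [(route_straight g T P h).1, (route_straight g T P h).2, fwd_add, lat_add, hd.fwd_self, lat_self]
  simp

/-- Beyond `3g` the survivor goes on only for a zombie of the square `[-80g, 80g]²` that is at least
3 ahead, so he is then at `80g - 3` at most and steps to `80g - 2` at most. A left turn swaps the
two coordinates up to sign, so the bound is inherited by the lateral one. -/
theorem route_bounds (hg : 1 ≤ g) (t : ℕ) (ht : t + 5 * g ≤ T + 1) :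
    lat (route g T P t).2 (route g T P t).1 ≤ -3 * g ∧
    -(80 * (g : ℤ) - 2) ≤ lat (route g T P t).2 (route g T P t).1 ∧
    |fwd (route g T P t).2 (route g T P t).1| ≤ 80 * (g : ℤ) - 2 := by
  induction t with
  | zero => simp [route, fwd, lat]; omega
  | succ t ih =>
    obtain ⟨h1, h2, h3⟩ := ih (by omega)
    rw [abs_le] at h3
    by_cases h : TurnsLeft g T t (P (t + 1)) (route g T P t)
    · obtain ⟨e1, e2⟩ := route_turn_frame g T P h
      rw [e1, e2, abs_le]
      have := h.2.1
      omega
    · obtain ⟨e1, e2⟩ := route_straight_frame g T P h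
      rw [e1, e2, abs_le]
      refine ⟨h1, h2, by omega, ?_⟩
      simp only [TurnsLeft, not_and, not_forall, not_lt] at h
      by_cases h4 : 3 * (g : ℤ) ≤ fwd (route g T P t).2 (route g T P t).1
      · obtain ⟨v, -, hv, hv'⟩ := h (by omega) h4
        have := ((isUnitStep_route g T P t).inSquare_iff _ _).1 hv
        have := this.1
        rw [abs_le] at this
        omega
      · omega

theorem route_inSquare (hg : 1 ≤ g) (t : ℕ) (ht : t + 5 * g ≤ T + 1) :
    InSquare (80 * g - 2) (route g T P t).1 := by
  rw [(isUnitStep_route g T P t).inSquare_iff]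
  obtain ⟨h1, h2, h3⟩ := route_bounds g T P hg t ht
  exact ⟨h3, abs_le.2 ⟨h2, by omega⟩⟩

theorem not_turnsLeft {t : ℕ} (ht : T < t + 5 * g) (Q : Set (ℤ × ℤ)) (s : (ℤ × ℤ) × (ℤ × ℤ)) :
    ¬ TurnsLeft g T t Q s := fun h => by have := h.1; omega

theorem route_final (t₀ : ℕ) (ht₀ : T < t₀ + 5 * g) (m : ℕ) :
    (route g T P (t₀ + m)).2 = (route g T P t₀).2 ∧
    (route g T P (t₀ + m)).1 = (route g T P t₀).1 + m • (route g T P t₀).2 := by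
  induction m with
  | zero => simp
  | succ m ih =>
    obtain ⟨e1, e2⟩ := route_straight g T P
      (not_turnsLeft g T (by omega) (P (t₀ + m + 1)) (route g T P (t₀ + m)))
    rw [← add_assoc, e1, e2, ih.1, ih.2]
    refine ⟨rfl, ?_⟩
    module

/-- The turn rule is switched off in the last `5g` rounds, and fewer than `5g` straight steps are
added to the bound `80g - 2`. -/
theorem route_inSquare_of_le (hg : 1 ≤ g) (hT : 5 * g ≤ T) (t : ℕ) (ht : t ≤ T) :
    InSquare (85 * g) (route g T P t).1 := by
  rcases le_or_gt (t + 5 * g) (T + 1) with h | h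
  · exact (route_inSquare g T P hg t h).mono (by omega)
  · obtain ⟨t₀, h0⟩ : ∃ t₀, t₀ + 5 * g = T + 1 := ⟨T + 1 - 5 * g, by omega⟩
    obtain ⟨m, rfl⟩ : ∃ m, t = t₀ + m := ⟨t - t₀, by omega⟩
    obtain ⟨e1, e2⟩ := route_final g T P t₀ (by omega) m
    have h1 := route_inSquare g T P hg t₀ (by omega)
    rw [(isUnitStep_route g T P t₀).inSquare_iff, abs_le, abs_le] at h1
    have e3 : ∀ w, fwd w (m • w) = m * fwd w w := fun w => by
      simp only [fwd, Prod.smul_fst, Prod.smul_snd]; simp only [nsmul_eq_mul]; ring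
    have e4 : ∀ w, lat w (m • w) = 0 := fun w => by
      simp only [lat, Prod.smul_fst, Prod.smul_snd]; simp only [nsmul_eq_mul]; ring
    rw [e2, (isUnitStep_route g T P t₀).inSquare_iff, fwd_add, lat_add, e3, e4,
      (isUnitStep_route g T P t₀).fwd_self, abs_le, abs_le]
    omega

theorem route_lat_le (t : ℕ) : lat (route g T P t).2 (route g T P t).1 ≤ -3 * g := by
  induction t with
  | zero => simp [route, lat]
  | succ t ih =>
    by_cases h : TurnsLeft g T t (P (t + 1)) (route g T P t)
    · rw [(route_turn_frame g T P h).2]; have := h.2.1; omega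
    · rw [(route_straight_frame g T P h).2]; exact ih

/-- If at time `a` the survivor is at the start of a side, he does not turn in the following `6 g`
steps. -/
theorem route_no_turn {a : ℕ} (ha : fwd (route g T P a).2 (route g T P a).1 ≤ -3 * g + 1) (m : ℕ)
    (hm : m + 1 < 6 * g) :
    fwd (route g T P (a + m)).2 (route g T P (a + m)).1 ≤ -3 * g + 1 + m ∧
    ¬ TurnsLeft g T (a + m) (P (a + m + 1)) (route g T P (a + m)) := by
  have key : fwd (route g T P (a + m)).2 (route g T P (a + m)).1 ≤ -3 * g + 1 + m := by
    induction m with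
    | zero => simpa using ha
    | succ m ih =>
      have h1 := ih (by omega)
      have h2 : ¬ TurnsLeft g T (a + m) (P (a + m + 1)) (route g T P (a + m)) := fun h => by
        have := h.2.1; omega
      have := (route_straight_frame g T P h2).1
      rw [← add_assoc]
      push_cast
      omega
  exact ⟨key, fun h => by have := h.2.1; omega⟩

/-- A turn leaves the forward coordinate at `-3g + 1` or less, and the next turn requires `3g`. -/
theorem route_turn_gap {j j' : ℕ} (hjj : j < j')
    (hj : TurnsLeft g T j (P (j + 1)) (route g T P j))
    (hj' : TurnsLeft g T j' (P (j' + 1)) (route g T P j')) : j + 6 * g ≤ j' := by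
  by_contra! h
  obtain ⟨m, rfl⟩ : ∃ m, j' = j + 1 + m := ⟨j' - (j + 1), by omega⟩
  have h1 := (route_turn_frame g T P hj).1
  have h2 := route_lat_le g T P j
  exact (route_no_turn g T P (a := j + 1) (by omega) m (by omega)).2 hj'

theorem route_first_turn {j : ℕ} (hj : TurnsLeft g T j (P (j + 1)) (route g T P j)) :
    6 * g ≤ j + 1 := by
  by_contra! h
  have := (route_no_turn g T P (a := 0) (by simp [route, fwd]) j (by omega)).2
  simp only [zero_add] at this
  exact this hj

end route

/-! ### Zombies on the survivor's track -/

/-- The zombie on `z` is behind the survivor at distance `2` or `3`, and it is lined up behind him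
unless his last turn (at time `τ`) was recent. -/
def Trails (g T : ℕ) (c : ℕ → Bool) (t : ℕ) (u d z : ℤ × ℤ) : Prop :=
  ∃ τ ≤ t, τ + 5 * g ≤ T ∧ fwd d u ≤ -3 * g + (t - τ) ∧ fwd d z - fwd d u ≤ -1 ∧
    (|fwd d z - fwd d u| + |lat d z - lat d u| = 2 ∨ |fwd d z - fwd d u| + |lat d z - lat d u| = 3) ∧
    (lat d z = lat d u ∨ |lat d z - lat d u| + coinCount c (latCoin d) (τ + 1) t ≤ 2)

section Trails

variable {g T t : ℕ} {c : ℕ → Bool} {u d z : ℤ × ℤ}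

/-- A forward move of the zombie keeps the gap; a lateral move lengthens the gap by 1 and shortens
the offset by 1. Either way the distance is preserved. As the zombie is strictly behind, a lateral
coin reduces a nonzero offset, so offset plus lateral coins does not grow. -/
theorem Trails.straight (hd : IsUnitStep d) (h : Trails g T c t u d z) :
    Trails g T c (t + 1) (u + d) d (chaseStep u z (c t)) := by
  obtain ⟨τ, h1, h2, h3, h4, h5, h6⟩ := h
  refine ⟨τ, by omega, h2, ?_⟩
  have hc := coinCount_succ_le c (latCoin d) (τ + 1) t
  have := hd.chaseStep_cases u z (c t)
  rw [fwd_add, lat_add, hd.fwd_self, lat_self]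
  generalize fwd d (chaseStep u z (c t)) = a at *
  generalize lat d (chaseStep u z (c t)) = b at *
  simp only [abs_eq_max_neg] at *
  push_cast
  by_cases hcc : c t = latCoin d
  · simp only [hcc, if_true, ne_eq, not_true, or_false, true_or, and_true] at *
    refine ⟨by omega, by omega, by omega, by omega⟩
  · simp only [hcc, if_false, ne_eq, false_or, not_false_eq_true, or_true, and_true] at *
    refine ⟨by omega, by omega, by omega, by omega⟩

theorem Trails.not_ahead (hd : IsUnitStep d) (h : Trails g T c t u d z) :
    fwd d (chaseStep u z (c t)) - fwd d u < 3 := by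
  obtain ⟨τ, h1, h2, h3, h4, h5, h6⟩ := h
  have := hd.chaseStep_cases u z (c t)
  omega

/-- In both cases more than `4g` rounds have passed since the turn at `τ`, so at least `g ≥ 3`
lateral coins have come up, too many for an offset of at most 2 to survive. -/
theorem Trails.lat_eq (hg : 3 ≤ g) (hc : BalancedCoins g T c) (ht : t ≤ T)
    (h : Trails g T c t u d z) (hu : 3 * (g : ℤ) ≤ fwd d u ∨ t = T) : lat d z = lat d u := by
  obtain ⟨τ, h1, h2, h3, h4, h5, h6⟩ := h
  refine h6.resolve_right fun h => ?_
  have h7 : τ + 1 + 4 * g ≤ t := by omega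
  have := hc (latCoin d) (τ + 1) (by omega)
  have := coinCount_mono c (latCoin d) (r := τ + 1) h7
  have := abs_nonneg (lat d z - lat d u)
  omega

/-- The lined-up zombie closes its gap to 1 or 2, which becomes its lateral offset in the new frame,
and the survivor's sidestep adds 1 to the distance. -/
theorem Trails.turn (hd : IsUnitStep d) (hg : 3 ≤ g) (hc : BalancedCoins g T c)
    (ht : t + 5 * g ≤ T) (hu : 3 * (g : ℤ) ≤ fwd d u) (hl : lat d u ≤ -3 * g)
    (h : Trails g T c t u d z) :
    Trails g T c (t + 1) (u + turnLeft d) (turnLeft d) (chaseStep u z (c t)) := by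
  have hz := h.lat_eq hg hc (by omega) (Or.inl hu)
  obtain ⟨τ, h1, h2, h3, h4, h5, h6⟩ := h
  -- The clock `τ` is reset to this turn, and the interval `[t + 1, t + 1)` contains no coins yet.
  refine ⟨t, by omega, ht, ?_⟩
  rw [coinCount_self, fwd_add, lat_add, hd.turnLeft.fwd_self, lat_self, fwd_turnLeft, fwd_turnLeft,
    lat_turnLeft, lat_turnLeft]
  have := hd.chaseStep_cases u z (c t)
  simp only [abs_eq_max_neg] at *
  push_cast
  refine ⟨by omega, by omega, by omega, by omega⟩

/-- A zombie straight ahead at distance `2` or `3` is behind the survivor after his turn. -/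
theorem trails_of_head_on (hd : IsUnitStep d)
    (ht : t + 5 * g ≤ T) (hl : lat d u ≤ -3 * g) (hz : lat d z = lat d u)
    (h2 : 2 ≤ fwd d z - fwd d u) (h3 : fwd d z - fwd d u ≤ 3) :
    Trails g T c (t + 1) (u + turnLeft d) (turnLeft d) (chaseStep u z (c t)) := by
  -- The zombie comes up to gap 1 or 2; after the survivor's sidestep it is one step behind him with
  -- lateral offset 1 or 2 in absolute value, at distance 2 or 3.
  refine ⟨t, by omega, ht, ?_⟩
  rw [coinCount_self, fwd_add, lat_add, hd.turnLeft.fwd_self, lat_self, fwd_turnLeft, fwd_turnLeft,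
    lat_turnLeft, lat_turnLeft]
  have := hd.chaseStep_cases u z (c t)
  simp only [abs_eq_max_neg] at *
  push_cast
  refine ⟨by omega, by omega, by omega, by omega⟩

end Trails

/-- `θ` is the time of the first visit of the sequence `z` to the square `[-80 g, 80 g]²`. -/
def FirstEntry (g : ℕ) (z : ℕ → ℤ × ℤ) (θ : ℕ) : Prop :=
  InSquare (80 * g) (z θ) ∧ ∀ s < θ, ¬ InSquare (80 * g) (z s)

theorem exists_firstEntry {g : ℕ} {z : ℕ → ℤ × ℤ} {t : ℕ} (h : InSquare (80 * g) (z t)) :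
    ∃ θ ≤ t, FirstEntry g z θ := by
  classical
  have hex : ∃ t, InSquare (80 * g) (z t) := ⟨t, h⟩
  exact ⟨Nat.find hex, Nat.find_min' hex h, Nat.find_spec hex, fun s hs => Nat.find_min hex hs⟩

theorem FirstEntry.unique {g : ℕ} {z : ℕ → ℤ × ℤ} {θ θ' : ℕ} (h : FirstEntry g z θ)
    (h' : FirstEntry g z θ') : θ = θ' := by
  rcases lt_trichotomy θ θ' with hlt | heq | hlt
  · exact absurd h.1 (h'.2 θ hlt)
  · exact heq
  · exact absurd h'.1 (h.2 θ' hlt)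

/-- A game of zombies against the survivor's route in which the coins are balanced, the zombies enter
the square `[-80 g, 80 g]²` one by one, and none enters it close to a corner. -/
structure TameChase {ι : Type*} (g T : ℕ) (P : ℕ → Set (ℤ × ℤ)) (c : ℕ → ι → Bool)
    (Z : ℕ → ι → ℤ × ℤ) : Prop where
  three_le : 3 ≤ g
  range : ∀ t, P t = Set.range (Z t)
  step : ∀ t i, Z (t + 1) i = chaseStep (route g T P t).1 (Z t i) (c t i)
  balanced : ∀ i, BalancedCoins g T (c · i)
  arrive : ∀ i, ∃ t, t + 800 * g ≤ T ∧ InSquare (80 * g) (Z t i)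
  separated : ∀ i j, i ≠ j → ∀ θ θ', FirstEntry g (Z · i) θ → FirstEntry g (Z · j) θ' → θ ≤ θ' →
    θ + 600 * g < θ'
  side : ∀ i θ, FirstEntry g (Z · i) θ →
    ∃ s, s + 600 * g ≤ θ ∧ (|(Z s i).1| ≤ 80 * g ∨ |(Z s i).2| ≤ 80 * g)

/-- The zombie with path `z` has visited the square `[-80 g, 80 g]²` by time `t`. -/
def Seen (g : ℕ) (z : ℕ → ℤ × ℤ) (t : ℕ) : Prop := ∃ s ≤ t, InSquare (80 * g) (z s)

/-! ### The phases of the survivor's movement -/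

namespace TameChase

variable {ι : Type*} {g T : ℕ} {P : ℕ → Set (ℤ × ℤ)} {c : ℕ → ι → Bool} {Z : ℕ → ι → ℤ × ℤ}

/-- All zombies seen so far, other than those with property `p`, trail the survivor. -/
def TrailExcept (g T : ℕ) (P : ℕ → Set (ℤ × ℤ)) (c : ℕ → ι → Bool) (Z : ℕ → ι → ℤ × ℤ)
    (p : ι → Prop) (t : ℕ) : Prop :=
  ∀ i, ¬ p i → Seen g (Z · i) t → Trails g T (c · i) t (route g T P t).1 (route g T P t).2 (Z t i)

theorem trailExcept_succ (h : TameChase g T P c Z) {p : ι → Prop} {t : ℕ}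
    (hp : TrailExcept g T P c Z p t) (hs : ∀ i, ¬ p i → Seen g (Z · i) (t + 1) → Seen g (Z · i) t) :
    TrailExcept g T P c Z p (t + 1) := by
  intro i hi hi'
  have h1 := hp i hi (hs i hi hi')
  have hd := isUnitStep_route g T P t
  have hZ := h.step t i
  by_cases ht : TurnsLeft g T t (P (t + 1)) (route g T P t)
  · rw [(route_turn g T P ht).1, (route_turn g T P ht).2, hZ]
    exact h1.turn hd h.three_le (h.balanced i) ht.1 ht.2.1 (route_lat_le g T P t)
  · rw [(route_straight g T P ht).1, (route_straight g T P ht).2, hZ]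
    exact h1.straight hd

/-- Only zombies with property `p` can keep the survivor from turning. -/
theorem turnsLeft_of (h : TameChase g T P c Z) {p : ι → Prop} {t : ℕ}
    (hp : TrailExcept g T P c Z p t) (hs : ∀ i, ¬ p i → Seen g (Z · i) (t + 1) → Seen g (Z · i) t)
    (ht : t + 5 * g ≤ T) (hu : 3 * (g : ℤ) ≤ fwd (route g T P t).2 (route g T P t).1)
    (hpi : ∀ i, p i → InSquare (80 * g) (Z (t + 1) i) →
      fwd (route g T P t).2 (Z (t + 1) i) - fwd (route g T P t).2 (route g T P t).1 < 3) :
    TurnsLeft g T t (P (t + 1)) (route g T P t) := by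
  refine ⟨ht, hu, ?_⟩
  rw [h.range]
  rintro v ⟨i, rfl⟩ hv
  by_cases hi : p i
  · exact hpi i hi hv
  · have h1 := hp i hi (hs i hi ⟨t + 1, le_rfl, hv⟩)
    have h2 := h1.not_ahead (isUnitStep_route g T P t)
    have h3 := h.step t i
    rw [h3]
    exact h2

/-- The survivor circles round the square `[-3 g, 3 g]²` with all zombies that he has seen behind
him. -/
def Circling (g T : ℕ) (P : ℕ → Set (ℤ × ℤ)) (c : ℕ → ι → Bool) (Z : ℕ → ι → ℤ × ℤ) (t : ℕ) : Prop :=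
  lat (route g T P t).2 (route g T P t).1 = -3 * g ∧
  |fwd (route g T P t).2 (route g T P t).1| ≤ 3 * g ∧
  TrailExcept g T P c Z (fun _ => False) t

/-- The survivor is on his way back after he has captured the zombie `j`. -/
def Returning (g T : ℕ) (P : ℕ → Set (ℤ × ℤ)) (c : ℕ → ι → Bool) (Z : ℕ → ι → ℤ × ℤ) (t : ℕ) : Prop :=
  ∃ j θ, FirstEntry g (Z · j) θ ∧ θ ≤ t ∧
  fwd (route g T P t).2 (route g T P t).1 ≤ 3 * g ∧
  (lat (route g T P t).2 (route g T P t).1 = -3 * g ∧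
      (t : ℤ) - θ + (3 * g - fwd (route g T P t).2 (route g T P t).1) ≤ 200 * g ∨
    (t : ℤ) - θ + (3 * g - fwd (route g T P t).2 (route g T P t).1) ≤ 115 * g) ∧
  TrailExcept g T P c Z (fun _ => False) t

/-- The zombie on `z` is in the direction in which the survivor will walk after `q` left turns. -/
def Facing (d z : ℤ × ℤ) (q : ℕ) (r s : ℤ) : Prop :=
  (q = 0 ∧ r ≤ fwd d z ∧ |lat d z| ≤ s) ∨ (q = 1 ∧ r ≤ lat d z ∧ |fwd d z| ≤ s) ∨
  (q = 2 ∧ r ≤ -fwd d z ∧ |lat d z| ≤ s) ∨ (q = 3 ∧ r ≤ -lat d z ∧ |fwd d z| ≤ s)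

/-- The zombie `j` has entered, and the survivor continues on his circle until he faces it. -/
def Waiting (g T : ℕ) (P : ℕ → Set (ℤ × ℤ)) (c : ℕ → ι → Bool) (Z : ℕ → ι → ℤ × ℤ) (t : ℕ) : Prop :=
  ∃ j θ, FirstEntry g (Z · j) θ ∧ θ ≤ t ∧
  lat (route g T P t).2 (route g T P t).1 = -3 * g ∧
  |fwd (route g T P t).2 (route g T P t).1| ≤ 3 * g ∧
  InSquare (80 * g) (Z t j) ∧
  (∃ q : ℕ, 1 ≤ q ∧ Facing (route g T P t).2 (Z t j) q (80 * g - (t - θ)) (3 * g) ∧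
    (t : ℤ) - θ + 6 * g * q + (3 * g - fwd (route g T P t).2 (route g T P t).1) ≤ 24 * g) ∧
  TrailExcept g T P c Z (· = j) t

/-- The survivor, since time `t₁`, walks towards the zombie `j`. -/
def Approaching (g T : ℕ) (P : ℕ → Set (ℤ × ℤ)) (c : ℕ → ι → Bool) (Z : ℕ → ι → ℤ × ℤ) (t : ℕ) :
    Prop :=
  ∃ j θ t₁, FirstEntry g (Z · j) θ ∧ θ ≤ t ∧ t₁ ≤ t ∧ t₁ ≤ θ + 24 * g ∧
  lat (route g T P t).2 (route g T P t).1 = -3 * g ∧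
  (t : ℤ) - t₁ - 3 * g ≤ fwd (route g T P t).2 (route g T P t).1 ∧
  fwd (route g T P t).2 (route g T P t).1 ≤ (t : ℤ) - t₁ + 3 * g + 1 ∧
  fwd (route g T P t).2 (Z t j) ≤ 80 * g ∧
  |lat (route g T P t).2 (Z t j)| ≤ 3 * g ∧
  2 ≤ fwd (route g T P t).2 (Z t j) - fwd (route g T P t).2 (route g T P t).1 ∧
  80 * g - 27 * g - 1 - 2 * ((t : ℤ) - t₁) ≤
    fwd (route g T P t).2 (Z t j) - fwd (route g T P t).2 (route g T P t).1 ∧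
  (lat (route g T P t).2 (Z t j) = -3 * g ∨
    lat (route g T P t).2 (Z t j) + 3 * g +
      coinCount (c · j) (latCoin (route g T P t).2) t₁ t ≤ 6 * g) ∧
  TrailExcept g T P c Z (· = j) t

/-- What the survivor is doing at time `t`. -/
def InPhase (g T : ℕ) (P : ℕ → Set (ℤ × ℤ)) (c : ℕ → ι → Bool) (Z : ℕ → ι → ℤ × ℤ) (t : ℕ) : Prop :=
  Circling g T P c Z t ∨ Returning g T P c Z t ∨ Waiting g T P c Z t ∨ Approaching g T P c Z t

/-- Every phase other than circling carries a time budget counted from the entry of the zombie that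
caused it, and `200g` is the largest. It stays well below the `600g` that separate entries. -/
theorem circling_or_recent {t : ℕ} (h : InPhase g T P c Z t) :
    Circling g T P c Z t ∨ ∃ j θ, FirstEntry g (Z · j) θ ∧ θ ≤ t ∧ t ≤ θ + 200 * g := by
  rcases h with h | ⟨j, θ, h1, h2, h3, h4, -⟩ | ⟨j, θ, h1, h2, h3, h4, h5, ⟨q, hq, h6, h7⟩, h8⟩ |
      ⟨j, θ, t₁, h1, h2, h3, h4, h5, h6, h7, h8, h9, h10, h11, -⟩
  · exact Or.inl h
  · exact Or.inr ⟨j, θ, h1, h2, by omega⟩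
  · refine Or.inr ⟨j, θ, h1, h2, ?_⟩
    rw [abs_le] at h4
    have : (0 : ℤ) ≤ 6 * g * q := by positivity
    omega
  · exact Or.inr ⟨j, θ, h1, h2, by omega⟩

/-- All seen zombies trail the survivor, so none is 3 ahead and he turns exactly at `3g`. -/
theorem circling_succ (h : TameChase g T P c Z) {t : ℕ} (ht : t + 5 * g ≤ T)
    (hc : Circling g T P c Z t) (hs : ∀ i, Seen g (Z · i) (t + 1) → Seen g (Z · i) t) :
    Circling g T P c Z (t + 1) := by
  obtain ⟨h1, h2, h3⟩ := hc
  have hs' := fun i (_ : ¬ False) => hs i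
  have hg := h.three_le
  refine ⟨?_, ?_, h.trailExcept_succ h3 hs'⟩ <;> rw [abs_le] at * <;>
  by_cases htl : TurnsLeft g T t (P (t + 1)) (route g T P t)
  · rw [(route_turn_frame g T P htl).2]; have := htl.2.1; omega
  · rw [(route_straight_frame g T P htl).2]; omega
  · have := htl.2.1
    rw [(route_turn_frame g T P htl).1]; omega
  · have h4 : ¬ 3 * (g : ℤ) ≤ fwd (route g T P t).2 (route g T P t).1 :=
      fun h4 => htl (h.turnsLeft_of h3 hs' ht h4 (fun i hi => hi.elim))
    rw [(route_straight_frame g T P htl).1]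
    omega

/-- The quantity `t - θ + (3g - fwd)` is the time after entry at which the current side will be
finished, and it is constant along a side. The first side after the capture is finished by `115g`;
the turn at its end puts the survivor on a line of the circle, possibly far before the circle's
corner. -/
theorem returning_succ (h : TameChase g T P c Z) {t : ℕ} (ht : t + 5 * g ≤ T)
    (hc : Returning g T P c Z t) (hs : ∀ i, Seen g (Z · i) (t + 1) → Seen g (Z · i) t) :
    Circling g T P c Z (t + 1) ∨ Returning g T P c Z (t + 1) := by
  obtain ⟨j, θ, h0, h1, h2, h4, h3⟩ := hc
  have hs' := fun i (_ : ¬ False) => hs i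
  have h5 := h.trailExcept_succ h3 hs'
  have hb := route_bounds g T P (by have := h.three_le; omega) t (by omega)
  by_cases htl : TurnsLeft g T t (P (t + 1)) (route g T P t)
  · have h6 := htl.2.1
    have e := route_turn_frame g T P htl
    -- The new forward coordinate is the old lateral one plus 1. If it is at least `-3g`, the circle
    -- is reached; if not, at most about `83g` steps remain on this line, and `115g + 83g` fits into
    -- `200g`.
    by_cases h7 : -3 * (g : ℤ) ≤ lat (route g T P t).2 (route g T P t).1 + 1
    · left
      refine ⟨by omega, ?_, h5⟩
      rw [abs_le]; omega
    · right
      refine ⟨j, θ, h0, by omega, by omega, Or.inl ⟨by omega, ?_⟩, h5⟩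
      push_cast
      omega
  · have h6 : ¬ 3 * (g : ℤ) ≤ fwd (route g T P t).2 (route g T P t).1 :=
      fun h6 => htl (h.turnsLeft_of h3 hs' ht h6 (fun i hi => hi.elim))
    have e := route_straight_frame g T P htl
    right
    refine ⟨j, θ, h0, by omega, by omega, ?_, h5⟩
    push_cast
    omega

theorem Facing.turn {d z : ℤ × ℤ} {q : ℕ} {r s : ℤ} (h : Facing d z (q + 1) r s) :
    Facing (turnLeft d) z q r s := by
  unfold Facing at *
  rw [fwd_turnLeft, lat_turnLeft, abs_neg]
  omega

/-- The target lies in the strip of half-width `s`, so the chaser cannot leave the strip, and its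
outward coordinate drops by at most 1 per move. -/
theorem Facing.move {d z u : ℤ × ℤ} {q : ℕ} {r s : ℤ} (hd : IsUnitStep d) (c : Bool)
    (h : Facing d z q r s) (hf : |fwd d u| ≤ s) (hl : |lat d u| ≤ s) :
    Facing d (chaseStep u z c) q (r - 1) s := by
  have := hd.chaseStep_cases u z c
  simp only [Facing, abs_le] at *
  rcases h with h | h | h | h
  · left; omega
  · right; left; omega
  · right; right; left; omega
  · right; right; right; omega

theorem InSquare.move {z u : ℤ × ℤ} {r : ℤ} (c : Bool)
    (hz : InSquare r z) (hu : InSquare r u) : InSquare r (chaseStep u z c) := by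
  have hd : IsUnitStep (1, 0) := Or.inl rfl
  rw [hd.inSquare_iff] at *
  have := hd.chaseStep_cases u z c
  simp only [abs_eq_max_neg] at *
  omega

/-- A zombie that the survivor faces as he starts a new side, or as he passes the end of a side. -/
theorem approaching_start {t : ℕ} {j : ι} {θ : ℕ} (hg : 1 ≤ g)
    (h0 : FirstEntry g (Z · j) θ) (h1 : θ ≤ t) (h2 : t ≤ θ + 24 * g)
    (h3 : lat (route g T P t).2 (route g T P t).1 = -3 * g)
    (h4 : |fwd (route g T P t).2 (route g T P t).1| ≤ 3 * g + 1)
    (h4' : -3 * g ≤ fwd (route g T P t).2 (route g T P t).1)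
    (h5 : InSquare (80 * g) (Z t j))
    (h6 : Facing (route g T P t).2 (Z t j) 0 (80 * g - (t - θ)) (3 * g))
    (h7 : TrailExcept g T P c Z (· = j) t) : Approaching g T P c Z t := by
  have hd := isUnitStep_route g T P t
  rw [hd.inSquare_iff] at h5
  unfold Facing at h6
  -- Take `t₁ = t`. The zombie has come inwards by at most `24g` since its entry and the survivor's
  -- forward coordinate is at most `3g + 1`, so the gap is at least `80g - 27g - 1`.
  refine ⟨j, θ, t, h0, h1, le_rfl, h2, h3, ?_, ?_, ?_, ?_, ?_, ?_, ?_, h7⟩ <;>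
    simp only [abs_eq_max_neg, coinCount_self] at * <;> omega

end TameChase

namespace TameChase

variable {ι : Type*} {g T : ℕ} {P : ℕ → Set (ℤ × ℤ)} {c : ℕ → ι → Bool} {Z : ℕ → ι → ℤ × ℤ}

theorem Facing.not_ahead {d z u : ℤ × ℤ} {q : ℕ} {r s : ℤ} (h : Facing d z q r s) (hq : 1 ≤ q)
    (hr : 0 ≤ r) (hu : s ≤ fwd d u) : fwd d z - fwd d u < 3 := by
  simp only [Facing, abs_le] at h
  omega

/-- One round in which the zombie `j` is in the square and neither ahead nor behind. -/
theorem waiting_step (h : TameChase g T P c Z) {t : ℕ} (ht : t + 5 * g ≤ T) {j : ι} {θ q : ℕ}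
    (h0 : FirstEntry g (Z · j) θ) (h1 : θ ≤ t + 1) (hq : 1 ≤ q)
    (h3 : lat (route g T P t).2 (route g T P t).1 = -3 * g)
    (h4 : |fwd (route g T P t).2 (route g T P t).1| ≤ 3 * g)
    (h5 : InSquare (80 * g) (Z (t + 1) j))
    (h6 : Facing (route g T P t).2 (Z (t + 1) j) q (80 * g - (t + 1 - θ)) (3 * g))
    (h7 : (t : ℤ) - θ + 6 * g * q + (3 * g - fwd (route g T P t).2 (route g T P t).1) ≤ 24 * g)
    (h8 : TrailExcept g T P c Z (· = j) t)
    (hs : ∀ i, ¬ i = j → Seen g (Z · i) (t + 1) → Seen g (Z · i) t) :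
    Waiting g T P c Z (t + 1) ∨ Approaching g T P c Z (t + 1) := by
  have h9 := h.trailExcept_succ h8 hs
  have hg := h.three_le
  have hqg : (g : ℤ) ≤ g * q := le_mul_of_one_le_right (by omega) (by omega)
  have h4' := abs_le.1 h4
  by_cases htl : TurnsLeft g T t (P (t + 1)) (route g T P t)
  · have h10 := htl.2.1
    have e := route_turn_frame g T P htl
    -- A left turn uses up one of the sides that remain before the zombie is faced; from `q = 1` it
    -- leads straight into the approach.
    obtain ⟨q, rfl⟩ : ∃ r, q = r + 1 := ⟨q - 1, by omega⟩
    have h11 := h6.turn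
    rw [← (route_turn g T P htl).1] at h11
    rcases Nat.eq_zero_or_pos q with hq0 | hq0
    · subst hq0
      right
      refine approaching_start (by omega) h0 h1 ?_ ?_ ?_ ?_ h5 (by push_cast; exact h11) h9
      · push_cast at h7; omega
      · omega
      · rw [abs_le]; omega
      · omega
    · left
      refine ⟨j, θ, h0, h1, by omega, ?_, h5, ⟨q, hq0, by push_cast; exact h11, ?_⟩, h9⟩
      · rw [abs_le]; omega
      · push_cast at h7 ⊢
        nlinarith
  · have h10 : ¬ 3 * (g : ℤ) ≤ fwd (route g T P t).2 (route g T P t).1 := by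
      refine fun h10 => htl (h.turnsLeft_of h8 hs ht h10 ?_)
      rintro i rfl -
      refine h6.not_ahead hq ?_ (by omega)
      nlinarith
    have e := route_straight_frame g T P htl
    left
    rw [← (route_straight g T P htl).1] at h6
    refine ⟨j, θ, h0, h1, by omega, ?_, h5, ⟨q, hq, by push_cast; exact h6, ?_⟩, h9⟩
    · rw [abs_le]; omega
    · push_cast; omega

theorem waiting_succ (h : TameChase g T P c Z) {t : ℕ} (ht : t + 5 * g ≤ T)
    (hc : Waiting g T P c Z t) (hs : ∀ i, Seen g (Z · i) (t + 1) → Seen g (Z · i) t) :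
    Waiting g T P c Z (t + 1) ∨ Approaching g T P c Z (t + 1) := by
  obtain ⟨j, θ, h0, h1, h2, h3, h4, ⟨q, hq, h5, h6⟩, h7⟩ := hc
  have hg := h.three_le
  have hd := isUnitStep_route g T P t
  refine h.waiting_step ht h0 (by omega) hq h2 h3 ?_ ?_ h6 h7 (fun i _ => hs i)
  · rw [h.step]
    exact InSquare.move _ h4 ((route_inSquare g T P (by omega) t (by omega)).mono (by omega))
  · rw [h.step]
    have := Facing.move (u := (route g T P t).1) hd (c t j) h5 h3 (by rw [abs_le]; omega)
    convert this using 1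
    ring

/-- The gap shrinks by at most 2 per round, so it still exceeds 3 when `24g` rounds have lined the
zombie up. From then on it comes head-on, and the gap passes through 2 or 3 at the beginning of a
round; then the survivor turns. -/
theorem approaching_succ (h : TameChase g T P c Z) {t : ℕ} (ht : t + 5 * g ≤ T)
    (hc : Approaching g T P c Z t) (hs : ∀ i, Seen g (Z · i) (t + 1) → Seen g (Z · i) t) :
    Approaching g T P c Z (t + 1) ∨ Returning g T P c Z (t + 1) := by
  obtain ⟨j, θ, t₁, h1, h2, h3, h4, h5, h6, h7, h8, h9, h10, h11, h12, h13⟩ := hc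
  have hg := h.three_le
  have hd := isUnitStep_route g T P t
  have hs' := fun i (_ : ¬ i = j) => hs i
  have h14 := h.trailExcept_succ h13 hs'
  have hb := route_bounds g T P (by omega) t (by omega)
  -- Six blocks of `4g` coins contain at least `6g` lateral ones, enough to bring an offset from
  -- `[-3g, 3g]` to the survivor's line at `-3g`.
  have hlined : t₁ + 24 * g ≤ t → lat (route g T P t).2 (Z t j) = -3 * g := by
    intro h15
    rcases h12 with h16 | h16
    · exact h16
    have h17 := (h.balanced j).mul_le (latCoin (route g T P t).2) t₁ 6 (by omega)
    have h18 := coinCount_mono (c · j) (latCoin (route g T P t).2) (r := t₁)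
      (show t₁ + 4 * g * 6 ≤ t by omega)
    have := abs_le.1 h9
    omega
  have hmove := hd.chaseStep_cases (route g T P t).1 (Z t j) (c t j)
  have hZ := h.step t j
  rw [← hZ] at hmove
  have hin : InSquare (80 * g) (Z (t + 1) j) := by
    rw [hd.inSquare_iff]
    simp only [abs_le] at *
    omega
  by_cases htl : TurnsLeft g T t (P (t + 1)) (route g T P t)
  · right
    have h15 := htl.2.2 (Z (t + 1) j) (by rw [h.range]; exact ⟨j, rfl⟩) hin
    have h16 := htl.2.1
    have h17 : t₁ + 24 * g ≤ t := by omega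
    have h18 := hlined h17
    have e := route_turn_frame g T P htl
    refine ⟨j, θ, h1, by omega, by omega, Or.inr (by push_cast; omega), ?_⟩
    intro i _ hi
    by_cases hij : i = j
    · subst hij
      rw [(route_turn g T P htl).1, (route_turn g T P htl).2, hZ]
      exact trails_of_head_on (c := (c · i)) hd ht (by omega) (by omega) h10 (by omega)
    · exact h14 i hij hi
  · left
    have e := route_straight_frame g T P htl
    have e' := (route_straight g T P htl).1
    -- With a gap of 2 or 3 the turn rule would have applied, so the gap is at least 4 and remains
    -- at least 2 after both have moved.
    have h15 : 4 ≤ fwd (route g T P t).2 (Z t j) - fwd (route g T P t).2 (route g T P t).1 := by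
      by_contra! h16
      have h17 : t₁ + 24 * g ≤ t := by omega
      have h18 := hlined h17
      refine htl (h.turnsLeft_of h13 hs' ht (by omega) ?_)
      rintro i rfl -
      omega
    have hc := coinCount_succ (c · j) (latCoin (route g T P t).2) h3
    refine ⟨j, θ, t₁, h1, by omega, by omega, h4, by omega, ?_, ?_, ?_, ?_, ?_, ?_, ?_, h14⟩
    · push_cast; omega
    · push_cast; omega
    · rw [e']; omega
    · rw [e', abs_le]; rw [abs_le] at h9; omega
    · rw [e.1, e']; omega
    · rw [e.1, e']; push_cast; omega
    · rw [e', hc]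
      rw [abs_le] at h9
      by_cases hcc : c t j = latCoin (route g T P t).2
      · simp only [hcc, if_true]
        push_cast
        simp only [hcc, ne_eq, not_true, or_false] at hmove
        omega
      · simp only [hcc, if_false]
        simp only [hcc, false_or] at hmove
        omega

end TameChase

theorem IsUnitStep.abs_add_abs {d : ℤ × ℤ} (hd : IsUnitStep d) (z u : ℤ × ℤ) :
    |fwd d z - fwd d u| + |lat d z - lat d u| = |z.1 - u.1| + |z.2 - u.2| := by
  rcases hd with rfl | rfl | rfl | rfl <;> simp only [fwd, lat, abs_eq_max_neg] <;> omega

theorem IsUnitStep.eq_sub_smul {d : ℤ × ℤ} (hd : IsUnitStep d) {z u : ℤ × ℤ} {m : ℕ}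
    (h1 : fwd d z - fwd d u = -m) (h2 : lat d z = lat d u) : z = u - m • d := by
  obtain ⟨z1, z2⟩ := z
  obtain ⟨u1, u2⟩ := u
  rcases hd with rfl | rfl | rfl | rfl <;> simp [fwd, lat] at * <;> omega

/-! ### Entries into the square, and the invariant of the chase -/

namespace TameChase

variable {ι : Type*} {g T : ℕ} {P : ℕ → Set (ℤ × ℤ)} {c : ℕ → ι → Bool} {Z : ℕ → ι → ℤ × ℤ}

theorem seen_of_succ {z : ℕ → ℤ × ℤ} {t : ℕ} (h : Seen g z (t + 1)) (h' : ¬ Seen g z t) :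
    FirstEntry g z (t + 1) := by
  obtain ⟨s, hs, hs'⟩ := h
  have hst : s = t + 1 := by
    by_contra hne
    exact h' ⟨s, by omega, hs'⟩
  subst hst
  exact ⟨hs', fun r hr hr' => h' ⟨r, by omega, hr'⟩⟩

/-- As long as the survivor circles, the zombies outside the square get into the range of his circle in
the coordinate that they have already adjusted. -/
theorem lat_le_of_circling (h : TameChase g T P c Z) {i : ι} {θ s₀ : ℕ} {e : ℤ × ℤ}
    (he : IsUnitStep e) (hθ : θ + 5 * g ≤ T + 2) (hs₀ : s₀ + 600 * g ≤ θ)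
    (hlat : |lat e (Z s₀ i)| ≤ 80 * g)
    (hcirc : ∀ s < θ, θ ≤ s + 320 * g → InSquare (3 * g) (route g T P s).1) :
    |lat e (Z (θ - 1) i)| ≤ 80 * g ∧ |lat e (Z θ i)| ≤ 3 * g := by
  have hg := h.three_le
  -- The survivor's own coordinate is in this range, so a coordinate that has entered it never
  -- leaves.
  have absorb : ∀ m, s₀ + m ≤ θ → |lat e (Z (s₀ + m) i)| ≤ 80 * g := by
    intro m
    induction m with
    | zero => intro _; exact hlat
    | succ m ih =>
      intro hm
      have h1 := ih (by omega)
      have h2 := (he.inSquare_iff _ _).1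
        (route_inSquare g T P (by omega) (s₀ + m) (by omega))
      have h3 := he.chaseStep_cases (route g T P (s₀ + m)).1 (Z (s₀ + m) i) (c (s₀ + m) i)
      rw [← h.step] at h3
      rw [← add_assoc]
      simp only [abs_le] at *
      omega
  have hlast : ∀ s, s₀ ≤ s → s ≤ θ → |lat e (Z s i)| ≤ 80 * g := by
    intro s hs hs'
    have := absorb (s - s₀) (by omega)
    rwa [show s₀ + (s - s₀) = s by omega] at this
  refine ⟨hlast (θ - 1) (by omega) (by omega), ?_⟩
  -- The last `320g` rounds are 80 blocks of `4g` coins, with at least `80g` lateral ones; each of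
  -- them reduces the lateral coordinate while that is outside `[-3g, 3g]`.
  obtain ⟨a, rfl⟩ : ∃ a, θ = a + 4 * g * 80 := ⟨θ - 4 * g * 80, by omega⟩
  have shrink : ∀ m, m ≤ 4 * g * 80 → |lat e (Z (a + m) i)| ≤ 3 * g ∨
      |lat e (Z (a + m) i)| + coinCount (c · i) (latCoin e) a (a + m) ≤ 80 * g := by
    intro m
    induction m with
    | zero =>
      intro _
      right
      have := hlast a (by omega) (by omega)
      simpa [coinCount_self] using this
    | succ m ih =>
      intro hm
      have h1 := ih (by omega)
      have h2 := (he.inSquare_iff _ _).1 (hcirc (a + m) (by omega) (by omega))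
      have h3 := he.chaseStep_cases (route g T P (a + m)).1 (Z (a + m) i) (c (a + m) i)
      rw [← h.step] at h3
      rw [← add_assoc, coinCount_succ _ _ (by omega)]
      have h2' := abs_le.1 h2.2
      simp only [abs_eq_max_neg] at h1 ⊢
      by_cases hcc : c (a + m) i = latCoin e
      · simp only [hcc, if_true, ne_eq, not_true, or_false] at h3 ⊢
        push_cast
        omega
      · simp only [hcc, if_false, false_or] at h3 ⊢
        push_cast
        omega
  rcases shrink (4 * g * 80) le_rfl with h1 | h1
  · exact h1
  · have h2 := (h.balanced i).mul_le (latCoin e) a 80 (by omega)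
    omega

/-- When a zombie enters the square, the survivor is circling, and he will face the zombie on one of
his next four sides. -/
theorem facing_of_entry (h : TameChase g T P c Z) {t : ℕ} (ht : t + 5 * g ≤ T)
    (hphase : ∀ s ≤ t, InPhase g T P c Z s) {i : ι} (hi : FirstEntry g (Z · i) (t + 1)) :
    Circling g T P c Z t ∧ ∃ q ≤ 3, Facing (route g T P t).2 (Z (t + 1) i) q (80 * g) (3 * g) := by
  have hg := h.three_le
  -- Otherwise another zombie entered at most `200g` before `s`, hence at most `520g` before this
  -- entry, against the separation by `600g`.
  have hcirc : ∀ s < t + 1, t + 1 ≤ s + 320 * g → Circling g T P c Z s := by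
    intro s hs hs'
    rcases circling_or_recent (hphase s (by omega)) with h1 | ⟨j, θ, h1, h2, h3⟩
    · exact h1
    · exfalso
      by_cases hij : j = i
      · subst hij
        have := h1.unique hi
        omega
      · have := h.separated j i hij θ (t + 1) h1 hi (by omega)
        omega
  have hsq : ∀ s < t + 1, t + 1 ≤ s + 320 * g → InSquare (3 * g) (route g T P s).1 := by
    intro s hs hs'
    obtain ⟨h1, h2, -⟩ := hcirc s hs hs'
    rw [(isUnitStep_route g T P s).inSquare_iff]
    refine ⟨h2, ?_⟩
    rw [abs_le]
    omega
  have h0 := hcirc t (by omega) (by omega)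
  refine ⟨h0, ?_⟩
  -- The lateral coordinate was already in range one step earlier, so the entry is made by the
  -- forward coordinate, which arrives exactly at `±80g`.
  have key : ∀ e, IsUnitStep e → (∃ s₀, s₀ + 600 * g ≤ t + 1 ∧ |lat e (Z s₀ i)| ≤ 80 * g) →
      |lat e (Z (t + 1) i)| ≤ 3 * g ∧ |fwd e (Z (t + 1) i)| = 80 * g := by
    rintro e he ⟨s₀, h1, h2⟩
    obtain ⟨h3, h4⟩ := h.lat_le_of_circling he (by omega) h1 h2 hsq
    refine ⟨h4, ?_⟩
    have h5 := hi.2 t (by omega)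
    have h6 := hi.1
    simp only [add_tsub_cancel_right] at h3
    rw [he.inSquare_iff] at h5 h6
    have h7 := he.chaseStep_cases (route g T P t).1 (Z t i) (c t i)
    have h8 := (he.inSquare_iff _ _).1 (hsq t (by omega) (by omega))
    rw [← h.step] at h7
    simp only [abs_eq_max_neg] at *
    omega
  have hdir : (|(Z (t + 1) i).2| ≤ 3 * g ∧ |(Z (t + 1) i).1| = 80 * g) ∨
      (|(Z (t + 1) i).1| ≤ 3 * g ∧ |(Z (t + 1) i).2| = 80 * g) := by
    obtain ⟨s₀, h1, h2 | h2⟩ := h.side i (t + 1) hi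
    · right
      simpa [lat, fwd] using key (0, 1) (Or.inr (Or.inl rfl)) ⟨s₀, h1, by simpa [lat] using h2⟩
    · left
      simpa [lat, fwd] using key (1, 0) (Or.inl rfl) ⟨s₀, h1, by simpa [lat] using h2⟩
  obtain ⟨q, hq⟩ : ∃ q, Facing (route g T P t).2 (Z (t + 1) i) q (80 * g) (3 * g) := by
    unfold Facing
    simp only [exists_or, exists_eq_left]
    generalize Z (t + 1) i = z at hdir
    rcases isUnitStep_route g T P t with hd | hd | hd | hd <;> rw [hd] <;>
      simp only [fwd, lat, abs_eq_max_neg] at hdir ⊢ <;> omega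
  exact ⟨q, by unfold Facing at hq; omega, hq⟩

theorem inPhase (h : TameChase g T P c Z) (t : ℕ) (ht : t + 5 * g ≤ T + 1) :
    InPhase g T P c Z t := by
  have hg := h.three_le
  induction t using Nat.strong_induction_on with
  | _ t ih =>
  rcases t with _ | t
  · left
    refine ⟨by simp [route, lat], by simp [route, fwd], ?_⟩
    rintro i - ⟨s, hs, hs'⟩
    obtain ⟨θ, hθ, hθ'⟩ := exists_firstEntry (z := (Z · i)) hs'
    -- An entry at time 0 is excluded, as `side` places every entry at time `600g` or later.
    obtain ⟨s', h1, -⟩ := h.side i θ hθ'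
    omega
  have hphase : ∀ s ≤ t, InPhase g T P c Z s := fun s hs => ih s (by omega) (by omega)
  by_cases hnew : ∃ i, Seen g (Z · i) (t + 1) ∧ ¬ Seen g (Z · i) t
  · obtain ⟨i, hi, hi'⟩ := hnew
    have hθ := seen_of_succ hi hi'
    obtain ⟨⟨h1, h2, h3⟩, q, hq, hf⟩ := h.facing_of_entry (by omega) hphase hθ
    have hs : ∀ j, ¬ j = i → Seen g (Z · j) (t + 1) → Seen g (Z · j) t := by
      intro j hj hs
      by_contra hs'
      have := h.separated j i hj (t + 1) (t + 1) (seen_of_succ hs hs') hθ le_rfl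
      omega
    have h3' : TrailExcept g T P c Z (· = i) t := fun j _ => h3 j (fun h => h)
    rcases Nat.eq_zero_or_pos q with hq0 | hq0
    · subst hq0
      -- The new zombie is about `77g` or more ahead on the current side, which prevents a turn even
      -- at the corner.
      have htl : ¬ TurnsLeft g T t (P (t + 1)) (route g T P t) := by
        intro htl
        have h4 := htl.2.2 (Z (t + 1) i) (by rw [h.range]; exact ⟨i, rfl⟩) hθ.1
        unfold Facing at hf
        rw [abs_le] at h2
        omega
      have e := route_straight_frame g T P htl
      refine Or.inr (Or.inr (Or.inr (approaching_start (by omega) hθ le_rfl (by omega) (by omega)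
        ?_ ?_ hθ.1 ?_ (h.trailExcept_succ h3' hs))))
      · rw [abs_le] at *; omega
      · rw [abs_le] at *; omega
      · rw [(route_straight g T P htl).1]
        simpa using hf
    · refine Or.inr (Or.inr (h.waiting_step (by omega) hθ le_rfl hq0 h1 h2 hθ.1 ?_ ?_ h3' hs))
      · simpa using hf
      · rw [abs_le] at h2
        have : (g : ℤ) * q ≤ g * 3 := by gcongr; exact_mod_cast hq
        push_cast
        nlinarith
  · push Not at hnew
    rcases hphase t le_rfl with h1 | h1 | h1 | h1
    · exact Or.inl (h.circling_succ (by omega) h1 hnew)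
    · rcases h.returning_succ (by omega) h1 hnew with h2 | h2
      · exact Or.inl h2
      · exact Or.inr (Or.inl h2)
    · exact Or.inr (Or.inr (h.waiting_succ (by omega) h1 hnew))
    · rcases h.approaching_succ (by omega) h1 hnew with h2 | h2
      · exact Or.inr (Or.inr (Or.inr h2))
      · exact Or.inr (Or.inl h2)

/-- Every zombie has entered by `T - 800g`, so when turning stops at `T + 1 - 5g` no entry is
recent. The survivor is then circling with all zombies on his trail, and only straight steps follow.
-/
theorem trails_final (h : TameChase g T P c Z) (t : ℕ) (ht : T + 1 ≤ t + 5 * g) (i : ι) :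
    Trails g T (c · i) t (route g T P t).1 (route g T P t).2 (Z t i) := by
  have hg := h.three_le
  obtain ⟨t₁, ht₁, -⟩ := h.arrive i
  obtain ⟨t₀, ht₀⟩ : ∃ t₀, T + 1 = t₀ + 5 * g := ⟨T + 1 - 5 * g, by omega⟩
  obtain ⟨m, rfl⟩ : ∃ m, t = t₀ + m := ⟨t - t₀, by omega⟩
  induction m with
  | zero =>
    rcases circling_or_recent (h.inPhase t₀ (by omega)) with ⟨-, -, h1⟩ | ⟨j, θ, h1, h2, h3⟩
    · obtain ⟨s, hs, hs'⟩ := h.arrive i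
      exact h1 i (fun h => h) ⟨s, by omega, hs'⟩
    · obtain ⟨s, hs, hs'⟩ := h.arrive j
      obtain ⟨θ', h4, h5⟩ := exists_firstEntry (z := (Z · j)) hs'
      have := h5.unique h1
      omega
  | succ m ih =>
    have h1 := ih (by omega)
    have h2 := not_turnsLeft g T (t := t₀ + m) (by omega) (P (t₀ + m + 1)) (route g T P (t₀ + m))
    have h3 := h.step (t₀ + m) i
    rw [← add_assoc, (route_straight g T P h2).1, (route_straight g T P h2).2, h3]
    exact h1.straight (isUnitStep_route g T P _)

theorem lined_up (h : TameChase g T P c Z) (i : ι) :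
    Z T i = (route g T P T).1 - 2 • (route g T P T).2 ∨
    Z T i = (route g T P T).1 - 3 • (route g T P T).2 := by
  have hg := h.three_le
  have h1 := h.trails_final T (by omega) i
  have h2 := h1.lat_eq hg (h.balanced i) le_rfl (Or.inr rfl)
  obtain ⟨τ, -, -, -, h3, h4, -⟩ := h1
  rw [h2, sub_self, abs_zero, abs_of_neg (by omega)] at h4
  rcases h4 with h4 | h4
  · exact Or.inl ((isUnitStep_route g T P T).eq_sub_smul (by push_cast; omega) h2)
  · exact Or.inr ((isUnitStep_route g T P T).eq_sub_smul (by push_cast; omega) h2)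

/-- Trailing zombies are at distance 2 or 3, an approached one has gap at least 2, one that is
waited for is still at `56g` or farther out, and an unseen one is outside `[-80g, 80g]²` while the
survivor is within `80g - 2`. -/
theorem two_le_dist (h : TameChase g T P c Z) (t : ℕ) (i : ι) :
    2 ≤ |(Z t i).1 - (route g T P t).1.1| + |(Z t i).2 - (route g T P t).1.2| := by
  have hg := h.three_le
  have hd := isUnitStep_route g T P t
  have trails : Trails g T (c · i) t (route g T P t).1 (route g T P t).2 (Z t i) →
      2 ≤ |(Z t i).1 - (route g T P t).1.1| + |(Z t i).2 - (route g T P t).1.2| := by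
    rintro ⟨τ, -, -, -, -, h4, -⟩
    rw [hd.abs_add_abs] at h4
    omega
  rcases le_or_gt (T + 1) (t + 5 * g) with ht | ht
  · exact trails (h.trails_final t ht i)
  by_cases hs : Seen g (Z · i) t
  · rcases h.inPhase t (by omega) with ⟨-, -, h1⟩ | ⟨j, θ, -, -, -, -, h1⟩ |
      ⟨j, θ, h1, h2, h3, h4, h5, ⟨q, hq, h6, h7⟩, h8⟩ |
      ⟨j, θ, t₁, h1, h2, h3, h4, h5, h6, h7, h8, h9, h10, h11, h12, h13⟩
    · exact trails (h1 i (fun h => h) hs)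
    · exact trails (h1 i (fun h => h) hs)
    · by_cases hij : i = j
      · subst hij
        rw [← hd.abs_add_abs]
        have : (0 : ℤ) ≤ g * q := by positivity
        simp only [Facing] at h6
        have h7' : (t : ℤ) - θ ≤ 24 * g := by
          rw [abs_le] at h4
          nlinarith
        simp only [abs_eq_max_neg] at *
        omega
      · exact trails (h8 i hij hs)
    · by_cases hij : i = j
      · subst hij
        rw [← hd.abs_add_abs]
        have := le_abs_self
          (fwd (route g T P t).2 (Z t i) - fwd (route g T P t).2 (route g T P t).1)
        have := abs_nonneg
          (lat (route g T P t).2 (Z t i) - lat (route g T P t).2 (route g T P t).1)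
        omega
      · exact trails (h13 i hij hs)
  · have h1 : ¬ InSquare (80 * g) (Z t i) := fun h1 => hs ⟨t, le_rfl, h1⟩
    have h2 := route_inSquare g T P (by omega) t (by omega)
    simp only [InSquare, abs_eq_max_neg] at *
    omega

end TameChase

/-! ### The game as a function of starting points and coins -/

section play

variable {ι : Type*}

/-- The zombies' positions and the survivor's position and direction, if the zombies start at `Z₀` and
move by the coins `c`, and the survivor reacts to the zombies in `A` only. -/
noncomputable def play (g T : ℕ) (A : Set ι) (Z₀ : ι → ℤ × ℤ) (c : ℕ → ι → Bool) :
    ℕ → (ι → ℤ × ℤ) × ((ℤ × ℤ) × (ℤ × ℤ))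
  | 0 => (Z₀, ((-3 * g, -3 * g), (1, 0)))
  | t + 1 =>
    (fun i => chaseStep (play g T A Z₀ c t).2.1 ((play g T A Z₀ c t).1 i) (c t i),
      advance g T t ((fun i => chaseStep (play g T A Z₀ c t).2.1 ((play g T A Z₀ c t).1 i) (c t i)) '' A)
        (play g T A Z₀ c t).2)

/-- The positions at time `t` of the zombies in `A`. -/
def activeSet (g T : ℕ) (A : Set ι) (Z₀ : ι → ℤ × ℤ) (c : ℕ → ι → Bool) (t : ℕ) : Set (ℤ × ℤ) :=
  (play g T A Z₀ c t).1 '' A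

variable (g T : ℕ) (A : Set ι) (Z₀ : ι → ℤ × ℤ) (c : ℕ → ι → Bool)

theorem play_snd (t : ℕ) :
    (play g T A Z₀ c t).2 = route g T (activeSet g T A Z₀ c) t := by
  induction t with
  | zero => rfl
  | succ t ih => rw [route, ← ih]; rfl

theorem play_fst_succ (t : ℕ) (i : ι) :
    (play g T A Z₀ c (t + 1)).1 i =
      chaseStep (route g T (activeSet g T A Z₀ c) t).1 ((play g T A Z₀ c t).1 i) (c t i) := by
  rw [← play_snd]; rfl

theorem play_snd_succ (t : ℕ) :
    (play g T A Z₀ c (t + 1)).2 =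
      advance g T t ((play g T A Z₀ c (t + 1)).1 '' A) (play g T A Z₀ c t).2 := rfl

theorem play_congr {c' : ℕ → ι → Bool} (t : ℕ) (h : ∀ s < t, c s = c' s) :
    play g T A Z₀ c t = play g T A Z₀ c' t := by
  induction t with
  | zero => rfl
  | succ t ih =>
    have h1 := ih fun s hs => h s (by omega)
    have h2 := h t (by omega)
    simp only [play, h1, h2]

/-- The zombie `j` has no influence before it enters the square. -/
theorem play_eq_of_no_entry {j : ι} {θ : ℕ}
    (hθ : ∀ s < θ, ¬ InSquare (80 * g) ((play g T (insert j A) Z₀ c s).1 j)) (t : ℕ) (ht : t < θ) :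
    play g T (insert j A) Z₀ c t = play g T A Z₀ c t := by
  induction t with
  | zero => rfl
  | succ t ih =>
    have h1 := ih (by omega)
    have h2 : (play g T (insert j A) Z₀ c (t + 1)).1 = (play g T A Z₀ c (t + 1)).1 := by
      simp only [play, h1]
    refine Prod.ext h2 ?_
    have h3 := hθ (t + 1) ht
    rw [play_snd_succ, play_snd_succ, h1, h2]
    rw [h2] at h3
    have h4 : TurnsLeft g T t ((play g T A Z₀ c (t + 1)).1 '' insert j A) (play g T A Z₀ c t).2 ↔
        TurnsLeft g T t ((play g T A Z₀ c (t + 1)).1 '' A) (play g T A Z₀ c t).2 := by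
      unfold TurnsLeft
      rw [Set.image_insert_eq]
      refine and_congr_right fun _ => and_congr_right fun _ => ?_
      simp only [Set.mem_insert_iff, forall_eq_or_imp, and_iff_right_iff_imp]
      exact fun _ h => absurd h h3
    unfold advance
    by_cases h5 : TurnsLeft g T t ((play g T A Z₀ c (t + 1)).1 '' A) (play g T A Z₀ c t).2
    · rw [if_pos h5, if_pos (h4.2 h5)]
    · rw [if_neg h5, if_neg (fun h => h5 (h4.1 h))]

/-- The zombies' positions at time `θ` depend on the survivor only up to `θ - 1`, so they still
agree at the moment of entry itself. -/
theorem play_fst_eq_of_no_entry {j : ι} {θ : ℕ}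
    (hθ : ∀ s < θ, ¬ InSquare (80 * g) ((play g T (insert j A) Z₀ c s).1 j)) (t : ℕ) (ht : t ≤ θ) :
    (play g T (insert j A) Z₀ c t).1 = (play g T A Z₀ c t).1 := by
  rcases t with _ | t
  · rfl
  · have h1 := play_eq_of_no_entry g T A Z₀ c hθ t (by omega)
    simp only [play, h1]

theorem play_inSquare {N : ℤ} (hg : 1 ≤ g) (hT : 5 * g ≤ T) (hN : 85 * g ≤ N) {i : ι}
    (hi : InSquare N (Z₀ i)) (t : ℕ) (ht : t ≤ T) : InSquare N ((play g T A Z₀ c t).1 i) := by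
  induction t with
  | zero => exact hi
  | succ t ih =>
    rw [play_fst_succ]
    exact TameChase.InSquare.move _ (ih (by omega))
      ((route_inSquare_of_le g T _ hg hT t (by omega)).mono hN)

/-- In `4gm` rounds each axis is preferred at least `gm ≥ N` times, and each such move draws the
coordinate inwards until it is in the range of the square. -/
theorem play_arrive {N m : ℕ} (hg : 1 ≤ g) {i : ι} (hi : InSquare N (Z₀ i))
    (hc : BalancedCoins g T (c · i)) (hm : N ≤ g * m) (hT : 4 * g * m + 5 * g ≤ T) :
    InSquare (80 * g) ((play g T A Z₀ c (4 * g * m)).1 i) := by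
  have key : ∀ e, IsUnitStep e → |lat e ((play g T A Z₀ c (4 * g * m)).1 i)| ≤ 80 * g := by
    intro e he
    have h0 : |lat e (Z₀ i)| ≤ N := ((he.inSquare_iff _ _).1 hi).2
    have shrink : ∀ t, t ≤ 4 * g * m → |lat e ((play g T A Z₀ c t).1 i)| ≤ 80 * g ∨
        |lat e ((play g T A Z₀ c t).1 i)| + coinCount (c · i) (latCoin e) 0 t ≤ N := by
      intro t
      induction t with
      | zero => intro _; right; simpa [coinCount_self, play] using h0
      | succ t ih =>
        intro ht
        have h1 := ih (by omega)
        have h2 := (he.inSquare_iff _ _).1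
          (route_inSquare g T (activeSet g T A Z₀ c) hg t (by omega))
        have h3 := he.chaseStep_cases (route g T (activeSet g T A Z₀ c) t).1
          ((play g T A Z₀ c t).1 i) (c t i)
        rw [← play_fst_succ] at h3
        rw [coinCount_succ _ _ (by omega)]
        have h2' := abs_le.1 h2.2
        simp only [abs_eq_max_neg] at h1 ⊢
        by_cases hcc : c t i = latCoin e
        · simp only [hcc, if_true, ne_eq, not_true, or_false] at h3 ⊢
          push_cast
          omega
        · simp only [hcc, if_false, false_or] at h3 ⊢
          push_cast
          omega
    rcases shrink _ le_rfl with h1 | h1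
    · exact h1
    · have h2 := hc.mul_le (latCoin e) 0 m (by omega)
      rw [zero_add] at h2
      omega
  exact ⟨by simpa [lat] using key (0, 1) (Or.inr (Or.inl rfl)), by simpa [lat] using key (1, 0) (Or.inl rfl)⟩

/-- The zombie `j` enters the square soon after another one, or close to a corner. It is ignored by the
survivor. -/
def BadEntry (j : ι) : Prop :=
  ∃ θ, θ + 5 * g ≤ T + 1 ∧ FirstEntry g (fun t => (play g T {j}ᶜ Z₀ c t).1 j) θ ∧
    ((∃ i ≠ j, ∃ θ' ≤ θ, FirstEntry g (fun t => (play g T {j}ᶜ Z₀ c t).1 i) θ' ∧ θ ≤ θ' + 600 * g) ∨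
      ∀ s, s + 600 * g ≤ θ → 80 * (g : ℤ) < |((play g T {j}ᶜ Z₀ c s).1 j).1| ∧
        80 * (g : ℤ) < |((play g T {j}ᶜ Z₀ c s).1 j).2|)

/-- `BadEntry` refers to games in which the survivor ignores `j`. Up to the entry of `j` such a game
coincides with the real one, so a violation of separation, or of the side condition, in the real
game is a bad entry of the later zombie. -/
theorem tameChase_play {N m : ℕ} (hg : 3 ≤ g) (hN : ∀ i, InSquare N (Z₀ i))
    (hc : ∀ i, BalancedCoins g T (c · i)) (hm : N ≤ g * m) (hT : 4 * g * m + 800 * g ≤ T)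
    (hbad : ∀ j, ¬ BadEntry g T Z₀ c j) :
    TameChase g T (activeSet g T Set.univ Z₀ c) c (fun t => (play g T Set.univ Z₀ c t).1) := by
  have arrive : ∀ i, InSquare (80 * g) ((play g T Set.univ Z₀ c (4 * g * m)).1 i) := fun i =>
    play_arrive g T Set.univ Z₀ c (by omega) (hN i) (hc i) hm (by omega)
  have early : ∀ i θ, FirstEntry g (fun t => (play g T Set.univ Z₀ c t).1 i) θ → θ ≤ 4 * g * m := by
    intro i θ h
    by_contra! h'
    exact h.2 _ h' (arrive i)
  have agree : ∀ j θ, FirstEntry g (fun t => (play g T Set.univ Z₀ c t).1 j) θ → ∀ t ≤ θ,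
      (play g T Set.univ Z₀ c t).1 = (play g T {j}ᶜ Z₀ c t).1 := by
    intro j θ h t ht
    have e : (Set.univ : Set ι) = insert j {j}ᶜ := by ext i; simp [em]
    have h' := h.2
    rw [e] at h' ⊢
    exact play_fst_eq_of_no_entry g T {j}ᶜ Z₀ c h' t ht
  have transfer : ∀ j θ, FirstEntry g (fun t => (play g T Set.univ Z₀ c t).1 j) θ → ∀ i, ∀ θ' ≤ θ,
      FirstEntry g (fun t => (play g T Set.univ Z₀ c t).1 i) θ' →
      FirstEntry g (fun t => (play g T {j}ᶜ Z₀ c t).1 i) θ' := by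
    intro j θ h i θ' hθ' h'
    have h1 := agree j θ h
    refine ⟨?_, fun s hs => ?_⟩
    · have := h'.1
      simpa only [h1 θ' hθ'] using this
    · have := h'.2 s hs
      simpa only [h1 s (by omega)] using this
  refine ⟨hg, fun t => by simp [activeSet], fun t i => play_fst_succ g T _ Z₀ c t i, hc,
    fun i => ⟨_, hT, arrive i⟩, ?_, ?_⟩
  · intro i j hij θ θ' h h' hle
    by_contra! hlt
    exact hbad j ⟨θ', by have := early j θ' h'; omega, transfer j θ' h' j θ' le_rfl h',
      Or.inl ⟨i, hij, θ, hle, transfer j θ' h' i θ hle h, hlt⟩⟩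
  · intro i θ h
    by_contra! h'
    refine hbad i ⟨θ, by have := early i θ h; omega, transfer i θ h i θ le_rfl h, Or.inr ?_⟩
    intro s hs
    have := h' s hs
    simp only [agree i θ h s (by omega)] at this
    exact this

end play

/-! ### Counting the starting points with a bad entry -/

theorem IsUnitStep.ext_frame {d : ℤ × ℤ} (hd : IsUnitStep d) {v w : ℤ × ℤ}
    (h1 : fwd d v = fwd d w) (h2 : lat d v = lat d w) : v = w := by
  obtain ⟨v1, v2⟩ := v
  obtain ⟨w1, w2⟩ := w
  rcases hd with rfl | rfl | rfl | rfl <;> simp [fwd, lat] at * <;> omega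

/-- The path of a zombie that starts at `z₀` and follows a survivor with positions `w`. -/
def drive (w : ℕ → ℤ × ℤ) (c : ℕ → Bool) (z₀ : ℤ × ℤ) : ℕ → ℤ × ℤ
  | 0 => z₀
  | t + 1 => chaseStep (w t) (drive w c z₀ t) (c t)

/-- Until time `θ` the path `z` is beyond the square in the direction `e`. -/
def Beyond (g : ℕ) (e : ℤ × ℤ) (z : ℕ → ℤ × ℤ) (θ : ℕ) : Prop :=
  0 < θ ∧ ∀ s < θ, 80 * (g : ℤ) < fwd e (z s)

section drive

variable {g : ℕ} {w : ℕ → ℤ × ℤ} {c : ℕ → Bool} {e : ℤ × ℤ} {θ : ℕ}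

/-- Beyond the square the forward coordinates never equal the survivor's, so every forward move goes
the same way, and the choice of axis depends only on the common coin and the common lateral
coordinate. The two paths are therefore translates of each other. -/
theorem drive_agree (he : IsUnitStep e) (hw : ∀ s < θ, InSquare (80 * g) (w s)) {z z' : ℤ × ℤ}
    (hz : Beyond g e (drive w c z) θ) (hz' : Beyond g e (drive w c z') θ) (hl : lat e z = lat e z')
    (t : ℕ) (ht : t ≤ θ) : lat e (drive w c z t) = lat e (drive w c z' t) ∧
      fwd e (drive w c z t) - fwd e (drive w c z' t) = fwd e z - fwd e z' := by
  induction t with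
  | zero => exact ⟨hl, rfl⟩
  | succ t ih =>
    obtain ⟨h1, h2⟩ := ih (by omega)
    have h3 := hz.2 t (by omega)
    have h4 := hz'.2 t (by omega)
    have h5 := he.chaseStep_cases (w t) (drive w c z t) (c t)
    have h6 := he.chaseStep_cases (w t) (drive w c z' t) (c t)
    have h7 := abs_le.1 ((he.inSquare_iff _ _).1 (hw t (by omega))).1
    simp only [drive]
    by_cases hcc : c t = latCoin e
    · simp only [hcc, ne_eq, not_true, or_false, true_or, and_true] at h5 h6 ⊢
      omega
    · simp only [hcc, ne_eq, false_or, not_false_eq_true, or_true, and_true] at h5 h6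
      omega

/-- Just before the entry the path is beyond the square in some direction `e`. It was so at all
earlier times, since a chaser whose `e`-coordinate is at most `80g` cannot exceed this value later.
-/
theorem exists_beyond (hw : ∀ s < θ, InSquare (80 * g) (w s)) {z : ℤ × ℤ}
    (hz : ¬ InSquare (80 * g) z) (hθ : FirstEntry g (drive w c z) θ) :
    ∃ e ∈ ({(1, 0), (0, 1), (-1, 0), (0, -1)} : Finset (ℤ × ℤ)), Beyond g e (drive w c z) θ := by
  have h0 : 0 < θ := by
    rcases Nat.eq_zero_or_pos θ with h | h
    · subst h; exact absurd hθ.1 hz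
    · exact h
  have back : ∀ e, IsUnitStep e → 80 * (g : ℤ) < fwd e (drive w c z (θ - 1)) →
      Beyond g e (drive w c z) θ := by
    intro e he h
    refine ⟨h0, fun s hs => ?_⟩
    by_contra! hle
    have : ∀ m, s + m < θ → fwd e (drive w c z (s + m)) ≤ 80 * g := by
      intro m
      induction m with
      | zero => intro _; exact hle
      | succ m ih =>
        intro hm
        have h1 := ih (by omega)
        have h2 := he.chaseStep_cases (w (s + m)) (drive w c z (s + m)) (c (s + m))
        have h3 := abs_le.1 ((he.inSquare_iff _ _).1 (hw (s + m) (by omega))).1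
        rw [← add_assoc]
        simp only [drive]
        omega
    have := this (θ - 1 - s) (by omega)
    rw [show s + (θ - 1 - s) = θ - 1 by omega] at this
    omega
  have h1 := hθ.2 (θ - 1) (by omega)
  have b1 := back (1, 0) (Or.inl rfl)
  have b2 := back (0, 1) (Or.inr (Or.inl rfl))
  have b3 := back (-1, 0) (Or.inr (Or.inr (Or.inl rfl)))
  have b4 := back (0, -1) (Or.inr (Or.inr (Or.inr rfl)))
  simp only [fwd] at b1 b2 b3 b4
  simp only [InSquare, abs_le] at h1
  simp only [Finset.mem_insert, Finset.mem_singleton, exists_eq_or_imp, exists_eq_left]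
  by_contra! hcon
  have c1 := mt b1 hcon.1
  have c2 := mt b2 hcon.2.1
  have c3 := mt b3 hcon.2.2.1
  have c4 := mt b4 hcon.2.2.2
  omega

theorem Beyond.fwd_eq (he : IsUnitStep e) {z : ℤ × ℤ} (hw : ∀ s < θ, InSquare (80 * g) (w s))
    (h : Beyond g e (drive w c z) θ) (hθ : FirstEntry g (drive w c z) θ) :
    fwd e (drive w c z θ) = 80 * g := by
  obtain ⟨t, rfl⟩ : ∃ t, θ = t + 1 := ⟨θ - 1, by have := h.1; omega⟩
  have h1 := h.2 t (by omega)
  have h2 := he.chaseStep_cases (w t) (drive w c z t) (c t)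
  have h3 := abs_le.1 ((he.inSquare_iff _ _).1 (hw t (by omega))).1
  have h4 := abs_le.1 ((he.inSquare_iff _ _).1 hθ.1).1
  simp only [drive] at h4 ⊢
  omega

theorem eq_of_same_entry (he : IsUnitStep e) (hw : ∀ s < θ, InSquare (80 * g) (w s)) {z z' : ℤ × ℤ}
    (hz : Beyond g e (drive w c z) θ) (hz' : Beyond g e (drive w c z') θ) (hl : lat e z = lat e z')
    (hθ : FirstEntry g (drive w c z) θ) (hθ' : FirstEntry g (drive w c z') θ) : z = z' := by
  have h1 := (drive_agree he hw hz hz' hl θ le_rfl).2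
  have h2 := hz.fwd_eq he hw hθ
  have h3 := hz'.fwd_eq he hw hθ'
  exact he.ext_frame (by omega) hl

open scoped Classical in
/-- Few starting points lead to an entry from a given side in a given period. -/
theorem card_entry_le {V : Type*} [Fintype V] {n W T : ℕ} (pos : V → ℤ × ℤ)
    (hpos : Function.Injective pos) (he : IsUnitStep e)
    (hn : (Finset.univ.image fun v => lat e (pos v)).card ≤ n)
    (hw : ∀ s < T, InSquare (80 * g) (w s)) (θ₀ : ℕ) :
    (Finset.univ.filter fun v => ∃ θ ≤ T, FirstEntry g (drive w c (pos v)) θ ∧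
      Beyond g e (drive w c (pos v)) θ ∧ θ₀ ≤ θ ∧ θ ≤ θ₀ + W).card ≤ n * (W + 1) := by
  refine le_trans ?_ (Nat.mul_le_mul_right (W + 1) hn)
  rw [← Finset.card_range (W + 1), ← Finset.card_product]
  -- The lateral coordinate of the start and the delay after `θ₀` determine the start: parallel
  -- paths that both reach forward coordinate `80g` at the same time coincide.
  refine Finset.card_le_card_of_forall_subsingleton
    (fun v p => lat e (pos v) = p.1 ∧ θ₀ + p.2 ≤ T ∧ FirstEntry g (drive w c (pos v)) (θ₀ + p.2) ∧
      Beyond g e (drive w c (pos v)) (θ₀ + p.2)) ?_ ?_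
  · intro v hv
    obtain ⟨θ, h1, h2, h3, h4, h5⟩ := (Finset.mem_filter.1 hv).2
    have h6 : θ₀ + (θ - θ₀) = θ := by omega
    refine ⟨(lat e (pos v), θ - θ₀), ?_, rfl, ?_⟩
    · simp only [Finset.mem_product, Finset.mem_image, Finset.mem_univ, true_and, Finset.mem_range]
      exact ⟨⟨v, rfl⟩, by omega⟩
    · simp only [h6]
      exact ⟨h1, h2, h3⟩
  · rintro ⟨l, δ⟩ - v ⟨-, h1, h2, h3, h4⟩ v' ⟨-, h1', h2', h3', h4'⟩
    simp only at *
    exact hpos (eq_of_same_entry he (fun s hs => hw s (by omega)) h4 h4' (h1.trans h1'.symm) h3 h3')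

/-- The time at which the second coordinate enters the range of the square, in terms of the frame. -/
theorem exists_first_lat (he : IsUnitStep e) {z : ℕ → ℤ × ℤ} (hθ : FirstEntry g z θ) :
    ∃ σ ≤ θ, |lat e (z σ)| ≤ 80 * g ∧ ∀ s < σ, 80 * (g : ℤ) < |lat e (z s)| := by
  classical
  have h1 := ((he.inSquare_iff _ _).1 hθ.1).2
  have hex : ∃ σ, |lat e (z σ)| ≤ 80 * g := ⟨θ, h1⟩
  exact ⟨Nat.find hex, Nat.find_min' hex h1, Nat.find_spec hex,
    fun s hs => not_le.1 (Nat.find_min hex hs)⟩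

open scoped Classical in
/-- Few starting points lead to an entry from a given side close to a corner. -/
theorem card_corner_le {V : Type*} [Fintype V] {n W T : ℕ} (pos : V → ℤ × ℤ)
    (hpos : Function.Injective pos) (he : IsUnitStep e)
    (hn : (Finset.univ.image fun v => lat e (pos v)).card ≤ n)
    (hw : ∀ s < T, InSquare (80 * g) (w s)) :
    (Finset.univ.filter fun v => ∃ θ ≤ T, FirstEntry g (drive w c (pos v)) θ ∧
      Beyond g e (drive w c (pos v)) θ ∧
        ∀ s, s + W ≤ θ → 80 * (g : ℤ) < |lat e (drive w c (pos v) s)|).card ≤ n * (W + 1) := by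
  refine le_trans ?_ (Nat.mul_le_mul_right (W + 1) hn)
  rw [← Finset.card_range (W + 1), ← Finset.card_product]
  -- Here the entry time is measured from the time `σ` at which the lateral coordinate gets into
  -- range. Paths with the same initial lateral coordinate share `σ`, so a lateral coordinate and a
  -- delay again fix the start.
  refine Finset.card_le_card_of_forall_subsingleton
    (fun v p => lat e (pos v) = p.1 ∧ ∃ σ, σ + p.2 ≤ T ∧
      FirstEntry g (drive w c (pos v)) (σ + p.2) ∧ Beyond g e (drive w c (pos v)) (σ + p.2) ∧
      |lat e (drive w c (pos v) σ)| ≤ 80 * g ∧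
      ∀ s < σ, 80 * (g : ℤ) < |lat e (drive w c (pos v) s)|) ?_ ?_
  · intro v hv
    obtain ⟨θ, h1, h2, h3, h4⟩ := (Finset.mem_filter.1 hv).2
    obtain ⟨σ, h5, h6, h7⟩ := exists_first_lat he h2
    have h8 : σ + (θ - σ) = θ := by omega
    have h9 : θ < σ + W := by
      by_contra! h
      have := h4 σ h
      omega
    refine ⟨(lat e (pos v), θ - σ), ?_, rfl, σ, ?_⟩
    · simp only [Finset.mem_product, Finset.mem_image, Finset.mem_univ, true_and, Finset.mem_range]
      exact ⟨⟨v, rfl⟩, by omega⟩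
    · simp only [h8]
      exact ⟨h1, h2, h3, h6, h7⟩
  · have key : ∀ v v' l δ σ σ', lat e (pos v) = l → lat e (pos v') = l → σ ≤ σ' → σ' + δ ≤ T →
        FirstEntry g (drive w c (pos v)) (σ + δ) → FirstEntry g (drive w c (pos v')) (σ' + δ) →
        Beyond g e (drive w c (pos v)) (σ + δ) → Beyond g e (drive w c (pos v')) (σ' + δ) →
        |lat e (drive w c (pos v) σ)| ≤ 80 * g →
        (∀ s < σ', 80 * (g : ℤ) < |lat e (drive w c (pos v') s)|) → v = v' := by
      intro v v' l δ σ σ' hl hl' hσ hT hf hf' hb hb' h1 h2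
      -- The paths are comparable only until the earlier of the two entries; this suffices, as both
      -- values of `σ` are first times of the same lateral motion.
      have hb'' : Beyond g e (drive w c (pos v')) (σ + δ) :=
        ⟨hb.1, fun s hs => hb'.2 s (by omega)⟩
      have h3 := (drive_agree he (fun s hs => hw s (by omega)) hb hb'' (hl.trans hl'.symm) σ
        (by omega)).1
      have h4 : σ = σ' := by
        by_contra hne
        have := h2 σ (by omega)
        rw [← h3] at this
        omega
      subst h4
      exact hpos (eq_of_same_entry he (fun s hs => hw s (by omega)) hb hb' (hl.trans hl'.symm) hf hf')
    rintro ⟨l, δ⟩ - v ⟨-, h1, σ, h2, h3, h4, h5, h6⟩ v' ⟨-, h1', σ', h2', h3', h4', h5', h6'⟩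
    simp only at *
    rcases le_total σ σ' with h | h
    · exact key v v' l δ σ σ' h1 h1' h h2' h3 h3' h4 h4' h5 h6'
    · exact (key v' v l δ σ' σ h1' h1 h h2 h3' h3 h4' h4 h5' h6).symm

end drive

section BadEntry

variable {ι : Type*} [DecidableEq ι] (g T : ℕ) (c : ℕ → ι → Bool)

theorem play_update {A : Set ι} {j : ι} (hj : j ∉ A) (Z₀ : ι → ℤ × ℤ) (a : ℤ × ℤ) (t : ℕ) :
    (∀ i ≠ j, (play g T A (Function.update Z₀ j a) c t).1 i = (play g T A Z₀ c t).1 i) ∧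
    (play g T A (Function.update Z₀ j a) c t).2 = (play g T A Z₀ c t).2 := by
  induction t with
  | zero => exact ⟨fun i hi => by simp [play, hi], rfl⟩
  | succ t ih =>
    have h1 : ∀ i ≠ j, (play g T A (Function.update Z₀ j a) c (t + 1)).1 i =
        (play g T A Z₀ c (t + 1)).1 i := fun i hi => by
      simp only [play, ih.2, ih.1 i hi]
    refine ⟨h1, ?_⟩
    rw [play_snd_succ, play_snd_succ, ih.2]
    congr 1
    exact Set.image_congr fun i hi => h1 i (fun h => hj (h ▸ hi))

theorem play_update_self {A : Set ι} {j : ι} (hj : j ∉ A) (Z₀ : ι → ℤ × ℤ) (a : ℤ × ℤ) (t : ℕ) :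
    (play g T A (Function.update Z₀ j a) c t).1 j =
      drive (fun s => (play g T A Z₀ c s).2.1) (c · j) a t := by
  induction t with
  | zero => simp [play, drive]
  | succ t ih => simp only [play, drive, ih, (play_update g T c hj Z₀ a t).2]

-- As the survivor ignores `j`, his path and the entry times of the others do not depend on where
-- `j` starts. Bad entries split by the direction of entry (factor 4) and by the other zombie
-- involved or the corner case (at most `card ι + 1` cases).
open scoped Classical in
theorem card_badEntry_le {V : Type*} [Fintype V] [Fintype ι] {n : ℕ} (hg : 1 ≤ g) (pos : V → ℤ × ℤ)
    (hpos : Function.Injective pos) (hn : ∀ e, IsUnitStep e →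
      (Finset.univ.image fun v => lat e (pos v)).card ≤ n) (Z₀ : ι → ℤ × ℤ) (j : ι) :
    (Finset.univ.filter fun v => ¬ InSquare (80 * g) (pos v) ∧
      BadEntry g T (Function.update Z₀ j (pos v)) c j).card ≤
      4 * ((Fintype.card ι + 1) * (n * (600 * g + 1))) := by
  set T' := T + 1 - 5 * g with hT'
  set w := fun s => (play g T {j}ᶜ Z₀ c s).2.1 with hw
  have hsq : ∀ s < T', InSquare (80 * g) (w s) := by
    intro s hs
    rw [hw]
    simp only [play_snd]
    exact (route_inSquare g T _ hg s (by omega)).mono (by omega)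
  have hj : j ∉ ({j}ᶜ : Set ι) := by simp
  let D : Finset (ℤ × ℤ) := {(1, 0), (0, 1), (-1, 0), (0, -1)}
  have hD : ∀ e ∈ D, IsUnitStep e := by
    intro e he
    simpa [D, IsUnitStep] using he
  -- The value 0 for a zombie that never enters is irrelevant: only zombies with an entry are used
  -- as `i`.
  let time : ι → ℕ := fun i =>
    if h : ∃ θ, FirstEntry g (fun t => (play g T {j}ᶜ Z₀ c t).1 i) θ then h.choose else 0
  let S : (ℤ × ℤ) → Option ι → Finset V := fun e o => o.elim
    (Finset.univ.filter fun v => ∃ θ ≤ T', FirstEntry g (drive w (c · j) (pos v)) θ ∧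
      Beyond g e (drive w (c · j) (pos v)) θ ∧
        ∀ s, s + 600 * g ≤ θ → 80 * (g : ℤ) < |lat e (drive w (c · j) (pos v) s)|)
    (fun i => Finset.univ.filter fun v => ∃ θ ≤ T', FirstEntry g (drive w (c · j) (pos v)) θ ∧
      Beyond g e (drive w (c · j) (pos v)) θ ∧ time i ≤ θ ∧ θ ≤ time i + 600 * g)
  have hS : ∀ e ∈ D, ∀ o, (S e o).card ≤ n * (600 * g + 1) := by
    intro e he o
    rcases o with _ | i
    · exact card_corner_le pos hpos (hD e he) (hn e (hD e he)) hsq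
    · exact card_entry_le pos hpos (hD e he) (hn e (hD e he)) hsq (time i)
  have hsub : (Finset.univ.filter fun v => ¬ InSquare (80 * g) (pos v) ∧
      BadEntry g T (Function.update Z₀ j (pos v)) c j) ⊆
      D.biUnion fun e => Finset.univ.biUnion fun o => S e o := by
    intro v hv
    obtain ⟨h1, θ, h2, h3, h4⟩ := (Finset.mem_filter.1 hv).2
    have hθ : θ ≤ T' := by omega
    simp only [play_update_self g T c hj] at h3 h4
    obtain ⟨e, he, hb⟩ := exists_beyond (fun s hs => hsq s (by omega)) h1 h3
    simp only [Finset.mem_biUnion, Finset.mem_univ, true_and]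
    refine ⟨e, he, ?_⟩
    rcases h4 with ⟨i, hi, θ', h5, h6, h7⟩ | h4
    · refine ⟨some i, Finset.mem_filter.2 ⟨Finset.mem_univ v, θ, hθ, h3, hb, ?_⟩⟩
      have h8 : FirstEntry g (fun t => (play g T {j}ᶜ Z₀ c t).1 i) θ' := by
        simpa only [(play_update g T c hj Z₀ (pos v) _).1 i hi] using h6
      have h9 : time i = θ' := by
        have hex : ∃ θ, FirstEntry g (fun t => (play g T {j}ᶜ Z₀ c t).1 i) θ := ⟨θ', h8⟩
        have : time i = hex.choose := dif_pos hex
        rw [this]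
        exact hex.choose_spec.unique h8
      rw [h9]
      exact ⟨h5, h7⟩
    · refine ⟨none, Finset.mem_filter.2 ⟨Finset.mem_univ v, θ, hθ, h3, hb, fun s hs => ?_⟩⟩
      obtain ⟨h5, h6⟩ := h4 s hs
      rcases hD e he with rfl | rfl | rfl | rfl <;> simpa [lat] using by assumption
  refine (Finset.card_le_card hsub).trans ?_
  refine (Finset.card_biUnion_le_card_mul D _ ((Fintype.card ι + 1) * (n * (600 * g + 1))) ?_).trans
    (Nat.mul_le_mul_right _ ?_)
  · intro e he
    refine (Finset.card_biUnion_le_card_mul _ _ _ fun o _ => hS e he o).trans ?_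
    rw [Finset.card_univ, Fintype.card_option]
  · exact Finset.card_le_four

end BadEntry

/-! ### Most starting points and coins are favourable -/

section counting

-- Double counting: `(y, v)` is recovered from `update y j v` together with the overwritten value `y
-- j`, and the latter is one of at most `b` values that put the tuple into `S`.
open scoped Classical in
theorem card_mul_card_le_of_update {ι V : Type*} [Fintype ι] [DecidableEq ι] [Fintype V] (S : Finset (ι → V))
    (j : ι) (b : ℕ) (h : ∀ x : ι → V, (Finset.univ.filter fun v => Function.update x j v ∈ S).card ≤ b) :
    S.card * Fintype.card V ≤ b * Fintype.card (ι → V) := by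
  have h1 : (S ×ˢ (Finset.univ : Finset V)).card ≤
      ((Finset.univ : Finset (ι → V)).sigma
        fun x => Finset.univ.filter fun v => Function.update x j v ∈ S).card := by
    refine Finset.card_le_card_of_injOn (fun p => ⟨Function.update p.1 j p.2, p.1 j⟩) ?_ ?_
    · rintro ⟨y, v⟩ hp
      simpa using hp
    · rintro ⟨y, v⟩ - ⟨y', v'⟩ - heq
      simp only [Sigma.mk.injEq, heq_eq_eq] at heq
      obtain ⟨e1, e2⟩ := heq
      have e3 : v = v' := by simpa using congrFun e1 j
      have e4 : y = y' := by
        have := congrArg (fun f => Function.update f j (y j)) e1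
        simp only [Function.update_idem, Function.update_eq_self] at this
        rw [e2, Function.update_eq_self] at this
        exact this
      rw [e3, e4]
  rw [Finset.card_product, Finset.card_univ, Finset.card_sigma] at h1
  refine h1.trans ((Finset.sum_le_card_nsmul _ _ b fun x _ => h x).trans ?_)
  rw [Finset.card_univ, smul_eq_mul, mul_comm]

/-- Chernoff bound with weight `(1/3)^count`. Its mean is `(2/3)^(4m)`, and it is at least `(1/3)^m`
on the event; the quotient is `(16/27)^m`. -/
theorem card_few_coins_le {α : Type*} [Fintype α] [DecidableEq α] (A : Finset α) (b : Bool) (m : ℕ)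
    (hA : A.card = 4 * m) :
    ((Finset.univ.filter fun c : α → Bool => (A.filter fun a => c a = b).card < m).card : ℝ) ≤
      (16 / 27) ^ m * Fintype.card (α → Bool) := by
  have hsum : ∑ c : α → Bool, (1 / 3 : ℝ) ^ (A.filter fun a => c a = b).card =
      (2 / 3) ^ (4 * m) * Fintype.card (α → Bool) := by
    have h1 : ∀ c : α → Bool, (1 / 3 : ℝ) ^ (A.filter fun a => c a = b).card =
        ∏ a, if a ∈ A ∧ c a = b then (1 / 3 : ℝ) else 1 := by
      intro c
      rw [Finset.prod_ite, Finset.prod_const_one, mul_one, Finset.prod_const]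
      congr 2
      ext a
      simp
    simp only [h1]
    have h2 := Finset.prod_univ_sum (fun _ : α => (Finset.univ : Finset Bool))
      (fun a x => if a ∈ A ∧ x = b then (1 / 3 : ℝ) else 1)
    rw [Fintype.piFinset_univ] at h2
    rw [← h2]
    have h3 : ∀ a, (∑ x : Bool, if a ∈ A ∧ x = b then (1 / 3 : ℝ) else 1) =
        2 * if a ∈ A then (2 / 3 : ℝ) else 1 := by
      intro a
      by_cases ha : a ∈ A <;> cases b <;> simp [ha] <;> norm_num
    simp only [h3, Finset.prod_mul_distrib, Finset.prod_const, Finset.card_univ]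
    rw [Finset.prod_ite, Finset.prod_const_one, mul_one, Finset.prod_const]
    simp [hA, mul_comm]
  have hle : ((Finset.univ.filter fun c : α → Bool => (A.filter fun a => c a = b).card < m).card : ℝ) *
      (1 / 3) ^ m ≤ (2 / 3) ^ (4 * m) * Fintype.card (α → Bool) := by
    rw [← hsum, ← nsmul_eq_mul]
    refine (Finset.card_nsmul_le_sum _ _ _ ?_).trans
      (Finset.sum_le_sum_of_subset_of_nonneg (Finset.subset_univ _) fun _ _ _ => by positivity)
    intro c hc
    exact pow_le_pow_of_le_one (by norm_num) (by norm_num) (Finset.mem_filter.1 hc).2.le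
  have e : ((2 : ℝ) / 3) ^ (4 * m) = (16 / 27) ^ m * (1 / 3) ^ m := by
    rw [pow_mul, ← mul_pow]; norm_num
  rw [e, mul_right_comm] at hle
  exact le_of_mul_le_mul_right hle (by positivity)

end counting

/-- Finitely many coins, continued by the value `false`. -/
def extendCoins {k T : ℕ} (c : Fin T → Fin k → Bool) (t : ℕ) : Fin k → Bool :=
  if h : t < T then c ⟨t, h⟩ else fun _ => false

open scoped Classical in
theorem card_unbalanced_le (g T k : ℕ) (i : Fin k) :
    ((Finset.univ.filter fun c : Fin T → Fin k → Bool =>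
      ¬ BalancedCoins g T (extendCoins c · i)).card : ℝ) ≤
      2 * (T + 1) * (16 / 27) ^ g * Fintype.card (Fin T → Fin k → Bool) := by
  let B : Bool × ℕ → Finset (Fin T → Fin k → Bool) := fun p => Finset.univ.filter fun c =>
    p.2 + 4 * g ≤ T ∧ coinCount (extendCoins c · i) p.1 p.2 (p.2 + 4 * g) < g
  have hB : ∀ p, ((B p).card : ℝ) ≤ (16 / 27) ^ g * Fintype.card (Fin T → Fin k → Bool) := by
    rintro ⟨b, a⟩
    by_cases ha : a + 4 * g ≤ T
    · let A : Finset (Fin T × Fin k) :=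
        (Finset.univ.filter fun s : Fin T => a ≤ s ∧ (s : ℕ) < a + 4 * g) ×ˢ {i}
      have hcount : ∀ q : ℕ → Prop, ∀ [DecidablePred q],
          (Finset.univ.filter fun s : Fin T => (a ≤ s ∧ (s : ℕ) < a + 4 * g) ∧ q s).card =
            ((Finset.Ico a (a + 4 * g)).filter q).card := by
        intro q _
        rw [← Finset.card_map Fin.valEmbedding]
        congr 1
        ext s
        simp only [Finset.mem_map, Finset.mem_filter, Finset.mem_univ, true_and, Fin.valEmbedding_apply,
          Finset.mem_Ico]
        constructor
        · rintro ⟨s, h, rfl⟩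
          exact h
        · rintro h
          exact ⟨⟨s, by omega⟩, h, rfl⟩
      have hA : A.card = 4 * g := by
        have := hcount (fun _ => True)
        simp only [and_true, Finset.filter_true, Nat.card_Ico] at this
        rw [Finset.card_product, Finset.card_singleton, mul_one, this]
        omega
      have h1 := card_few_coins_le A b g hA
      rw [← Fintype.card_congr (Equiv.curry (Fin T) (Fin k) Bool)]
      refine le_trans ?_ h1
      norm_cast
      refine Finset.card_le_card_of_injOn (fun c p => c p.1 p.2) ?_ ?_
      · intro c hc
        have h2 := (Finset.mem_filter.1 hc).2.2
        simp only [Finset.coe_filter, Finset.mem_univ, true_and, Set.mem_ofPred_eq]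
        refine lt_of_le_of_lt ?_ h2
        unfold coinCount
        rw [← hcount]
        refine Finset.card_le_card_of_injOn Prod.fst ?_ ?_
        · rintro ⟨s, i'⟩ hs
          simp only [A, Finset.coe_filter, Finset.mem_product, Finset.mem_filter, Finset.mem_univ,
            true_and, Finset.mem_singleton, Set.mem_ofPred_eq] at hs ⊢
          obtain ⟨⟨h3, rfl⟩, h4⟩ := hs
          exact ⟨h3, by simp [extendCoins, h4]⟩
        · rintro ⟨s, i'⟩ hs ⟨s', i''⟩ hs' heq
          simp only [A, Finset.coe_filter, Finset.mem_product, Finset.mem_singleton,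
            Set.mem_ofPred_eq] at hs hs' heq
          rw [heq, hs.1.2, hs'.1.2]
      · intro c _ c' _ h
        funext s i'
        exact congrFun h (s, i')
    · have : B (b, a) = ∅ := by
        simp only [B, ha, false_and, Finset.filter_false]
      rw [this]
      simp only [Finset.card_empty, Nat.cast_zero]
      positivity
  have hsub : (Finset.univ.filter fun c : Fin T → Fin k → Bool =>
      ¬ BalancedCoins g T (extendCoins c · i)) ⊆
      ((Finset.univ : Finset Bool) ×ˢ Finset.range (T + 1)).biUnion B := by
    intro c hc
    have h1 := (Finset.mem_filter.1 hc).2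
    simp only [BalancedCoins, not_forall, not_le] at h1
    obtain ⟨b, a, h2, h3⟩ := h1
    exact Finset.mem_biUnion.2 ⟨(b, a), by simp; omega, by simp [B, h2, h3]⟩
  calc _ ≤ ((((Finset.univ : Finset Bool) ×ˢ Finset.range (T + 1)).biUnion B).card : ℝ) := by
        exact_mod_cast Finset.card_le_card hsub
    _ ≤ ∑ p ∈ (Finset.univ : Finset Bool) ×ˢ Finset.range (T + 1), ((B p).card : ℝ) := by
        exact_mod_cast Finset.card_biUnion_le
    _ ≤ ∑ p ∈ (Finset.univ : Finset Bool) ×ˢ Finset.range (T + 1),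
          (16 / 27) ^ g * (Fintype.card (Fin T → Fin k → Bool) : ℝ) := Finset.sum_le_sum fun p _ => hB p
    _ = _ := by
        rw [Finset.sum_const, Finset.card_product, Finset.card_univ, Finset.card_range, nsmul_eq_mul,
          Fintype.card_bool]
        push_cast
        ring

/-- The representative of `a` modulo `n` of least absolute value. -/
def centered {n : ℕ} (a : Fin n) : ℤ := if (a : ℕ) ≤ n / 2 then a else (a : ℤ) - n

theorem centered_injective {n : ℕ} : Function.Injective (centered (n := n)) := by
  intro a b h
  unfold centered at h
  apply Fin.ext
  split_ifs at h <;> omega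

theorem abs_centered_le {n : ℕ} (a : Fin n) : |centered a| ≤ n / 2 := by
  have := a.2
  unfold centered
  rw [abs_le]
  split_ifs <;> omega

/-- The starting positions lie in the ring between the squares of radius `80 g` and `N`, and the coins
and the entries are as in a tame chase. -/
def Favourable {ι : Type*} (g T : ℕ) (N : ℕ) (Z₀ : ι → ℤ × ℤ) (c : ℕ → ι → Bool) : Prop :=
  (∀ i, InSquare N (Z₀ i) ∧ ¬ InSquare (80 * g) (Z₀ i)) ∧ (∀ i, BalancedCoins g T (c · i)) ∧
    ∀ j, ¬ BadEntry g T Z₀ c j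

/-- The coordinates of `v` relative to `q`. -/
def relPos {n : ℕ} (q v : Fin n × Fin n) : ℤ × ℤ := (centered (v.1 - q.1), centered (v.2 - q.2))

theorem relPos_injective {n : ℕ} [NeZero n] (q : Fin n × Fin n) : Function.Injective (relPos q) := by
  rintro ⟨a, b⟩ ⟨a', b'⟩ h
  simp only [relPos, Prod.mk.injEq] at h
  have h1 := centered_injective h.1
  have h2 := centered_injective h.2
  rw [sub_left_inj] at h1 h2
  rw [h1, h2]

theorem card_image_lat_relPos_le {n : ℕ} (q : Fin n × Fin n) {e : ℤ × ℤ} (he : IsUnitStep e) :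
    (Finset.univ.image fun v : Fin n × Fin n => lat e (relPos q v)).card ≤ n := by
  have key : ∀ f : Fin n × Fin n → Fin n, ∀ G : Fin n → ℤ,
      (∀ v, lat e (relPos q v) = G (f v)) →
      (Finset.univ.image fun v : Fin n × Fin n => lat e (relPos q v)).card ≤ n := by
    intro f G h
    have h1 : (Finset.univ.image fun v : Fin n × Fin n => lat e (relPos q v)) ⊆
        Finset.univ.image G := by
      intro x hx
      obtain ⟨v, -, rfl⟩ := Finset.mem_image.1 hx
      exact Finset.mem_image.2 ⟨f v, Finset.mem_univ _, (h v).symm⟩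
    exact (Finset.card_le_card h1).trans (Finset.card_image_le.trans (by simp))
  rcases he with rfl | rfl | rfl | rfl
  · exact key Prod.snd (fun a => centered (a - q.2)) fun v => by simp [lat, relPos]
  · exact key Prod.fst (fun a => -centered (a - q.1)) fun v => by simp [lat, relPos]
  · exact key Prod.snd (fun a => -centered (a - q.2)) fun v => by simp [lat, relPos]
  · exact key Prod.fst (fun a => centered (a - q.1)) fun v => by simp [lat, relPos]

/-- About `160g` values are too close to the centre, and about `180g` lie within `90g` of the
antipode. -/
theorem card_bad_coordinate_le {n g : ℕ} [NeZero n] (hg : 1 ≤ g) (q : Fin n) :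
    (Finset.univ.filter fun a : Fin n => |centered (a - q)| ≤ 80 * g ∨
      ((n / 2 - 90 * g : ℕ) : ℤ) < |centered (a - q)|).card ≤ 400 * g := by
  set N := n / 2 - 90 * g with hN
  have h1 : (Finset.univ.filter fun a : Fin n => |centered (a - q)| ≤ 80 * g ∨
      (N : ℤ) < |centered (a - q)|).card ≤
      (Finset.Icc (-(80 * g : ℤ)) (80 * g) ∪ (Finset.Icc (N + 1 : ℤ) ((n / 2 : ℕ) : ℤ) ∪
        Finset.Icc (-((n / 2 : ℕ) : ℤ)) (-(N + 1 : ℤ)))).card := by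
    refine Finset.card_le_card_of_injOn (fun a => centered (a - q)) ?_ ?_
    · intro a ha
      have h2 := (Finset.mem_filter.1 ha).2
      have h3 := abs_centered_le (a - q)
      simp only [Finset.coe_union, Finset.coe_Icc, Set.mem_union, Set.mem_Icc]
      simp only [abs_eq_max_neg] at h2 h3
      omega
    · intro a _ b _ h
      exact sub_left_inj.1 (centered_injective h)
  refine h1.trans ((Finset.card_union_le _ _).trans
    ((Nat.add_le_add_left (Finset.card_union_le _ _) _).trans ?_))
  simp only [Int.card_Icc]
  omega

open scoped Classical in
theorem card_bad_start_le {n g : ℕ} [NeZero n] (hg : 1 ≤ g) (q : Fin n × Fin n) :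
    (Finset.univ.filter fun v : Fin n × Fin n =>
      ¬ (InSquare ((n / 2 - 90 * g : ℕ) : ℤ) (relPos q v) ∧ ¬ InSquare (80 * g) (relPos q v))).card ≤
      800 * g * n := by
  let C : Fin n → Finset (Fin n) := fun r => Finset.univ.filter fun a : Fin n =>
    |centered (a - r)| ≤ 80 * g ∨ ((n / 2 - 90 * g : ℕ) : ℤ) < |centered (a - r)|
  have hsub : (Finset.univ.filter fun v : Fin n × Fin n =>
      ¬ (InSquare ((n / 2 - 90 * g : ℕ) : ℤ) (relPos q v) ∧ ¬ InSquare (80 * g) (relPos q v))) ⊆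
      (C q.1 ×ˢ Finset.univ) ∪ (Finset.univ ×ˢ C q.2) := by
    intro v hv
    have h1 := (Finset.mem_filter.1 hv).2
    simp only [InSquare, relPos] at h1
    simp only [C, Finset.mem_union, Finset.mem_product, Finset.mem_filter, Finset.mem_univ, true_and,
      and_true]
    by_contra! h2
    exact h1 ⟨⟨h2.1.2, h2.2.2⟩, fun h => absurd h.1 (not_le.2 h2.1.1)⟩
  refine (Finset.card_le_card hsub).trans ((Finset.card_union_le _ _).trans ?_)
  rw [Finset.card_product, Finset.card_product, Finset.card_univ, Fintype.card_fin]
  have h1 := Nat.mul_le_mul_right n (card_bad_coordinate_le hg q.1)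
  have h2 := Nat.mul_le_mul_left n (card_bad_coordinate_le hg q.2)
  calc _ ≤ 400 * g * n + n * (400 * g) := add_le_add h1 h2
    _ = _ := by ring

open scoped Classical in
theorem card_filter_prod {α β : Type*} [Fintype α] [Fintype β] (R : α → β → Prop) :
    (Finset.univ.filter fun p : α × β => R p.1 p.2).card =
      ∑ b, (Finset.univ.filter fun a => R a b).card := by
  rw [Finset.card_filter, Fintype.sum_prod_type_right]
  exact Finset.sum_congr rfl fun b _ => (Finset.card_filter _ _).symm

open scoped Classical in
/-- An event that, given all other data, has few values of the starting point of the zombie `j`. -/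
theorem card_start_event_le {V C : Type*} [Fintype V] [Fintype C] [Nonempty V] {k : ℕ} (j : Fin k)
    (R : (Fin k → V) → C → Prop) (b : ℕ)
    (h : ∀ x c, (Finset.univ.filter fun v => R (Function.update x j v) c).card ≤ b) :
    ((Finset.univ.filter fun p : (Fin k → V) × C => R p.1 p.2).card : ℝ) ≤
      b / Fintype.card V * Fintype.card ((Fin k → V) × C) := by
  have h1 : (Finset.univ.filter fun p : (Fin k → V) × C => R p.1 p.2).card * Fintype.card V ≤
      b * Fintype.card ((Fin k → V) × C) := by
    rw [card_filter_prod, Finset.sum_mul, Fintype.card_prod]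
    refine (Finset.sum_le_card_nsmul Finset.univ _ (b * Fintype.card (Fin k → V)) ?_).trans ?_
    · intro c _
      refine card_mul_card_le_of_update (Finset.univ.filter fun x => R x c) j b fun x => ?_
      simpa only [Finset.mem_filter, Finset.mem_univ, true_and] using h x c
    · rw [Finset.card_univ, smul_eq_mul]
      exact le_of_eq (by ring)
  have h2 : (0 : ℝ) < Fintype.card V := by exact_mod_cast Fintype.card_pos
  rw [div_mul_eq_mul_div, le_div_iff₀ h2]
  exact_mod_cast h1

-- Union bound over the zombies and three kinds of failure: a start outside the ring, a bad entry
-- from a start outside the inner square, unbalanced coins.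
open scoped Classical in
theorem card_not_favourable_le {n g : ℕ} [NeZero n] (T k : ℕ) (hg : 1 ≤ g) (q : Fin n × Fin n) :
    ((Finset.univ.filter fun p : (Fin k → Fin n × Fin n) × (Fin T → Fin k → Bool) =>
      ¬ Favourable g T (n / 2 - 90 * g) (fun i => relPos q (p.1 i)) (extendCoins p.2)).card : ℝ) ≤
      k * (800 * g / n + 4 * (k + 1) * (600 * g + 1) / n + 2 * (T + 1) * (16 / 27) ^ g) *
        Fintype.card ((Fin k → Fin n × Fin n) × (Fin T → Fin k → Bool)) := by
  set N := n / 2 - 90 * g with hN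
  let S₁ : Fin k → Finset ((Fin k → Fin n × Fin n) × (Fin T → Fin k → Bool)) := fun j =>
    Finset.univ.filter fun p =>
    ¬ (InSquare N (relPos q (p.1 j)) ∧ ¬ InSquare (80 * g) (relPos q (p.1 j)))
  let S₂ : Fin k → Finset ((Fin k → Fin n × Fin n) × (Fin T → Fin k → Bool)) := fun j =>
    Finset.univ.filter fun p =>
    ¬ InSquare (80 * g) (relPos q (p.1 j)) ∧
      BadEntry g T (fun i => relPos q (p.1 i)) (extendCoins p.2) j
  let S₃ : Fin k → Finset ((Fin k → Fin n × Fin n) × (Fin T → Fin k → Bool)) := fun j =>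
    Finset.univ.filter fun p =>
    ¬ BalancedCoins g T (extendCoins p.2 · j)
  have hn : (n : ℝ) ≠ 0 := by exact_mod_cast NeZero.ne n
  have h₁ : ∀ j, ((S₁ j).card : ℝ) ≤ 800 * g / n *
      Fintype.card ((Fin k → Fin n × Fin n) × (Fin T → Fin k → Bool)) := by
    intro j
    have := card_start_event_le (C := Fin T → Fin k → Bool) j (fun x _ =>
      ¬ (InSquare N (relPos q (x j)) ∧ ¬ InSquare (80 * g) (relPos q (x j)))) (800 * g * n)
      (fun x c => by simpa only [Function.update_self] using card_bad_start_le hg q)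
    refine le_trans (le_of_eq ?_) (this.trans (le_of_eq ?_))
    · simp only [S₁]; congr
    · rw [Fintype.card_prod (Fin n) (Fin n), Fintype.card_fin]
      push_cast
      field_simp
  have h₂ : ∀ j, ((S₂ j).card : ℝ) ≤ 4 * (k + 1) * (600 * g + 1) / n *
      Fintype.card ((Fin k → Fin n × Fin n) × (Fin T → Fin k → Bool)) := by
    intro j
    have := card_start_event_le (C := Fin T → Fin k → Bool) j (fun x c =>
      ¬ InSquare (80 * g) (relPos q (x j)) ∧
        BadEntry g T (fun i => relPos q (x i)) (extendCoins c) j)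
      (4 * ((k + 1) * (n * (600 * g + 1))))
      (fun x c => by
        have h1 := card_badEntry_le g T (extendCoins c) hg (relPos q) (relPos_injective q)
          (fun e he => card_image_lat_relPos_le q he) (fun i => relPos q (x i)) j
        rw [Fintype.card_fin] at h1
        refine le_trans (le_of_eq ?_) h1
        congr 1
        ext v
        simp only [Finset.mem_filter, Finset.mem_univ, true_and, Function.update_self]
        have e : (fun i => relPos q (Function.update x j v i)) =
            Function.update (fun i => relPos q (x i)) j (relPos q v) := by
          funext i
          by_cases hi : i = j
          · subst hi; simp
          · simp [hi]
        rw [e])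
    refine le_trans (le_of_eq ?_) (this.trans (le_of_eq ?_))
    · simp only [S₂]; congr
    · rw [Fintype.card_prod (Fin n) (Fin n), Fintype.card_fin]
      push_cast
      field_simp
  have h₃ : ∀ j, ((S₃ j).card : ℝ) ≤ 2 * (T + 1) * (16 / 27) ^ g *
      Fintype.card ((Fin k → Fin n × Fin n) × (Fin T → Fin k → Bool)) := by
    intro j
    have h1 := card_unbalanced_le g T k j
    have h2 : S₃ j = Finset.univ ×ˢ (Finset.univ.filter fun c : Fin T → Fin k → Bool =>
        ¬ BalancedCoins g T (extendCoins c · j)) := by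
      ext p
      simp [S₃]
    rw [h2, Finset.card_product, Finset.card_univ, Fintype.card_prod]
    push_cast
    calc _ ≤ (Fintype.card (Fin k → Fin n × Fin n) : ℝ) *
          (2 * (T + 1) * (16 / 27) ^ g * Fintype.card (Fin T → Fin k → Bool)) := by gcongr
      _ = _ := by ring
  have hsub : (Finset.univ.filter fun p : (Fin k → Fin n × Fin n) × (Fin T → Fin k → Bool) =>
      ¬ Favourable g T N (fun i => relPos q (p.1 i)) (extendCoins p.2)) ⊆
      Finset.univ.biUnion fun j => S₁ j ∪ (S₂ j ∪ S₃ j) := by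
    intro p hp
    have h1 := (Finset.mem_filter.1 hp).2
    simp only [Finset.mem_biUnion, Finset.mem_union, Finset.mem_univ, true_and, S₁, S₂, S₃,
      Finset.mem_filter]
    by_contra! h2
    exact h1 ⟨fun i => (h2 i).1, fun i => (h2 i).2.2, fun j => (h2 j).2.1 (h2 j).1.2⟩
  calc _ ≤ (((Finset.univ : Finset (Fin k)).biUnion fun j => S₁ j ∪ (S₂ j ∪ S₃ j)).card : ℝ) := by
        exact_mod_cast Finset.card_le_card hsub
    _ ≤ ∑ j, (((S₁ j).card : ℝ) + ((S₂ j).card + (S₃ j).card)) := by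
        have h1 : (Finset.univ.biUnion fun j => S₁ j ∪ (S₂ j ∪ S₃ j)).card ≤
            ∑ j, ((S₁ j).card + ((S₂ j).card + (S₃ j).card)) :=
          Finset.card_biUnion_le.trans (Finset.sum_le_sum fun j _ =>
            (Finset.card_union_le _ _).trans (Nat.add_le_add_left (Finset.card_union_le _ _) _))
        exact_mod_cast h1
    _ ≤ ∑ _j : Fin k, (800 * g / n *
          Fintype.card ((Fin k → Fin n × Fin n) × (Fin T → Fin k → Bool)) + (4 * (k + 1) * (600 * g + 1) / n *
          Fintype.card ((Fin k → Fin n × Fin n) × (Fin T → Fin k → Bool)) +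
          2 * (T + 1) * (16 / 27) ^ g *
            Fintype.card ((Fin k → Fin n × Fin n) × (Fin T → Fin k → Bool))) : ℝ) :=
        Finset.sum_le_sum fun j _ => add_le_add (h₁ j) (add_le_add (h₂ j) (h₃ j))
    _ = _ := by
        rw [Finset.sum_const, Finset.card_univ, Fintype.card_fin, nsmul_eq_mul]
        ring

/-! ### Integer coordinates on the torus -/

theorem lt_two_mul_centered {n : ℕ} (a : Fin n) : -(n : ℤ) < 2 * centered a ∧ 2 * centered a ≤ n := by
  have := a.2
  unfold centered
  split_ifs <;> omega

section torus

variable {n : ℕ} [NeZero n]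

variable (n) in
/-- Reduction modulo `n`. -/
def emb : ℤ →+ Fin n :=
  AddMonoidHom.mk' (fun z => ⟨(z % n).toNat, by
    have := Int.emod_lt_of_pos z (show (0 : ℤ) < n by exact_mod_cast Nat.pos_of_neZero n)
    have := Int.emod_nonneg z (show (n : ℤ) ≠ 0 by exact_mod_cast NeZero.ne n)
    omega⟩) (by
    intro a b
    have hn : (n : ℤ) ≠ 0 := by exact_mod_cast NeZero.ne n
    apply Fin.ext
    rw [Fin.val_add]
    zify
    rw [Int.toNat_of_nonneg (Int.emod_nonneg _ hn), Int.toNat_of_nonneg (Int.emod_nonneg _ hn),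
      Int.toNat_of_nonneg (Int.emod_nonneg _ hn)]
    exact Int.add_emod a b n)

theorem emb_val (z : ℤ) : ((emb n z : ℕ) : ℤ) = z % n :=
  Int.toNat_of_nonneg (Int.emod_nonneg _ (by exact_mod_cast NeZero.ne n))

theorem emb_natCast (i : ℕ) : emb n (i : ℤ) = Fin.ofNat n i := by
  apply Fin.ext
  zify
  rw [emb_val]
  simp

theorem emb_val_self (a : Fin n) : emb n ((a : ℕ) : ℤ) = a := by
  rw [emb_natCast]
  apply Fin.ext
  simp

theorem emb_self : emb n (n : ℤ) = 0 := by
  rw [emb_natCast]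
  apply Fin.ext
  simp

theorem emb_centered (a : Fin n) : emb n (centered a) = a := by
  unfold centered
  split_ifs
  · exact emb_val_self a
  · rw [map_sub, emb_val_self, emb_self, sub_zero]

theorem emb_eq_zero_iff (z : ℤ) : emb n z = 0 ↔ (n : ℤ) ∣ z := by
  rw [Fin.ext_iff, Int.dvd_iff_emod_eq_zero, ← emb_val]
  simp

theorem eq_of_emb_eq {a b : ℤ} (h : emb n a = emb n b) (hab : |a - b| < n) : a = b := by
  rw [← sub_eq_zero, ← map_sub, emb_eq_zero_iff] at h
  have := Int.eq_zero_of_abs_lt_dvd h hab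
  omega

theorem centered_emb {z : ℤ} (hz : 2 * |z| < n) : centered (emb n z) = z := by
  have h1 := lt_two_mul_centered (emb n z)
  refine eq_of_emb_eq (emb_centered _) ?_
  rw [abs_lt] at *
  have := abs_le.1 (le_refl |z|)
  omega

/-- At the antipode `2|z| = n` the representative may change its sign, but not its absolute value.
-/
theorem centered_emb_natAbs {z : ℤ} (hz : 2 * |z| ≤ n) : |centered (emb n z)| = |z| := by
  have h1 := lt_two_mul_centered (emb n z)
  obtain ⟨k, hk⟩ : (n : ℤ) ∣ centered (emb n z) - z := by
    rw [← emb_eq_zero_iff, map_sub, emb_centered, sub_self]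
  have hn : (0 : ℤ) < n := by exact_mod_cast Nat.pos_of_neZero n
  have h2 := abs_le.1 (le_refl |z|)
  have h3 : k < 2 := by nlinarith
  have h4 : -2 < k := by nlinarith
  obtain rfl | rfl | rfl : k = -1 ∨ k = 0 ∨ k = 1 := by omega
  all_goals simp only [abs_eq_max_neg] at *; omega

theorem abs_centered_add_one (a : Fin n) :
    |centered (a + emb n 1)| ≤ |centered a| + 1 ∧ |centered a| ≤ |centered (a + emb n 1)| + 1 := by
  have h1 := lt_two_mul_centered a
  have h2 := lt_two_mul_centered (a + emb n 1)
  obtain ⟨k, hk⟩ : (n : ℤ) ∣ centered (a + emb n 1) - centered a - 1 := by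
    rw [← emb_eq_zero_iff, map_sub, map_sub, emb_centered, emb_centered]
    abel
  have hn : (0 : ℤ) < n := by exact_mod_cast Nat.pos_of_neZero n
  have h3 : k < 1 := by nlinarith
  have h4 : -2 < k := by nlinarith
  obtain rfl | rfl : k = -1 ∨ k = 0 := by omega
  all_goals simp only [abs_eq_max_neg] at *; omega

theorem cycleGraph_adj_iff (hn : 2 ≤ n) (a b : Fin n) :
    (SimpleGraph.cycleGraph n).Adj a b ↔ b = a + emb n 1 ∨ b = a + emb n (-1) := by
  have h1 : ∀ c : Fin n, (c : ℕ) = 1 ↔ c = emb n 1 := by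
    intro c
    have h2 : (emb n 1 : ℕ) = 1 := by
      zify
      rw [emb_val, Int.emod_eq_of_lt] <;> omega
    rw [Fin.ext_iff, h2]
  rw [SimpleGraph.cycleGraph_adj', h1, h1, sub_eq_iff_eq_add, sub_eq_iff_eq_add, map_neg, or_comm]
  refine or_congr ⟨fun h => by rw [h, add_comm], fun h => by rw [h, add_comm]⟩
    ⟨fun h => by rw [h]; abel, fun h => by rw [h]; abel⟩

/-- The centred absolute value is 1-Lipschitz along edges, which gives the lower bound for distances
in the cycle. -/
theorem abs_centered_le_length (hn : 2 ≤ n) (a : Fin n) {b b' : Fin n}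
    (p : (SimpleGraph.cycleGraph n).Walk b b') :
    |centered (b - a)| ≤ |centered (b' - a)| + p.length := by
  induction p with
  | nil => simp
  | cons h p ih =>
    rw [SimpleGraph.Walk.length_cons]
    rw [cycleGraph_adj_iff hn] at h
    push_cast
    rcases h with h | h
    · rename_i u v w
      have := abs_centered_add_one (u - a)
      rw [show u - a + emb n 1 = v - a by rw [h]; abel] at this
      omega
    · rename_i u v w
      have := abs_centered_add_one (v - a)
      rw [show v - a + emb n 1 = u - a by rw [h, map_neg]; abel] at this
      omega

theorem cycleGraph_connected_of_neZero : (SimpleGraph.cycleGraph n).Connected := by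
  obtain ⟨m, rfl⟩ : ∃ m, n = m + 1 := ⟨n - 1, by have := NeZero.ne n; omega⟩
  exact SimpleGraph.cycleGraph_connected

theorem cycleGraph_dist_emb (hn : 2 ≤ n) (a : Fin n) {z : ℤ} (hz : 2 * |z| ≤ n) :
    ((SimpleGraph.cycleGraph n).dist (a + emb n z) a : ℤ) = |z| := by
  have hc := cycleGraph_connected_of_neZero (n := n)
  apply le_antisymm
  · have key : ∀ s : ℤ, (s = 1 ∨ s = -1) → ∀ m : ℕ,
        (SimpleGraph.cycleGraph n).dist (a + emb n (s * m)) a ≤ m := by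
      intro s hs m
      induction m with
      | zero => simp
      | succ m ih =>
        have h1 : (SimpleGraph.cycleGraph n).Adj (a + emb n (s * m)) (a + emb n (s * (m + 1 : ℕ))) := by
          rw [cycleGraph_adj_iff hn]
          push_cast
          rw [mul_add, mul_one, map_add, ← add_assoc]
          rcases hs with rfl | rfl
          · left; rfl
          · right; rfl
        have h2 := hc.dist_triangle (u := a + emb n (s * (m + 1 : ℕ))) (v := a + emb n (s * m)) (w := a)
        rw [SimpleGraph.dist_eq_one_iff_adj.2 h1.symm] at h2
        omega
    rcases abs_cases z with ⟨h, h'⟩ | ⟨h, h'⟩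
    · have := key 1 (Or.inl rfl) z.natAbs
      rw [show (1 : ℤ) * z.natAbs = z by omega] at this
      omega
    · have := key (-1) (Or.inr rfl) z.natAbs
      rw [show (-1 : ℤ) * z.natAbs = z by omega] at this
      omega
  · obtain ⟨p, hp⟩ := hc.exists_walk_length_eq_dist (a + emb n z) a
    have := abs_centered_le_length hn a p
    rw [add_sub_cancel_left, sub_self, centered_emb_natAbs hz, hp] at this
    simpa [centered] using this

variable (n) in
/-- Reduction modulo `n` in both coordinates. -/
def embPair : ℤ × ℤ →+ Fin n × Fin n := (emb n).prodMap (emb n)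

theorem embPair_apply (z : ℤ × ℤ) : embPair n z = (emb n z.1, emb n z.2) := rfl

theorem torusGrid_dist (hn : 2 ≤ n) (u : Fin n × Fin n) {z : ℤ × ℤ} (h1 : 2 * |z.1| ≤ n)
    (h2 : 2 * |z.2| ≤ n) : ((torusGrid n).dist (u + embPair n z) u : ℤ) = |z.1| + |z.2| := by
  have hc := cycleGraph_connected_of_neZero (n := n)
  have h : (torusGrid n).dist (u + embPair n z) u =
      (SimpleGraph.cycleGraph n).dist (u.1 + emb n z.1) u.1 +
      (SimpleGraph.cycleGraph n).dist (u.2 + emb n z.2) u.2 := by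
    unfold torusGrid
    rw [SimpleGraph.dist, SimpleGraph.edist_boxProd]
    rw [ENat.toNat_add]
    · rfl
    · exact SimpleGraph.edist_ne_top_iff_reachable.2 (hc.preconnected _ _)
    · exact SimpleGraph.edist_ne_top_iff_reachable.2 (hc.preconnected _ _)
  rw [h]
  push_cast
  rw [cycleGraph_dist_emb hn _ h1, cycleGraph_dist_emb hn _ h2]

theorem torusGrid_adj_iff (hn : 2 ≤ n) (v w : Fin n × Fin n) :
    (torusGrid n).Adj v w ↔ ∃ d, IsUnitStep d ∧ w = v + embPair n d := by
  unfold torusGrid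
  rw [SimpleGraph.boxProd_adj, cycleGraph_adj_iff hn, cycleGraph_adj_iff hn]
  obtain ⟨v1, v2⟩ := v
  obtain ⟨w1, w2⟩ := w
  constructor
  · rintro (⟨h | h, h'⟩ | ⟨h | h, h'⟩)
    · exact ⟨(1, 0), Or.inl rfl, by simp_all [embPair_apply]⟩
    · exact ⟨(-1, 0), Or.inr (Or.inr (Or.inl rfl)), by simp_all [embPair_apply]⟩
    · exact ⟨(0, 1), Or.inr (Or.inl rfl), by simp_all [embPair_apply]⟩
    · exact ⟨(0, -1), Or.inr (Or.inr (Or.inr rfl)), by simp_all [embPair_apply]⟩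
  · rintro ⟨d, rfl | rfl | rfl | rfl, h⟩ <;> simp_all [embPair_apply]

theorem chaseStep_add (u z : ℤ × ℤ) (c : Bool) :
    chaseStep u (u + z) c = u + chaseStep 0 z c := by
  unfold chaseStep
  simp only [Prod.fst_add, Prod.snd_add, add_eq_left, ne_eq, Prod.fst_zero, Prod.snd_zero]
  split_ifs <;> ext <;> simp <;> ring

/-- A unit step from `z` that comes closer to the origin is one of the two moves of a zombie. -/
theorem exists_chaseStep_eq {z d : ℤ × ℤ} (hd : IsUnitStep d)
    (h : |(z + d).1| + |(z + d).2| < |z.1| + |z.2|) : ∃ c, chaseStep 0 z c = z + d := by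
  obtain ⟨z1, z2⟩ := z
  simp only [chaseStep, Prod.fst_zero, Prod.snd_zero, abs_eq_max_neg] at *
  rcases hd with rfl | rfl | rfl | rfl <;> simp only [Prod.mk_add_mk, add_zero] at h ⊢
  · exact ⟨true, by simp [show z1 ≠ 0 by omega, Int.sign_eq_neg_one_of_neg (show z1 < 0 by omega)]⟩
  · exact ⟨false, by
      simp [show z2 ≠ 0 by omega, Int.sign_eq_neg_one_of_neg (show z2 < 0 by omega)]⟩
  · exact ⟨true, by simp [show z1 ≠ 0 by omega, Int.sign_eq_one_of_pos (show 0 < z1 by omega)]⟩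
  · exact ⟨false, by simp [show z2 ≠ 0 by omega, Int.sign_eq_one_of_pos (show 0 < z2 by omega)]⟩

theorem exists_unitStep_chaseStep {z : ℤ × ℤ} (hz : z ≠ 0) (c : Bool) :
    ∃ d, IsUnitStep d ∧ chaseStep 0 z c = z + d ∧ |(z + d).1| + |(z + d).2| = |z.1| + |z.2| - 1 := by
  obtain ⟨z1, z2⟩ := z
  have hz' : z1 ≠ 0 ∨ z2 ≠ 0 := by
    by_contra! h
    exact hz (Prod.ext h.1 h.2)
  unfold chaseStep
  simp only [Prod.fst_zero, Prod.snd_zero, zero_sub, Int.sign_neg, abs_eq_max_neg]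
  split_ifs with h
  · rcases sign_cases z1 with ⟨h1, h2⟩ | ⟨h1, h2⟩ | ⟨h1, h2⟩
    · refine ⟨(-1, 0), Or.inr (Or.inr (Or.inl rfl)), by simp [h2], ?_⟩
      simp only [Prod.mk_add_mk]; omega
    · exact absurd h1 h.1
    · refine ⟨(1, 0), Or.inl rfl, by simp [h2], ?_⟩
      simp only [Prod.mk_add_mk]; omega
  · have h0 : z2 ≠ 0 := by
      intro h0
      rcases hz' with h1 | h1
      · exact h ⟨h1, Or.inr h0⟩
      · exact h1 h0
    rcases sign_cases z2 with ⟨h1, h2⟩ | ⟨h1, h2⟩ | ⟨h1, h2⟩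
    · refine ⟨(0, -1), Or.inr (Or.inr (Or.inr rfl)), by simp [h2], ?_⟩
      simp only [Prod.mk_add_mk]; omega
    · exact absurd h1 h0
    · refine ⟨(0, 1), Or.inr (Or.inl rfl), by simp [h2], ?_⟩
      simp only [Prod.mk_add_mk]; omega

/-- The margin 1 ensures that the torus distance of all neighbours of `z` is the planar `ℓ¹` norm
too, so the steps that come closer are those of the plane. For `z = 0` the default option of staying
put agrees with `chaseStep`. -/
theorem zombieOptions_add_embPair (hn : 2 ≤ n) (u : Fin n × Fin n) {z : ℤ × ℤ}
    (h1 : 2 * (|z.1| + 1) ≤ n) (h2 : 2 * (|z.2| + 1) ≤ n) :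
    zombieOptions (torusGrid n) u (u + embPair n z) =
      Set.range fun c => u + embPair n (chaseStep 0 z c) := by
  have hd0 := torusGrid_dist hn u (z := z) (by omega) (by omega)
  have hstep : ∀ d, IsUnitStep d → ((torusGrid n).dist (u + embPair n (z + d)) u : ℤ) =
      |(z + d).1| + |(z + d).2| := by
    intro d hd
    refine torusGrid_dist hn u ?_ ?_ <;> simp only [Prod.fst_add, Prod.snd_add, abs_eq_max_neg] at * <;>
      rcases hd with rfl | rfl | rfl | rfl <;> omega
  have hset : {w | (torusGrid n).Adj (u + embPair n z) w ∧
      (torusGrid n).dist w u < (torusGrid n).dist (u + embPair n z) u} =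
      {w | z ≠ 0 ∧ ∃ c, w = u + embPair n (chaseStep 0 z c)} := by
    ext w
    simp only [Set.mem_ofPred_eq, torusGrid_adj_iff hn]
    constructor
    · rintro ⟨⟨d, hd, rfl⟩, hlt⟩
      rw [add_assoc, ← map_add] at hlt ⊢
      have h3 := hstep d hd
      obtain ⟨c, hc⟩ := exists_chaseStep_eq (z := z) hd (by omega)
      refine ⟨?_, c, by rw [hc]⟩
      rintro rfl
      have h5 : |(0 : ℤ × ℤ).1| + |(0 : ℤ × ℤ).2| = 0 := by simp
      omega
    · rintro ⟨hz, c, rfl⟩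
      obtain ⟨d, hd, e, h3⟩ := exists_unitStep_chaseStep hz c
      have h4 := hstep d hd
      rw [e]
      refine ⟨⟨d, hd, by rw [map_add, add_assoc]⟩, ?_⟩
      omega
  unfold zombieOptions
  rw [hset]
  by_cases hz : z = 0
  · subst hz
    rw [if_neg]
    · ext w
      simp [chaseStep, Prod.mk_zero_zero, eq_comm]
    · simp
  · rw [if_pos]
    · ext w
      simp [hz, @eq_comm _ w]
    · exact ⟨_, hz, true, rfl⟩

/-- The vertex with coordinates `z` relative to `q`. -/
def place (q : Fin n × Fin n) (z : ℤ × ℤ) : Fin n × Fin n := q + embPair n z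

theorem zombieOptions_place (hn : 2 ≤ n) (q : Fin n × Fin n) {u z : ℤ × ℤ}
    (h1 : 2 * (|z.1 - u.1| + 1) ≤ n) (h2 : 2 * (|z.2 - u.2| + 1) ≤ n) :
    zombieOptions (torusGrid n) (place q u) (place q z) =
      Set.range fun c => place q (chaseStep u z c) := by
  have h := zombieOptions_add_embPair hn (place q u) (z := z - u) h1 h2
  have e : place q u + embPair n (z - u) = place q z := by
    unfold place
    rw [map_sub]
    abel
  rw [e] at h
  rw [h]
  congr 1
  funext c
  have := chaseStep_add u (z - u) c
  rw [add_sub_cancel] at this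
  rw [this]
  unfold place
  rw [map_add, add_assoc]

theorem place_relPos (q v : Fin n × Fin n) : place q (relPos q v) = v := by
  unfold place relPos
  rw [embPair_apply, emb_centered, emb_centered]
  ext1 <;> simp

theorem relPos_place (q : Fin n × Fin n) {z : ℤ × ℤ} (h1 : 2 * |z.1| < n) (h2 : 2 * |z.2| < n) :
    relPos q (place q z) = z := by
  unfold place relPos
  rw [embPair_apply]
  ext1 <;> simp [centered_emb, h1, h2]

theorem place_injOn (q : Fin n × Fin n) {u z : ℤ × ℤ} (h1 : |z.1 - u.1| < n) (h2 : |z.2 - u.2| < n)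
    (h : place q z = place q u) : z = u := by
  unfold place at h
  rw [add_right_inj, embPair_apply, embPair_apply, Prod.mk.injEq] at h
  exact Prod.ext (eq_of_emb_eq h.1 h1) (eq_of_emb_eq h.2 h2)

end torus

/-! ### Finite-dimensional distributions of the game -/

section trajMeasure

open Preorder

variable {X : Type*} [MeasurableSpace X] {μ₀ : Measure X}
  (κ : (n : ℕ) → Kernel ((i : Finset.Iic n) → X) X) [∀ n, IsMarkovKernel (κ n)]

theorem trajMeasure_succ [IsProbabilityMeasure μ₀] [MeasurableSingletonClass X] (t : ℕ)
    (h : (i : Finset.Iic t) → X) (y : X) :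
    Kernel.trajMeasure (X := fun _ => X) μ₀ κ
      {z | frestrictLe (π := fun _ => X) t z = h ∧ z (t + 1) = y} =
    Kernel.trajMeasure (X := fun _ => X) μ₀ κ {z | frestrictLe (π := fun _ => X) t z = h} *
      κ t h {y} := by
  have h1 := Kernel.map_frestrictLe_trajMeasure_compProd_eq_map_trajMeasure
    (X := fun _ => X) (μ₀ := μ₀) (κ := κ) (a := t)
  have h2 := congrArg (fun ν => ν ({h} ×ˢ {y})) h1
  have hm : MeasurableSet ({h} ×ˢ {y} : Set (((i : Finset.Iic t) → X) × X)) :=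
    (measurableSet_singleton h).prod (measurableSet_singleton y)
  rw [Measure.compProd_apply_prod (measurableSet_singleton h) (measurableSet_singleton y),
    Measure.restrict_singleton, lintegral_smul_measure, lintegral_dirac,
    Measure.map_apply (by fun_prop) hm,
    Measure.map_apply (by fun_prop) (measurableSet_singleton h)] at h2
  rw [smul_eq_mul] at h2
  have e1 : (frestrictLe (π := fun _ => X) t) ⁻¹' {h} = {z | frestrictLe (π := fun _ => X) t z = h} := by
    ext z; simp
  have e2 : (fun x : ℕ → X => (frestrictLe (π := fun _ => X) t x, x (t + 1))) ⁻¹' ({h} ×ˢ {y}) =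
      {z | frestrictLe (π := fun _ => X) t z = h ∧ z (t + 1) = y} := by
    ext z; simp
  rw [e1, e2] at h2
  exact h2.symm

theorem trajMeasure_zero :
    (Kernel.trajMeasure (X := fun _ => X) μ₀ κ).map (fun z => z 0) = μ₀ := by
  have h1 : (Kernel.trajMeasure (X := fun _ => X) μ₀ κ).map (frestrictLe (π := fun _ => X) 0) =
      μ₀.map (MeasurableEquiv.piUnique (fun _ : Finset.Iic 0 => X)).symm := by
    rw [Kernel.trajMeasure, Measure.map_comp _ _ (by fun_prop), Kernel.traj_map_frestrictLe,
      Kernel.partialTraj_self]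
    exact Measure.id_comp
  have h2 : (fun z : ℕ → X => z 0) =
      (MeasurableEquiv.piUnique (fun _ : Finset.Iic 0 => X)) ∘ frestrictLe (π := fun _ => X) 0 := by
    funext z
    rfl
  rw [h2, ← Measure.map_map (by fun_prop) (by fun_prop), h1, Measure.map_map (by fun_prop) (by fun_prop)]
  have h3 : (MeasurableEquiv.piUnique (fun _ : Finset.Iic 0 => X)) ∘
      (MeasurableEquiv.piUnique (fun _ : Finset.Iic 0 => X)).symm = id := by
    funext x
    exact MeasurableEquiv.apply_symm_apply _ x
  rw [h3, Measure.map_id]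

theorem trajMeasure_ae_mem [IsProbabilityMeasure μ₀] [Finite X] [MeasurableSingletonClass X] (t : ℕ)
    (J : ((i : Finset.Iic t) → X) → Set X) (hJ : ∀ h, κ t h (J h)ᶜ = 0) :
    ∀ᵐ z ∂Kernel.trajMeasure (X := fun _ => X) μ₀ κ,
      z (t + 1) ∈ J (frestrictLe (π := fun _ => X) t z) := by
  have h1 := Kernel.map_frestrictLe_trajMeasure_compProd_eq_map_trajMeasure
    (X := fun _ => X) (μ₀ := μ₀) (κ := κ) (a := t)
  have hm : MeasurableSet {p : ((i : Finset.Iic t) → X) × X | p.2 ∈ (J p.1)ᶜ} :=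
    (Set.toFinite _).measurableSet
  have h2 := congrArg (fun ν => ν {p : ((i : Finset.Iic t) → X) × X | p.2 ∈ (J p.1)ᶜ}) h1
  rw [Measure.compProd_apply hm, Measure.map_apply (by fun_prop) hm] at h2
  rw [ae_iff]
  refine Eq.trans ?_ (h2.symm.trans ?_)
  · rfl
  · exact (lintegral_congr fun h => hJ h).trans lintegral_zero

end trajMeasure

/-! ### Comparison of the process with independent uniform coins -/

section coupling

open Preorder

theorem frestrictLe_succ_eq_iff {X : Type*} (t : ℕ) (z : ℕ → X) (h : (i : Finset.Iic (t + 1)) → X) :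
    frestrictLe (π := fun _ => X) (t + 1) z = h ↔
      frestrictLe (π := fun _ => X) t z = frestrictLe₂ (π := fun _ => X) (Nat.le_succ t) h ∧
        z (t + 1) = h ⟨t + 1, Finset.mem_Iic.2 le_rfl⟩ := by
  constructor
  · rintro rfl
    exact ⟨rfl, rfl⟩
  · rintro ⟨h1, h2⟩
    funext ⟨i, hi⟩
    rw [Finset.mem_Iic] at hi
    rcases Nat.lt_or_ge t i with hlt | hle
    · obtain rfl : i = t + 1 := by omega
      exact h2
    · exact congrFun h1 ⟨i, Finset.mem_Iic.2 hle⟩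

variable {X β : Type*} [Fintype X] [Fintype β] [Nonempty β] [MeasurableSpace X]
  [MeasurableSingletonClass X] {μ₀ : Measure X} [IsProbabilityMeasure μ₀]
  (κ : (n : ℕ) → Kernel ((i : Finset.Iic n) → X) X) [∀ n, IsMarkovKernel (κ n)] {T : ℕ}
  (path : X → (Fin T → β) → ℕ → X) (Reg : ℕ → X → (Fin T → β) → Prop)

open scoped Classical in
/-- The law of a process is at least the law of a function of independent uniform variables that has
the right transition probabilities at regular steps. -/
theorem card_history_le (h0 : ∀ x b, path x b 0 = x)
    (hpath : ∀ x b (s : Fin T) v, ∀ t ≤ (s : ℕ), path x (Function.update b s v) t = path x b t)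
    (hReg : ∀ x b (s : Fin T) v, ∀ t ≤ (s : ℕ), Reg t x b → Reg t x (Function.update b s v))
    (hstep : ∀ x b (s : Fin T), Reg s x b → ∀ y,
      ((Finset.univ.filter fun v => path x (Function.update b s v) (s + 1) = y).card : ℝ≥0∞) ≤
        Fintype.card β * κ s (frestrictLe (π := fun _ => X) (s : ℕ) (path x b)) {y})
    (hμ : ∀ x, 1 ≤ μ₀ {x} * Fintype.card X) (t : ℕ) (ht : t ≤ T) (h : (i : Finset.Iic t) → X) :
    ((Finset.univ.filter fun p : X × (Fin T → β) => (∀ s < t, Reg s p.1 p.2) ∧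
      frestrictLe (π := fun _ => X) t (path p.1 p.2) = h).card : ℝ≥0∞) ≤
      Kernel.trajMeasure (X := fun _ => X) μ₀ κ {z | frestrictLe (π := fun _ => X) t z = h} *
        Fintype.card (X × (Fin T → β)) := by
  induction t with
  | zero =>
    have e : ∀ z : ℕ → X, frestrictLe (π := fun _ => X) 0 z = h ↔
        z 0 = h ⟨0, Finset.mem_Iic.2 le_rfl⟩ := by
      intro z
      constructor
      · rintro rfl; rfl
      · intro hz
        funext ⟨i, hi⟩
        obtain rfl : i = 0 := by simpa using hi
        exact hz
    have e1 : Kernel.trajMeasure (X := fun _ => X) μ₀ κ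
        {z | frestrictLe (π := fun _ => X) 0 z = h} = μ₀ {h ⟨0, Finset.mem_Iic.2 le_rfl⟩} := by
      conv_rhs => rw [← trajMeasure_zero (μ₀ := μ₀) κ]
      rw [Measure.map_apply (by fun_prop) (measurableSet_singleton _)]
      congr 1
      ext z
      simp [e]
    rw [e1]
    refine le_trans (Nat.cast_le.2 (?_ : _ ≤ Fintype.card (Fin T → β))) ?_
    · rw [← Finset.card_univ]
      refine Finset.card_le_card_of_injOn Prod.snd (fun _ _ => Finset.mem_coe.2 (Finset.mem_univ _)) ?_
      rintro ⟨x, b⟩ hx ⟨x', b'⟩ hx' (rfl : b = b')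
      simp only [Finset.coe_filter, Finset.mem_univ, true_and, Set.mem_ofPred_eq, e, h0] at hx hx'
      rw [hx.2, hx'.2]
    · rw [Fintype.card_prod]
      push_cast
      rw [← mul_assoc]
      exact le_mul_of_one_le_left zero_le (hμ _)
  | succ t ih =>
    set h' := frestrictLe₂ (π := fun _ => X) (Nat.le_succ t) h with hh'
    set y := h ⟨t + 1, Finset.mem_Iic.2 le_rfl⟩ with hy
    have ht' : t < T := by omega
    set S := Finset.univ.filter fun p : X × (Fin T → β) => (∀ s < t + 1, Reg s p.1 p.2) ∧
      frestrictLe (π := fun _ => X) (t + 1) (path p.1 p.2) = h with hS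
    set E := Finset.univ.filter fun p : X × (Fin T → β) => (∀ s < t + 1, Reg s p.1 p.2) ∧
      frestrictLe (π := fun _ => X) t (path p.1 p.2) = h' with hE
    have hEle : (E.card : ℝ≥0∞) ≤ Kernel.trajMeasure (X := fun _ => X) μ₀ κ
        {z | frestrictLe (π := fun _ => X) t z = h'} * Fintype.card (X × (Fin T → β)) := by
      refine le_trans ?_ (ih (by omega) h')
      norm_cast
      refine Finset.card_le_card fun p hp => ?_
      rw [hE, Finset.mem_filter] at hp
      exact Finset.mem_filter.2 ⟨hp.1, fun s hs => hp.2.1 s (by omega), hp.2.2⟩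
    have hpres : ∀ x b v, frestrictLe (π := fun _ => X) t
        (path x (Function.update b ⟨t, ht'⟩ v)) = frestrictLe (π := fun _ => X) t (path x b) := by
      intro x b v
      funext ⟨i, hi⟩
      exact hpath x b ⟨t, ht'⟩ v i (Finset.mem_Iic.1 hi)
    -- Resample the coin at time `t`: the past is unaffected, and the original coin, kept as the
    -- second component, is a value leading to `y`.
    have h1 : (S ×ˢ (Finset.univ : Finset β)).card ≤ (E.sigma fun p =>
        Finset.univ.filter fun v => path p.1 (Function.update p.2 ⟨t, ht'⟩ v) (t + 1) = y).card := by
      refine Finset.card_le_card_of_injOn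
        (fun q => ⟨(q.1.1, Function.update q.1.2 ⟨t, ht'⟩ q.2), q.1.2 ⟨t, ht'⟩⟩) ?_ ?_
      · rintro ⟨⟨x, b⟩, v⟩ hp
        simp only [hS, Finset.coe_product, Set.mem_prod, Finset.mem_coe, Finset.mem_filter,
          Finset.mem_univ, true_and, Finset.coe_univ, Set.mem_univ, and_true] at hp
        obtain ⟨hp1, hp2⟩ := hp
        rw [frestrictLe_succ_eq_iff] at hp2
        simp only [hE, Finset.coe_sigma, Set.mem_sigma_iff, Finset.mem_coe, Finset.mem_filter,
          Finset.mem_univ, true_and, Function.update_idem, Function.update_eq_self]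
        refine ⟨⟨fun s hs => hReg x b ⟨t, ht'⟩ v s (by simp; omega) (hp1 s hs), ?_⟩, hp2.2⟩
        rw [hpres]
        exact hp2.1
      · rintro ⟨⟨x, b⟩, v⟩ - ⟨⟨x', b'⟩, v'⟩ - heq
        simp only [Sigma.mk.injEq, Prod.mk.injEq, heq_eq_eq] at heq
        obtain ⟨⟨rfl, e1⟩, e2⟩ := heq
        have e3 : v = v' := by simpa using congrFun e1 ⟨t, ht'⟩
        have e4 := congrArg (fun f => Function.update f ⟨t, ht'⟩ (b ⟨t, ht'⟩)) e1
        simp only [Function.update_idem, Function.update_eq_self] at e4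
        rw [e2, Function.update_eq_self] at e4
        rw [e3, e4]
    rw [Finset.card_product, Finset.card_sigma, Finset.card_univ] at h1
    have h2 : (S.card : ℝ≥0∞) * Fintype.card β ≤
        E.card * (Fintype.card β * κ t h' {y}) := by
      calc (S.card : ℝ≥0∞) * Fintype.card β ≤ ∑ p ∈ E, ((Finset.univ.filter fun v =>
            path p.1 (Function.update p.2 ⟨t, ht'⟩ v) (t + 1) = y).card : ℝ≥0∞) := by
            exact_mod_cast h1
        _ ≤ ∑ p ∈ E, (Fintype.card β * κ t h' {y}) := by
            refine Finset.sum_le_sum fun p hp => ?_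
            rw [hE, Finset.mem_filter] at hp
            have := hstep p.1 p.2 ⟨t, ht'⟩ (hp.2.1 t (by omega)) y
            simp only [hp.2.2] at this
            exact this
        _ = _ := by rw [Finset.sum_const, nsmul_eq_mul]
    have h3 : (S.card : ℝ≥0∞) ≤ E.card * κ t h' {y} := by
      rw [mul_left_comm, mul_comm (Fintype.card β : ℝ≥0∞)] at h2
      refine (ENNReal.mul_le_mul_iff_left ?_ (ENNReal.natCast_ne_top _)).1 h2
      exact_mod_cast Fintype.card_ne_zero
    have h4 : {z : ℕ → X | frestrictLe (π := fun _ => X) (t + 1) z = h} =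
        {z | frestrictLe (π := fun _ => X) t z = h' ∧ z (t + 1) = y} := by
      ext z
      exact frestrictLe_succ_eq_iff t z h
    rw [h4, trajMeasure_succ]
    calc (S.card : ℝ≥0∞) ≤ E.card * κ t h' {y} := h3
      _ ≤ _ := mul_le_mul_left hEle _
      _ = _ := by ring

-- Sum of the estimate for single histories over the disjoint events given by the different
-- histories up to `T`.
open scoped Classical in
theorem card_le_trajMeasure (h0 : ∀ x b, path x b 0 = x)
    (hpath : ∀ x b (s : Fin T) v, ∀ t ≤ (s : ℕ), path x (Function.update b s v) t = path x b t)
    (hReg : ∀ x b (s : Fin T) v, ∀ t ≤ (s : ℕ), Reg t x b → Reg t x (Function.update b s v))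
    (hstep : ∀ x b (s : Fin T), Reg s x b → ∀ y,
      ((Finset.univ.filter fun v => path x (Function.update b s v) (s + 1) = y).card : ℝ≥0∞) ≤
        Fintype.card β * κ s (frestrictLe (π := fun _ => X) (s : ℕ) (path x b)) {y})
    (hμ : ∀ x, 1 ≤ μ₀ {x} * Fintype.card X) (G : Finset (X × (Fin T → β)))
    (hG : ∀ p ∈ G, ∀ s < T, Reg s p.1 p.2) :
    (G.card : ℝ≥0∞) ≤ Kernel.trajMeasure (X := fun _ => X) μ₀ κ
      {z | ∃ p ∈ G, ∀ t ≤ T, z t = path p.1 p.2 t} * Fintype.card (X × (Fin T → β)) := by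
  let f : X × (Fin T → β) → ((i : Finset.Iic T) → X) :=
    fun p => frestrictLe (π := fun _ => X) T (path p.1 p.2)
  have h1 : G.card = ∑ h ∈ G.image f, (G.filter fun p => f p = h).card :=
    Finset.card_eq_sum_card_image f G
  have h2 : ∀ h ∈ G.image f, ((G.filter fun p => f p = h).card : ℝ≥0∞) ≤
      Kernel.trajMeasure (X := fun _ => X) μ₀ κ {z | frestrictLe (π := fun _ => X) T z = h} *
        Fintype.card (X × (Fin T → β)) := by
    intro h _
    refine le_trans ?_ (card_history_le κ path Reg h0 hpath hReg hstep hμ T le_rfl h)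
    norm_cast
    refine Finset.card_le_card fun p hp => ?_
    rw [Finset.mem_filter] at hp
    exact Finset.mem_filter.2 ⟨Finset.mem_univ _, hG p hp.1, hp.2⟩
  have hmeas : ∀ h : (i : Finset.Iic T) → X,
      MeasurableSet {z : ℕ → X | frestrictLe (π := fun _ => X) T z = h} := fun h =>
    (measurable_frestrictLe (X := fun _ => X) T) (measurableSet_singleton h)
  have h3 : ∑ h ∈ G.image f, Kernel.trajMeasure (X := fun _ => X) μ₀ κ
      {z | frestrictLe (π := fun _ => X) T z = h} =
      Kernel.trajMeasure (X := fun _ => X) μ₀ κ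
        (⋃ h ∈ G.image f, {z | frestrictLe (π := fun _ => X) T z = h}) := by
    rw [measure_biUnion_finset]
    · intro h _ h' _ hne
      refine Set.disjoint_left.2 fun z hz hz' => hne ?_
      exact hz.symm.trans hz'
    · exact fun h _ => hmeas h
  calc (G.card : ℝ≥0∞) = ∑ h ∈ G.image f, ((G.filter fun p => f p = h).card : ℝ≥0∞) := by
        exact_mod_cast h1
    _ ≤ ∑ h ∈ G.image f, Kernel.trajMeasure (X := fun _ => X) μ₀ κ
          {z | frestrictLe (π := fun _ => X) T z = h} * Fintype.card (X × (Fin T → β)) :=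
        Finset.sum_le_sum h2
    _ = _ := by rw [← Finset.sum_mul, h3]
    _ ≤ _ := by
        refine mul_le_mul_left (measure_mono ?_) _
        intro z hz
        simp only [Set.mem_iUnion, Finset.mem_image, exists_prop] at hz
        obtain ⟨h, ⟨p, hp, rfl⟩, hz⟩ := hz
        exact ⟨p, hp, fun t ht => congrFun hz ⟨t, Finset.mem_Iic.2 ht⟩⟩

end coupling

/-! ### The survivor's strategy on the torus -/

/-- The turn rule sees only zombies in `[-80g, 80g]²`. This makes the strategy boxed. -/
theorem route_congr {g T : ℕ} {P P' : ℕ → Set (ℤ × ℤ)} (t : ℕ)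
    (h : ∀ s ≤ t, ∀ v, InSquare (80 * g) v → (v ∈ P s ↔ v ∈ P' s)) : route g T P t = route g T P' t := by
  induction t with
  | zero => rfl
  | succ t ih =>
    have h1 := ih fun s hs => h s (by omega)
    have h2 : TurnsLeft g T t (P (t + 1)) (route g T P' t) ↔
        TurnsLeft g T t (P' (t + 1)) (route g T P' t) := by
      unfold TurnsLeft
      refine and_congr_right fun _ => and_congr_right fun _ => forall_congr' fun v => ?_
      constructor
      · exact fun h3 h4 h5 => h3 ((h (t + 1) le_rfl v h5).2 h4) h5
      · exact fun h3 h4 h5 => h3 ((h (t + 1) le_rfl v h5).1 h4) h5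
    simp only [route, h1]
    unfold advance
    by_cases h3 : TurnsLeft g T t (P' (t + 1)) (route g T P' t)
    · rw [if_pos h3, if_pos (h2.2 h3)]
    · rw [if_neg h3, if_neg (fun h => h3 (h2.1 h))]

section strategy

open Preorder

variable {n k : ℕ}

/-- The relative positions of the zombies in the configuration `z`. -/
def seenFrom (q : Fin n × Fin n) (z : Config (Fin n × Fin n) k) : Set (ℤ × ℤ) :=
  Set.range fun i => relPos q (z i)

/-- A history, continued by its last configuration. -/
def History.extend {V : Type*} {t : ℕ} (h : History V k t) (s : ℕ) : Config V k :=
  h ⟨min s t, Finset.mem_Iic.2 (min_le_right s t)⟩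

theorem History.extend_frestrictLe {V : Type*} (z : ℕ → Config V k) {s t : ℕ} (h : s ≤ t) :
    History.extend (frestrictLe (π := fun _ => Config V k) t z) s = z s := by
  change z (min s t) = z s
  rw [min_eq_left h]

theorem route_extend_frestrictLe (g T : ℕ) (q : Fin n × Fin n)
    (z : ℕ → Config (Fin n × Fin n) k) {s t : ℕ} (h : s ≤ t) :
    route g T (fun r => seenFrom q (History.extend
      (frestrictLe (π := fun _ => Config (Fin n × Fin n) k) t z) r)) s =
    route g T (fun r => seenFrom q (z r)) s := by
  refine route_congr s fun r hr v _ => ?_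
  rw [History.extend_frestrictLe z (by omega)]

variable [NeZero n]

/-- The survivor follows the route whose centre is the vertex `q`. -/
noncomputable def routeStrategy (g T : ℕ) (hn : 2 ≤ n) (q : Fin n × Fin n) :
    SurvivorStrategy (torusGrid n) k where
  pos t h := place q (route g T (fun s => seenFrom q (h.extend s)) t).1
  move t z := by
    right
    rw [torusGrid_adj_iff hn]
    refine ⟨_, isUnitStep_route g T (fun s => seenFrom q (z s)) (t + 1), ?_⟩
    rw [route_extend_frestrictLe g T q z le_rfl, route_extend_frestrictLe g T q z le_rfl,
      route_fst_succ]
    unfold place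
    rw [map_add, add_assoc]

variable (g T : ℕ) (hn : 2 ≤ n) (q : Fin n × Fin n)

theorem traj_routeStrategy (z : ℕ → Config (Fin n × Fin n) k) (t : ℕ) :
    (routeStrategy g T hn q).traj z t = place q (route g T (fun s => seenFrom q (z s)) t).1 := by
  change place q _ = _
  rw [route_extend_frestrictLe g T q z le_rfl]

theorem place_mem_torusBox (p : Fin n × Fin n) {m : ℕ} (hm : 180 * g ≤ m) (hg : 1 ≤ g) {z : ℤ × ℤ}
    (hz : InSquare (85 * g) z) : place (place p (90 * g, 90 * g)) z ∈ torusBox p m := by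
  obtain ⟨h1, h2⟩ := hz
  rw [abs_le] at h1 h2
  refine ⟨(90 * g + z.1).toNat, (90 * g + z.2).toNat, by omega, by omega, ?_⟩
  rw [← emb_natCast, ← emb_natCast, Int.toNat_of_nonneg (by omega), Int.toNat_of_nonneg (by omega)]
  simp only [place, embPair_apply, map_add]
  ext1 <;> simp [add_assoc]

theorem isBoxed_routeStrategy (p : Fin n × Fin n) {m : ℕ} (hm : 180 * g ≤ m) (hg : 1 ≤ g)
    (hT : 5 * g ≤ T) :
    (routeStrategy (k := k) g T hn (place p (90 * g, 90 * g))).IsBoxed (torusBox p m) T := by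
  refine ⟨⟨place (place p (90 * g, 90 * g)) (-3 * g, -3 * g), ?_, fun h => rfl⟩, ?_, ?_⟩
  · refine place_mem_torusBox g p hm hg ?_
    simp only [InSquare, abs_le]
    omega
  · exact fun t ht h => place_mem_torusBox g p hm hg (route_inSquare_of_le g T _ hg hT t ht)
  · intro t ht h h' heq
    change place _ _ = place _ _
    congr 2
    refine route_congr t fun s hs v hv => ?_
    have key : ∀ h h' : History (Fin n × Fin n) k t,
        (∀ s i, h s i = h' s i ∨ (h s i ∉ torusBox p m ∧ h' s i ∉ torusBox p m)) →
        v ∈ seenFrom (place p (90 * g, 90 * g)) (h.extend s) →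
        v ∈ seenFrom (place p (90 * g, 90 * g)) (h'.extend s) := by
      rintro h h' heq ⟨i, hi⟩
      refine ⟨i, ?_⟩
      rcases heq ⟨min s t, Finset.mem_Iic.2 (min_le_right s t)⟩ i with h1 | ⟨h1, -⟩
      · rw [← hi]
        change relPos _ (h' _ i) = relPos _ (h _ i)
        rw [h1]
      · refine absurd ?_ h1
        have h2 := place_relPos (place p (90 * g, 90 * g)) (h.extend s i)
        change h.extend s i ∈ _
        rw [← h2]
        refine place_mem_torusBox g p hm hg ?_
        rw [show relPos _ (h.extend s i) = v from hi]
        exact hv.mono (by omega)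
    exact ⟨key h h' heq, key h' h fun s i => (heq s i).imp Eq.symm And.symm⟩

/-- The difference of consecutive positions. -/
theorem traj_succ_sub (z : ℕ → Config (Fin n × Fin n) k) (t : ℕ) :
    (routeStrategy g T hn q).traj z (t + 1) - (routeStrategy g T hn q).traj z t =
      embPair n (route g T (fun s => seenFrom q (z s)) (t + 1)).2 := by
  rw [traj_routeStrategy, traj_routeStrategy, route_fst_succ]
  unfold place
  rw [map_add]
  abel

theorem embPair_unitStep_injective (hn : 3 ≤ n) {d d' : ℤ × ℤ} (hd : IsUnitStep d)
    (hd' : IsUnitStep d') (h : embPair n d = embPair n d') : d = d' := by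
  refine place_injOn (n := n) 0 (u := d') (z := d) ?_ ?_ (by simp [place, h]) <;>
    rcases hd with rfl | rfl | rfl | rfl <;> rcases hd' with rfl | rfl | rfl | rfl <;>
      simp <;> omega

/-- A change of step can only come from a left turn, never a reversal. Turns are `6g` apart, the
first is not before `6g - 1`, and none comes in the last `5g` rounds. -/
theorem isStableTrajectory_routeStrategy (hn3 : 3 ≤ n) (hT : 5 * g ≤ T)
    (hlog : ⌊20 * Real.log n⌋₊ ≤ g) (z : ℕ → Config (Fin n × Fin n) k) :
    IsStableTrajectory ((routeStrategy g T hn q).traj z) 0 T := by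
  set P := fun s => seenFrom q (z s) with hP
  have hd := isUnitStep_route g T P
  have hturn : ∀ j, 0 < j → (routeStrategy g T hn q).traj z j -
      (routeStrategy g T hn q).traj z (j - 1) ≠
      (routeStrategy g T hn q).traj z (j + 1) - (routeStrategy g T hn q).traj z j →
      TurnsLeft g T j (P (j + 1)) (route g T P j) := by
    intro j hj h
    obtain ⟨i, rfl⟩ : ∃ i, j = i + 1 := ⟨j - 1, by omega⟩
    rw [add_tsub_cancel_right, traj_succ_sub, traj_succ_sub] at h
    by_contra h'
    exact h (by rw [(route_straight g T P h').1])
  refine ⟨?_, ?_, ?_⟩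
  · intro t _ _
    rw [torusGrid_adj_iff hn]
    refine ⟨_, hd (t + 1), ?_⟩
    rw [← traj_succ_sub g T hn q z t]
    abel
  · intro j hj _ hne heq
    have h1 := hturn j hj hne
    obtain ⟨i, rfl⟩ : ∃ i, j = i + 1 := ⟨j - 1, by omega⟩
    rw [add_tsub_cancel_right, traj_succ_sub, traj_succ_sub, ← map_neg] at heq
    have hneg : IsUnitStep (-(route g T P (i + 1 + 1)).2) := by
      rcases hd (i + 1 + 1) with h | h | h | h <;> rw [h] <;> simp [IsUnitStep]
    have h2 := embPair_unitStep_injective hn3 (hd _) hneg heq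
    rw [(route_turn g T P h1).1] at h2
    rcases hd (i + 1) with h | h | h | h <;> rw [h] at h2 <;> simp [turnLeft] at h2
  · intro j j' hj hj' hlt
    refine hlog.trans ?_
    rcases hj' with rfl | rfl | ⟨h1, h2, h3⟩
    · omega
    · rcases hj with rfl | rfl | ⟨h4, h5, h6⟩
      · omega
      · omega
      · have := (hturn j h4 h6).1
        omega
    · have h7 := hturn j' h1 h3
      rcases hj with rfl | rfl | ⟨h4, h5, h6⟩
      · have := route_first_turn g T P h7
        omega
      · omega
      · have := route_turn_gap g T P hlt (hturn j h4 h6) h7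
        omega

end strategy

/-! ### The zombies' moves in terms of coins -/

instance {V : Type*} [Fintype V] {k : ℕ} : Fintype (Config V k) :=
  inferInstanceAs (Fintype (Fin k → V))

-- A fibre is a product of factors of size 1 or 2, where 2 means that both coins of a zombie give
-- the same move. Its size does not depend on the value, so uniform coins give a uniform joint move
-- even when some zombies have a single option.
open scoped Classical in
theorem card_fibre_mul_card_range {ι V X : Type*} [Fintype ι] [DecidableEq ι]
    (φ : ι → Bool → V) (F : (ι → Bool) → X)
    (hF : ∀ v w, F v = F w ↔ ∀ i, φ i (v i) = φ i (w i)) (w : ι → Bool) :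
    (Finset.univ.filter fun v : ι → Bool => F v = F w).card * (Finset.univ.image F).card =
      Fintype.card (ι → Bool) := by
  have h1 : ∀ w' : ι → Bool, (Finset.univ.filter fun v : ι → Bool => F v = F w').card =
        ∏ i, if φ i true = φ i false then 2 else 1 := by
    intro w'
    have e : (Finset.univ.filter fun v : ι → Bool => F v = F w') =
        Fintype.piFinset fun i => Finset.univ.filter fun x => φ i x = φ i (w' i) := by
      ext v
      simp [hF]
    rw [e, Fintype.card_piFinset]
    refine Finset.prod_congr rfl fun i _ => ?_
    rw [show (Finset.univ : Finset Bool) = {true, false} from rfl, Finset.filter_insert,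
      Finset.filter_singleton]
    rcases Bool.eq_false_or_eq_true (w' i) with hw | hw <;> by_cases h : φ i true = φ i false
    · simp [hw, h]
    · simp [hw, h, Ne.symm h]
    · simp [hw, h]
    · simp [hw, h]
  rw [← Finset.card_univ, Finset.card_eq_sum_card_image F Finset.univ,
    Finset.sum_const_nat (m := ∏ i, if φ i true = φ i false then 2 else 1), h1, mul_comm]
  intro y hy
  obtain ⟨w', -, rfl⟩ := Finset.mem_image.1 hy
  exact h1 w'

open scoped Classical in
theorem card_fibre_le_uniformOn_range {B X : Type*} [Fintype B] [Nonempty B] [MeasurableSpace X]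
    [MeasurableSingletonClass X] (F : B → X)
    (hF : ∀ w, (Finset.univ.filter fun v => F v = F w).card * (Finset.univ.image F).card =
      Fintype.card B) (y : X) :
    ((Finset.univ.filter fun v => F v = y).card : ℝ≥0∞) ≤
      Fintype.card B * uniformOn (Set.range F) {y} := by
  by_cases hy : ∃ w, F w = y
  · obtain ⟨w, rfl⟩ := hy
    have e : Set.range F = ((Finset.univ.image F : Finset X) : Set X) := by simp
    rw [e]
    unfold uniformOn
    rw [cond_apply (Finset.measurableSet _), Measure.count_apply_finset,
      Set.inter_eq_right.2 (by simp), Measure.count_singleton, mul_one]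
    refine (ENNReal.le_div_iff_mul_le (Or.inl ?_) (Or.inl (ENNReal.natCast_ne_top _))).2 ?_
    · simp only [ne_eq, Nat.cast_eq_zero, Finset.card_eq_zero, Finset.image_eq_empty]
      exact Finset.univ_nonempty.ne_empty
    · exact_mod_cast (hF w).le
  · rw [Finset.filter_false_of_mem fun v _ h => hy ⟨v, h⟩]
    simp

open scoped Classical in
theorem card_fibre_le_uniformOn {V : Type*} {k : ℕ} (φ : Fin k → Bool → V) (F : (Fin k → Bool) → Config V k)
    (hF : ∀ v i, F v i = φ i (v i)) (y : Config V k) :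
    ((Finset.univ.filter fun v : Fin k → Bool => F v = y).card : ℝ≥0∞) ≤
      Fintype.card (Fin k → Bool) *
        uniformOn {c : Config V k | ∀ i, c i ∈ Set.range (φ i)} {y} := by
  have e : {c : Config V k | ∀ i, c i ∈ Set.range (φ i)} = Set.range F := by
    ext c
    constructor
    · intro h
      choose v hv using h
      exact ⟨v, funext fun i => (hF v i).trans (hv i)⟩
    · rintro ⟨v, rfl⟩ i
      exact ⟨v i, (hF v i).symm⟩
  rw [e]
  refine card_fibre_le_uniformOn_range F (card_fibre_mul_card_range φ F fun v w => ?_) y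
  simp only [← hF]
  exact ⟨fun h i => congrFun h i, fun h => funext h⟩

section coupling

open Preorder

variable {n k : ℕ} [NeZero n] (g T : ℕ) (hn : 2 ≤ n) (q : Fin n × Fin n)

/-- The configurations on the torus if the zombies start at `x` and move by the coins `b`. -/
noncomputable def coinPath (x : Config (Fin n × Fin n) k) (b : Fin T → Fin k → Bool) (t : ℕ) :
    Config (Fin n × Fin n) k :=
  fun i => place q ((play g T Set.univ (fun i => relPos q (x i)) (extendCoins b) t).1 i)

variable {g T}

theorem route_seenFrom_coinPath (hg : 1 ≤ g) (hT : 5 * g ≤ T) {N : ℕ} (hN : 85 * g ≤ N)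
    (hNn : 2 * (N + 85 * g + 1) ≤ n) {x : Config (Fin n × Fin n) k} (b : Fin T → Fin k → Bool)
    (hx : ∀ i, InSquare N (relPos q (x i))) {z : ℕ → Config (Fin n × Fin n) k} {t : ℕ} (ht : t ≤ T)
    (hz : ∀ s ≤ t, z s = coinPath g T q x b s) :
    route g T (fun s => seenFrom q (z s)) t =
      route g T (activeSet g T Set.univ (fun i => relPos q (x i)) (extendCoins b)) t := by
  refine route_congr t fun s hs v _ => ?_
  rw [hz s hs]
  unfold activeSet seenFrom
  rw [Set.image_univ]
  have e : (fun i => relPos q (coinPath g T q x b s i)) =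
      (play g T Set.univ (fun i => relPos q (x i)) (extendCoins b) s).1 := by
    funext i
    have h := play_inSquare g T Set.univ (fun i => relPos q (x i)) (extendCoins b) (N := N) hg hT
      (by omega) (hx i) s (by omega)
    exact relPos_place q (by have := h.1; omega) (by have := h.2; omega)
  rw [e]

-- The zombies stay within `N` and the survivor within `85g` of the centre, so coordinate
-- differences plus 1 are at most `n/2` and the torus moves are the planar ones. Regularity thus
-- depends on the starting positions only.
open scoped Classical in
theorem card_le_law (hg : 1 ≤ g) (hT : 5 * g ≤ T) {N : ℕ} (hN : 85 * g ≤ N)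
    (hNn : 2 * (N + 85 * g + 1) ≤ n)
    (G : Finset (Config (Fin n × Fin n) k × (Fin T → Fin k → Bool)))
    (hG : ∀ p ∈ G, ∀ i, InSquare N (relPos q (p.1 i))) :
    (G.card : ℝ≥0∞) ≤ (routeStrategy (k := k) g T hn q).law
      {z | ∃ p ∈ G, ∀ t ≤ T, z t = coinPath g T q p.1 p.2 t} *
        Fintype.card (Config (Fin n × Fin n) k × (Fin T → Fin k → Bool)) := by
  have : Nonempty (Config (Fin n × Fin n) k) := ⟨fun _ => q⟩
  have hprob : IsProbabilityMeasure (uniformOn (Set.univ : Set (Config (Fin n × Fin n) k))) :=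
    isProbabilityMeasure_uniformOn Set.finite_univ Set.univ_nonempty
  have hcoin : ∀ (b : Fin T → Fin k → Bool) (s : Fin T) (v : Fin k → Bool), ∀ r < (s : ℕ),
      extendCoins (Function.update b s v) r = extendCoins b r := by
    intro b s v r hr
    unfold extendCoins
    split_ifs with h
    · rw [Function.update_of_ne]
      exact fun h => absurd (congrArg Fin.val h) (by simp; omega)
    · rfl
  refine card_le_trajMeasure (routeStrategy (k := k) g T hn q).zombieKernel (coinPath g T q)
    (fun _ x _ => ∀ i, InSquare N (relPos q (x i))) ?_ ?_ ?_ ?_ ?_ G fun p hp _ _ => hG p hp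
  · exact fun x b => funext fun i => place_relPos q (x i)
  · intro x b s v t ht
    funext i
    change place q _ = place q _
    rw [play_congr g T Set.univ _ _ t fun r hr => hcoin b s v r (by omega)]
  · exact fun x b s v t _ h => h
  · intro x b s hx y
    set Z := play g T Set.univ (fun i => relPos q (x i)) (extendCoins b) s with hZ
    have h1 : ∀ v, coinPath g T q x (Function.update b s v) (s + 1) =
        fun i => place q (chaseStep Z.2.1 (Z.1 i) (v i)) := by
      intro v
      funext i
      change place q _ = place q _
      rw [play_fst_succ, ← play_snd, play_congr g T Set.univ _ _ _ fun r hr => hcoin b s v r hr]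
      congr 2
      simp [extendCoins]
    have h2 : (routeStrategy (k := k) g T hn q).pos s
        (frestrictLe (π := fun _ => Config (Fin n × Fin n) k) (s : ℕ) (coinPath g T q x b)) =
        place q Z.2.1 := by
      refine (traj_routeStrategy g T hn q (coinPath g T q x b) s).trans ?_
      rw [route_seenFrom_coinPath q hg hT hN hNn b hx s.2.le fun _ _ => rfl, ← play_snd]
    have h3 : (routeStrategy (k := k) g T hn q).zombieKernel s
        (frestrictLe (π := fun _ => Config (Fin n × Fin n) k) (s : ℕ) (coinPath g T q x b)) =
        uniformOn {c : Config (Fin n × Fin n) k |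
          ∀ i, c i ∈ Set.range fun β => place q (chaseStep Z.2.1 (Z.1 i) β)} := by
      change uniformOn (jointOptions (torusGrid n) _ (coinPath g T q x b s)) = _
      rw [h2]
      congr 1
      ext c
      refine forall_congr' fun i => ?_
      have h4 := play_inSquare g T Set.univ (fun i => relPos q (x i)) (extendCoins b) (N := N) hg hT
        (by omega) (hx i) s s.2.le
      have h5 := route_inSquare_of_le g T (activeSet g T Set.univ (fun i => relPos q (x i))
        (extendCoins b)) hg hT s s.2.le
      rw [← play_snd, ← hZ] at h5
      rw [← hZ] at h4
      rw [show coinPath g T q x b s i = place q (Z.1 i) from rfl, zombieOptions_place hn]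
      · have h6 := h4.1
        have h7 := h5.1
        rw [abs_le] at h6 h7
        have : |(Z.1 i).1 - Z.2.1.1| ≤ N + 85 * g := by rw [abs_le]; omega
        omega
      · have h6 := h4.2
        have h7 := h5.2
        rw [abs_le] at h6 h7
        have : |(Z.1 i).2 - Z.2.1.2| ≤ N + 85 * g := by rw [abs_le]; omega
        omega
    rw [h3]
    simp only [h1]
    exact card_fibre_le_uniformOn (fun i β => place q (chaseStep Z.2.1 (Z.1 i) β)) _ (fun _ _ => rfl) y
  · intro x
    unfold uniformOn
    rw [cond_apply MeasurableSet.univ, Set.univ_inter, Measure.count_singleton, mul_one,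
      Measure.count_apply MeasurableSet.univ, Set.encard_univ, ENat.card_eq_coe_fintype_card]
    simp only [ENat.toENNReal_coe]
    rw [ENNReal.inv_mul_cancel (by exact_mod_cast Fintype.card_ne_zero) (ENNReal.natCast_ne_top _)]

/-- The coupling controls the game only up to time `4n`; afterwards it is enough that almost surely
all moves are legal. -/
theorem SurvivorStrategy.ae_mem_jointOptions {V : Type*} [Finite V] [Nonempty V] {G : SimpleGraph V}
    (S : SurvivorStrategy G k) :
    ∀ᵐ z ∂S.law, ∀ t, z (t + 1) ∈ jointOptions G (S.traj z t) (z t) := by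
  have : Nonempty (Config V k) := inferInstanceAs (Nonempty (Fin k → V))
  have hprob : IsProbabilityMeasure (uniformOn (Set.univ : Set (Config V k))) :=
    isProbabilityMeasure_uniformOn Set.finite_univ Set.univ_nonempty
  rw [ae_all_iff]
  intro t
  refine trajMeasure_ae_mem S.zombieKernel t
    (fun h => jointOptions G (S.pos t h) (h ⟨t, Finset.mem_Iic.2 le_rfl⟩)) fun h => ?_
  change uniformOn (jointOptions G (S.pos t h) (h ⟨t, Finset.mem_Iic.2 le_rfl⟩)) _ = 0
  unfold uniformOn
  rw [cond_apply (Set.Finite.measurableSet (Set.toFinite _)), Set.inter_compl_self]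
  simp

end coupling

/-! ### The end of the game -/

section endgame

variable {n k : ℕ} [NeZero n]

theorem add_embPair_ne (hn : 2 ≤ n) (u : Fin n × Fin n) {z : ℤ × ℤ} (h1 : 2 * |z.1| ≤ n)
    (h2 : 2 * |z.2| ≤ n) (hz : z ≠ 0) : u + embPair n z ≠ u := by
  intro h
  have h3 := torusGrid_dist hn u h1 h2
  rw [h, SimpleGraph.dist_self] at h3
  simp only [abs_eq_max_neg] at h3
  exact hz (Prod.ext (by simp; omega) (by simp; omega))

theorem IsUnitStep.smul_bounds {d : ℤ × ℤ} (hd : IsUnitStep d) (a : ℤ) :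
    |(a • d).1| ≤ |a| ∧ |(a • d).2| ≤ |a| := by
  rcases hd with rfl | rfl | rfl | rfl <;> simp

theorem IsUnitStep.smul_ne_zero {d : ℤ × ℤ} (hd : IsUnitStep d) {a : ℤ} (ha : a ≠ 0) : a • d ≠ 0 := by
  rcases hd with rfl | rfl | rfl | rfl <;> simp [ha, Prod.ext_iff]

theorem IsUnitStep.chaseStep_zero_smul {d : ℤ × ℤ} (hd : IsUnitStep d) {a : ℤ} (ha : 0 < a) (c : Bool) :
    chaseStep 0 (-a • d) c = (1 - a) • d := by
  have h1 : Int.sign a = 1 := Int.sign_eq_one_of_pos ha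
  rcases hd with rfl | rfl | rfl | rfl <;>
    simp [chaseStep, h1, ha.ne'] <;> ring

/-- A zombie straight behind a survivor who goes straight on keeps its distance. -/
theorem eq_behind_of_straight (hn : 8 ≤ n) {d : ℤ × ℤ} (hd : IsUnitStep d) {u z : ℕ → Fin n × Fin n}
    (hu : ∀ m, u (m + 1) = u m + embPair n d)
    (hz : ∀ m, z (m + 1) ∈ zombieOptions (torusGrid n) (u m) (z m)) {a : ℤ} (ha : 0 < a) (ha' : a ≤ 3)
    (h0 : z 0 = u 0 + embPair n (-a • d)) (m : ℕ) :
    z m = u m + embPair n (-a • d) ∧ z (m + 1) = u m + embPair n ((1 - a) • d) := by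
  have hb := hd.smul_bounds (-a)
  have habs : |-a| = a := by rw [abs_neg, abs_of_pos ha]
  have step : ∀ m, z m = u m + embPair n (-a • d) → z (m + 1) = u m + embPair n ((1 - a) • d) := by
    intro m h
    have h1 := hz m
    rw [h, zombieOptions_add_embPair (by omega) _ (by omega) (by omega)] at h1
    obtain ⟨c, hc⟩ := h1
    rw [← hc, ← hd.chaseStep_zero_smul ha c]
  have main : z m = u m + embPair n (-a • d) := by
    induction m with
    | zero => exact h0
    | succ m ih =>
      rw [step m ih, hu, add_assoc, ← map_add, sub_smul, one_smul, neg_smul, sub_eq_add_neg]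
  exact ⟨main, step m main⟩

variable {g T : ℕ} (hn2 : 2 ≤ n) (q : Fin n × Fin n)

/-- Up to `T` the planar chase is transferred to the torus without wrapping around. From `T` on the
survivor walks straight, and the zombies behind him have one legal move each. -/
theorem traj_routeStrategy_of_coinPath (hg : 1 ≤ g) (hT : 5 * g ≤ T) {N : ℕ} (hN : 85 * g ≤ N)
    (hNn : 2 * (N + 85 * g + 1) ≤ n) {x : Config (Fin n × Fin n) k} {b : Fin T → Fin k → Bool}
    (hx : ∀ i, InSquare N (relPos q (x i))) {z : ℕ → Config (Fin n × Fin n) k}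
    (hz : ∀ t ≤ T, z t = coinPath g T q x b t)
    (hlegal : ∀ t, z (t + 1) ∈ jointOptions (torusGrid n) ((routeStrategy g T hn2 q).traj z t) (z t))
    (h : TameChase g T (activeSet g T Set.univ (fun i => relPos q (x i)) (extendCoins b)) (extendCoins b)
      fun t => (play g T Set.univ (fun i => relPos q (x i)) (extendCoins b) t).1) :
    LinedUpBehind ((routeStrategy g T hn2 q).traj z) z T ∧ (routeStrategy g T hn2 q).Survives z := by
  set c := extendCoins b with hc
  set Z₀ : Fin k → ℤ × ℤ := fun i => relPos q (x i) with hZ₀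
  set P := activeSet g T Set.univ Z₀ c with hP
  set Q := fun s => seenFrom q (z s) with hQ
  set S := routeStrategy (k := k) g T hn2 q with hS
  have hroute : ∀ t ≤ T, route g T Q t = route g T P t := fun t ht =>
    route_seenFrom_coinPath q hg hT hN hNn b hx ht fun s hs => hz s (by omega)
  have htraj : ∀ t, S.traj z t = place q (route g T Q t).1 := traj_routeStrategy g T hn2 q z
  set d := (route g T Q T).2 with hd'
  have hd : IsUnitStep d := isUnitStep_route g T Q T
  have hstraight : ∀ m, S.traj z (T + (m + 1)) = S.traj z (T + m) + embPair n d := by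
    intro m
    have h1 := (route_final g T Q T (show T < T + 5 * g by omega) (m + 1)).1
    have h2 := traj_succ_sub g T hn2 q z (T + m)
    rw [add_assoc, h1] at h2
    rw [← h2]
    abel
  have hbehind : ∀ i, ∃ a : ℤ, (a = 2 ∨ a = 3) ∧ z T i = S.traj z T + embPair n (-a • d) := by
    intro i
    have h1 : z T i = place q ((play g T Set.univ Z₀ c T).1 i) := by rw [hz T le_rfl]; rfl
    rw [h1, htraj T, hroute T le_rfl, hd', hroute T le_rfl]
    rcases h.lined_up i with h2 | h2
    · refine ⟨2, Or.inl rfl, ?_⟩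
      rw [h2, place, place, add_assoc, ← map_add, neg_smul, ← sub_eq_add_neg]
      norm_cast
    · refine ⟨3, Or.inr rfl, ?_⟩
      rw [h2, place, place, add_assoc, ← map_add, neg_smul, ← sub_eq_add_neg]
      norm_cast
  constructor
  · intro i
    obtain ⟨a, ha, h1⟩ := hbehind i
    obtain ⟨t, rfl⟩ : ∃ t, T = t + 1 := ⟨T - 1, by omega⟩
    have h2 := traj_succ_sub g (t + 1) hn2 q z t
    rw [add_tsub_cancel_right, h2, h1]
    have hb := hd.smul_bounds (-a)
    have habs : |-a| = a := by rw [abs_neg, abs_of_pos (by omega)]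
    have h3 := torusGrid_dist hn2 (S.traj z (t + 1)) (z := -a • d) (by omega) (by omega)
    have h4 : |(-a • d).1| + |(-a • d).2| = a := by
      rw [← habs]
      rcases hd with h | h | h | h <;> rw [h] <;> simp
    rw [h4] at h3
    have h5 : ∀ m : ℕ, a = m → S.traj z (t + 1) + embPair n (-a • d) =
        S.traj z (t + 1) - m • embPair n d := by
      rintro m rfl
      rw [neg_smul, map_neg, ← sub_eq_add_neg, map_zsmul, natCast_zsmul]
    rcases ha with rfl | rfl
    · exact Or.inl ⟨h5 2 rfl, by exact_mod_cast h3⟩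
    · exact Or.inr ⟨h5 3 rfl, by exact_mod_cast h3⟩
  · intro t i
    rcases lt_or_ge t T with ht | ht
    · have h1 := h.two_le_dist t i
      have hsq := play_inSquare g T Set.univ Z₀ c (N := N) hg hT (by omega) (hx i)
      have h2 := hsq t ht.le
      have h3 := hsq (t + 1) ht
      have h4 := route_inSquare_of_le g T P hg hT t ht.le
      -- The distance before the zombie's move is at least 2, and the move reduces it by exactly 1.
      have h5 : (play g T Set.univ Z₀ c (t + 1)).1 i ≠ (route g T P t).1 := by
        intro h6
        rw [play_fst_succ] at h6
        change chaseStep (route g T P t).1 _ _ = _ at h6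
        have h7 := chaseStep_add (route g T P t).1
          ((play g T Set.univ Z₀ c t).1 i - (route g T P t).1) (c t i)
        rw [add_sub_cancel, h6, left_eq_add] at h7
        obtain ⟨e, -, h8, h9⟩ := exists_unitStep_chaseStep
          (z := (play g T Set.univ Z₀ c t).1 i - (route g T P t).1) (by
            intro h10
            rw [sub_eq_zero] at h10
            rw [h10] at h1
            simp at h1) (c t i)
        rw [← h8, h7] at h9
        simp only [Prod.fst_zero, Prod.snd_zero, Prod.fst_sub, Prod.snd_sub, abs_zero] at h9
        omega
      have h6 : (play g T Set.univ Z₀ c t).1 i ≠ (route g T P t).1 := by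
        intro h10
        rw [h10] at h1
        simp at h1
      obtain ⟨h2a, h2b⟩ := h2
      obtain ⟨h3a, h3b⟩ := h3
      obtain ⟨h4a, h4b⟩ := h4
      rw [abs_le] at h2a h2b h3a h3b h4a h4b
      rw [htraj, hroute t ht.le, hz t ht.le, hz (t + 1) ht]
      refine ⟨fun h7 => h6 (place_injOn q ?_ ?_ h7), fun h7 => h5 (place_injOn q ?_ ?_ h7)⟩ <;>
        rw [abs_lt] <;> omega
    · obtain ⟨m, rfl⟩ := Nat.exists_eq_add_of_le ht
      obtain ⟨a, ha, h1⟩ := hbehind i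
      obtain ⟨h2, h3⟩ := eq_behind_of_straight (by omega) hd (u := fun m => S.traj z (T + m))
        (z := fun m => z (T + m) i) hstraight (fun m => hlegal (T + m) i) (a := a) (by omega) (by omega)
        h1 m
      change z (T + m) i = S.traj z (T + m) + _ at h2
      change z (T + (m + 1)) i = S.traj z (T + m) + _ at h3
      have hb := hd.smul_bounds (-a)
      have hb' := hd.smul_bounds (1 - a)
      have h4 : |-a| ≤ 3 := by rw [abs_le]; omega
      have h5 : |1 - a| ≤ 3 := by rw [abs_le]; omega
      rw [add_assoc, h2, h3]
      exact ⟨add_embPair_ne hn2 _ (by omega) (by omega) (hd.smul_ne_zero (by omega)),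
        add_embPair_ne hn2 _ (by omega) (by omega) (hd.smul_ne_zero (by omega))⟩

end endgame

/-! ### The survivor's chances against few zombies -/

theorem le_law_routeStrategy {n k g : ℕ} [NeZero n] (hn : 2 ≤ n) (q : Fin n × Fin n) (hg : 3 ≤ g)
    (hgn : 400 * g ≤ n) (hlog : ⌊20 * Real.log n⌋₊ ≤ g) :
    1 - ENNReal.ofReal (k * (800 * g / n + 4 * (k + 1) * (600 * g + 1) / n +
      2 * ((4 * n : ℕ) + 1) * (16 / 27) ^ g)) ≤
    (routeStrategy (k := k) g (4 * n) hn q).law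
      {z | IsStableTrajectory ((routeStrategy g (4 * n) hn q).traj z) 0 (4 * n) ∧
        LinedUpBehind ((routeStrategy g (4 * n) hn q).traj z) z (4 * n) ∧
        (routeStrategy g (4 * n) hn q).Survives z} := by
  classical
  have : Nonempty (Fin n × Fin n) := ⟨q⟩
  set S := routeStrategy (k := k) g (4 * n) hn q with hS
  set N := n / 2 - 90 * g with hN
  set C := Fintype.card (Config (Fin n × Fin n) k × (Fin (4 * n) → Fin k → Bool)) with hC
  let Fav : Config (Fin n × Fin n) k × (Fin (4 * n) → Fin k → Bool) → Prop := fun p =>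
    Favourable g (4 * n) N (fun i => relPos q (p.1 i)) (extendCoins p.2)
  have h1 := card_le_law (k := k) (T := 4 * n) hn q (show 1 ≤ g by omega) (by omega) (N := N) (by omega)
    (by omega) (Finset.univ.filter Fav) fun p hp i => ((Finset.mem_filter.1 hp).2.1 i).1
  have h2 := card_not_favourable_le (n := n) (g := g) (4 * n) k (by omega) q
  set δ : ℝ := k * (800 * g / n + 4 * (k + 1) * (600 * g + 1) / n +
      2 * ((4 * n : ℕ) + 1) * (16 / 27) ^ g) with hδ
  have h3 : ((Finset.univ.filter fun p => ¬ Fav p).card : ℝ≥0∞) ≤ ENNReal.ofReal δ * C := by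
    have h4 := ENNReal.ofReal_le_ofReal h2
    rw [ENNReal.ofReal_mul (by positivity), ENNReal.ofReal_natCast, ENNReal.ofReal_natCast] at h4
    refine le_trans (Nat.cast_le.2 (Finset.card_le_card fun p hp => ?_)) h4
    exact Finset.mem_filter.2 ⟨Finset.mem_univ _, (Finset.mem_filter.1 hp).2⟩
  have h5 : (C : ℝ≥0∞) = (Finset.univ.filter Fav).card + (Finset.univ.filter fun p => ¬ Fav p).card := by
    rw [hC, ← Finset.card_univ, ← Finset.card_filter_add_card_filter_not Fav]
    push_cast
    rfl
  have h6 : (1 : ℝ≥0∞) ≤ S.law {z | ∃ p ∈ Finset.univ.filter Fav, ∀ t ≤ 4 * n,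
      z t = coinPath g (4 * n) q p.1 p.2 t} + ENNReal.ofReal δ := by
    have h7 : (1 : ℝ≥0∞) * C ≤ (S.law {z | ∃ p ∈ Finset.univ.filter Fav, ∀ t ≤ 4 * n,
        z t = coinPath g (4 * n) q p.1 p.2 t} + ENNReal.ofReal δ) * C := by
      rw [one_mul, add_mul]
      calc (C : ℝ≥0∞) = _ := h5
        _ ≤ _ := add_le_add h1 h3
    have : Nonempty (Config (Fin n × Fin n) k) := ⟨fun _ => q⟩
    exact (ENNReal.mul_le_mul_iff_left (by exact_mod_cast Fintype.card_ne_zero)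
      (ENNReal.natCast_ne_top _)).1 h7
  refine (tsub_le_iff_right.2 h6).trans (measure_mono_ae ?_)
  filter_upwards [S.ae_mem_jointOptions] with z hlegal
  rintro ⟨p, hp, hz⟩
  obtain ⟨hstart, hcoins, hbad⟩ := (Finset.mem_filter.1 hp).2
  -- The number of blocks is `N / g + 1`, so all zombies arrive by `4N + 4g`, well before `4n -
  -- 800g`.
  have hm : N ≤ g * (N / g + 1) := by
    have := Nat.div_add_mod N g
    have := Nat.mod_lt N (show 0 < g by omega)
    rw [mul_add, mul_one]
    omega
  have hm' : g * (N / g + 1) ≤ N + g := by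
    have := Nat.div_add_mod N g
    rw [mul_add, mul_one]
    omega
  have htame := tameChase_play g (4 * n) (fun i => relPos q (p.1 i)) (extendCoins p.2) (N := N)
    (m := N / g + 1) hg (fun i => (hstart i).1) hcoins hm
    (by rw [mul_assoc]; omega) hbad
  exact ⟨isStableTrajectory_routeStrategy g (4 * n) hn q (by omega) (by omega) hlog z,
    traj_routeStrategy_of_coinPath hn q (by omega) (by omega) (N := N) (by omega) (by omega)
      (fun i => (hstart i).1) hz hlegal htame⟩

/-- The critical term is the middle one: `k + 1 ≤ 2√n` and `kg ≤ 20√n/w` bound it by a multiple of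
`1/w`. -/
theorem failure_bound {n k g : ℕ} {w : ℝ} (hw : 1 ≤ w) (hlog : 1 ≤ Real.log n)
    (hg : (g : ℝ) ≤ 20 * Real.log n) (hg' : 20 * Real.log n ≤ g + 1)
    (hk : (k : ℝ) ≤ Real.sqrt n / (w * Real.log n)) :
    (k : ℝ) * (800 * g / n + 4 * (k + 1) * (600 * g + 1) / n + 2 * ((4 * n : ℕ) + 1) * (16 / 27) ^ g) ≤
      120000 * w⁻¹ + 10 * (n : ℝ)⁻¹ := by
  have hn0 : (0 : ℝ) < n := by
    rcases Nat.eq_zero_or_pos n with rfl | h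
    · norm_num at hlog
    · exact_mod_cast h
  have hn1 : (1 : ℝ) ≤ n := by exact_mod_cast hn0
  set L := Real.log n with hL
  set s := Real.sqrt n with hs
  have hs2 : s * s = n := Real.mul_self_sqrt hn0.le
  have hs1 : 1 ≤ s := by rw [hs]; exact Real.one_le_sqrt.2 hn1
  have hk0 : (0 : ℝ) ≤ k := Nat.cast_nonneg k
  have hkwL : (k : ℝ) * (w * L) ≤ s := (le_div_iff₀ (by positivity)).1 hk
  have hks : (k : ℝ) ≤ s := by
    have : 1 ≤ w * L := by nlinarith
    nlinarith
  have hkL : (k : ℝ) * L ≤ s * w⁻¹ := by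
    rw [← div_eq_mul_inv, le_div_iff₀ (by positivity)]
    linarith
  have hw0 : 0 < w⁻¹ := by positivity
  have t1 : (k : ℝ) * (800 * g / n) ≤ 16000 * w⁻¹ := by
    rw [← mul_div_assoc, div_le_iff₀ hn0]
    have h1 : (k : ℝ) * g ≤ k * (20 * L) := mul_le_mul_of_nonneg_left hg hk0
    have h2 : s * w⁻¹ ≤ n * w⁻¹ := mul_le_mul_of_nonneg_right (by nlinarith) hw0.le
    nlinarith
  have t2 : (k : ℝ) * (4 * (k + 1) * (600 * g + 1) / n) ≤ 96008 * w⁻¹ := by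
    rw [← mul_div_assoc, div_le_iff₀ hn0]
    have h1 : (k : ℝ) * (600 * g + 1) ≤ 12001 * (s * w⁻¹) := by
      have : (k : ℝ) * (600 * g + 1) ≤ k * (12001 * L) := mul_le_mul_of_nonneg_left (by linarith) hk0
      linarith
    have h2 : 4 * ((k : ℝ) + 1) ≤ 8 * s := by linarith
    calc (k : ℝ) * (4 * (k + 1) * (600 * g + 1)) = 4 * (k + 1) * (k * (600 * g + 1)) := by ring
      _ ≤ 8 * s * (12001 * (s * w⁻¹)) := mul_le_mul h2 h1 (by positivity) (by positivity)
      _ = 96008 * w⁻¹ * (s * s) := by ring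
      _ = _ := by rw [hs2]
  have t3 : (k : ℝ) * (2 * ((4 * n : ℕ) + 1) * (16 / 27) ^ g) ≤ 10 * (n : ℝ)⁻¹ := by
    -- Since `g ≥ 20L - 1 ≥ 19L`, the exponent `11g/27` exceeds `3L`.
    have h1 : (16 / 27 : ℝ) ^ g ≤ ((n : ℝ) ^ 3)⁻¹ := by
      have h2 : (16 / 27 : ℝ) ≤ Real.exp (-(11 / 27)) := by
        have := Real.one_sub_le_exp_neg (11 / 27)
        linarith
      calc (16 / 27 : ℝ) ^ g ≤ Real.exp (-(11 / 27)) ^ g := pow_le_pow_left₀ (by norm_num) h2 g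
        _ = Real.exp (g * -(11 / 27)) := (Real.exp_nat_mul _ g).symm
        _ ≤ Real.exp (-(3 * L)) := Real.exp_le_exp.2 (by linarith)
        _ = _ := by
          rw [Real.exp_neg, show (3 : ℝ) * L = (3 : ℕ) * L by norm_num, Real.exp_nat_mul, hL,
            Real.exp_log hn0]
    have h3 : (k : ℝ) ≤ n := hks.trans (by nlinarith)
    push_cast
    calc (k : ℝ) * (2 * (4 * n + 1) * (16 / 27) ^ g) ≤ n * (2 * (5 * n) * ((n : ℝ) ^ 3)⁻¹) := by
          refine mul_le_mul h3 (mul_le_mul (by linarith) h1 (by positivity) (by positivity))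
            (by positivity) (by positivity)
      _ = 10 * (n : ℝ)⁻¹ := by field_simp; norm_num
  have : (k : ℝ) * (800 * g / n + 4 * (k + 1) * (600 * g + 1) / n + 2 * ((4 * n : ℕ) + 1) * (16 / 27) ^ g) =
      k * (800 * g / n) + k * (4 * (k + 1) * (600 * g + 1) / n) +
        k * (2 * ((4 * n : ℕ) + 1) * (16 / 27) ^ g) := by ring
  rw [this]
  linarith

theorem exists_strategy_against_few (ω : ℕ → ℝ) (hω : Tendsto ω atTop atTop) :
    ∃ ε : ℕ → ℝ≥0∞, Tendsto ε atTop (𝓝 0) ∧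
      ∀ᶠ n : ℕ in atTop, ∀ k : ℕ, (k : ℝ) ≤ Real.sqrt n / (ω n * Real.log n) →
        ∀ (_ : NeZero n) (p : Fin n × Fin n), ∃ S : SurvivorStrategy (torusGrid n) k,
          S.IsBoxed (torusBox p ⌊5 * 10 ^ 4 * Real.log n⌋₊) (4 * n) ∧
          1 - ε n ≤ S.law {z | IsStableTrajectory (S.traj z) 0 (4 * n) ∧
            LinedUpBehind (S.traj z) z (4 * n) ∧ S.Survives z} := by
  refine ⟨fun n => ENNReal.ofReal (120000 * (ω n)⁻¹ + 10 * (n : ℝ)⁻¹), ?_, ?_⟩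
  · rw [← ENNReal.ofReal_zero]
    refine ENNReal.tendsto_ofReal ?_
    have h := (hω.inv_tendsto_atTop.const_mul 120000).add
      ((tendsto_inv_atTop_nhds_zero_nat (𝕜 := ℝ)).const_mul 10)
    simpa using h
  · have hlog : Tendsto (fun n : ℕ => Real.log n) atTop atTop :=
      Real.tendsto_log_atTop.comp tendsto_natCast_atTop_atTop
    have hsmall : ∀ᶠ n : ℕ in atTop, 8000 * Real.log n ≤ n := by
      have h1 := Real.isLittleO_log_id_atTop.bound (show (0 : ℝ) < 1 / 8000 by norm_num)
      filter_upwards [tendsto_natCast_atTop_atTop.eventually h1, hlog.eventually_ge_atTop 1] with n h2 h3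
      rw [Real.norm_of_nonneg (by linarith), id, Real.norm_of_nonneg (by positivity)] at h2
      linarith
    filter_upwards [hω.eventually_ge_atTop 1, hlog.eventually_ge_atTop 1, hsmall] with n hw hL hn k hk _ p
    set g := ⌊20 * Real.log n⌋₊ with hg
    have hg1 : (g : ℝ) ≤ 20 * Real.log n := Nat.floor_le (by linarith)
    have hg2 : 20 * Real.log n < g + 1 := Nat.lt_floor_add_one _
    have hg3 : 3 ≤ g := Nat.le_floor (by push_cast; linarith)
    have hgn : 400 * g ≤ n := by
      have : (400 * g : ℝ) ≤ n := by linarith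
      exact_mod_cast this
    have hbox : 180 * g ≤ ⌊5 * 10 ^ 4 * Real.log n⌋₊ := Nat.le_floor (by push_cast; linarith)
    refine ⟨routeStrategy g (4 * n) (by omega) (place p (90 * g, 90 * g)),
      isBoxed_routeStrategy g (4 * n) _ p hbox (by omega) (by omega), le_trans ?_
        (le_law_routeStrategy (by omega) _ hg3 hgn le_rfl)⟩
    exact tsub_le_tsub_left (ENNReal.ofReal_le_ofReal (failure_bound hw hL hg1 hg2.le hk)) 1

/-! ### Many zombies -/

/-- With many zombies the starting positions most likely cover all vertices, and then any starting
vertex is fatal. This makes the set defining the zombie number nonempty, so that its infimum is not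
the default value 0. -/
theorem exists_survivalProb_le_half {V : Type*} [Finite V] [Nonempty V] (G : SimpleGraph V) (k₀ : ℕ) :
    ∃ k, k₀ ≤ k ∧ survivalProb G k ≤ 1 / 2 := by
  classical
  have := Fintype.ofFinite V
  set N := Fintype.card V with hN
  have hN0 : 0 < N := Fintype.card_pos
  obtain ⟨k, hk, hpow⟩ : ∃ k, k₀ ≤ k ∧ 2 * (N * (N - 1) ^ k) ≤ N ^ k := by
    have h1 : Tendsto (fun k : ℕ => (((N - 1 : ℕ) : ℝ) / N) ^ k) atTop (𝓝 0) := by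
      refine tendsto_pow_atTop_nhds_zero_of_lt_one (by positivity) ?_
      rw [div_lt_one (by exact_mod_cast hN0)]
      exact_mod_cast Nat.sub_lt hN0 one_pos
    have h2 : (0 : ℝ) < 1 / (2 * N) := by positivity
    obtain ⟨k, h3, h4⟩ := ((h1.eventually (gt_mem_nhds h2)).and (eventually_ge_atTop k₀)).exists
    refine ⟨k, h4, ?_⟩
    rw [div_pow, div_lt_div_iff₀ (by positivity) (by positivity), one_mul] at h3
    have : (2 * (N * (N - 1 : ℕ) ^ k) : ℝ) ≤ (N : ℝ) ^ k := by linarith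
    exact_mod_cast this
  refine ⟨k, hk, iSup_le fun S => ?_⟩
  have : Nonempty (Config V k) := inferInstanceAs (Nonempty (Fin k → V))
  have hprob : IsProbabilityMeasure (uniformOn (Set.univ : Set (Config V k))) :=
    isProbabilityMeasure_uniformOn Set.finite_univ Set.univ_nonempty
  let A : Finset (Config V k) :=
    Finset.univ.biUnion fun v : V => Fintype.piFinset fun _ : Fin k => Finset.univ.erase v
  have hA : A.card ≤ N * (N - 1) ^ k := by
    refine Finset.card_biUnion_le_card_mul _ _ _ fun v _ => ?_
    refine (Fintype.card_piFinset fun _ : Fin k => Finset.univ.erase v).trans_le ?_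
    simp [hN]
  have h1 : {z | S.Survives z} ⊆ (fun z : ℕ → Config V k => z 0) ⁻¹' A := by
    intro z hz
    refine Finset.mem_coe.2 (Finset.mem_biUnion.2 ⟨S.traj z 0, Finset.mem_univ _, ?_⟩)
    exact Fintype.mem_piFinset.2 fun i => Finset.mem_erase.2 ⟨(hz 0 i).1, Finset.mem_univ _⟩
  have hC : Fintype.card (Config V k) = N ^ k := by
    change Fintype.card (Fin k → V) = _
    simp [hN]
  have h2 : S.law ((fun z : ℕ → Config V k => z 0) ⁻¹' A) = (A.card : ℝ≥0∞) / (N ^ k : ℕ) := by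
    unfold SurvivorStrategy.law
    rw [← Measure.map_apply (by fun_prop) (Finset.measurableSet A),
      trajMeasure_zero (X := Config V k) S.zombieKernel]
    unfold uniformOn
    rw [cond_apply MeasurableSet.univ, Set.univ_inter, Measure.count_apply_finset,
      Measure.count_apply MeasurableSet.univ, Set.encard_univ, ENat.card_eq_coe_fintype_card, hC,
      mul_comm, ENNReal.div_eq_inv_mul, mul_comm]
    rfl
  refine (measure_mono h1).trans ?_
  rw [h2]
  refine ENNReal.div_le_of_le_mul ?_
  rw [mul_comm, mul_one_div, ENNReal.le_div_iff_mul_le (by simp) (by simp)]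
  have : A.card * 2 ≤ N ^ k := by linarith
  exact_mod_cast this

theorem theorem5p2 (ω : ℕ → ℝ) (hω : Tendsto ω atTop atTop) :
    (∀ᶠ n : ℕ in atTop,
      Real.sqrt n / (ω n * Real.log n) ≤ (zombieNumber (torusGrid n) : ℝ)) ∧
    ∃ ε : ℕ → ℝ≥0∞, Tendsto ε atTop (𝓝 0) ∧
      ∀ᶠ n : ℕ in atTop, ∀ (_ : NeZero n) (p : Fin n × Fin n),
        ∃ S : SurvivorStrategy (torusGrid n) ⌊Real.sqrt n / (ω n * Real.log n)⌋₊,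
          S.IsBoxed (torusBox p ⌊5 * 10 ^ 4 * Real.log n⌋₊) (4 * n) ∧
          1 - ε n ≤ S.law {z | IsStableTrajectory (S.traj z) 0 (4 * n) ∧
            LinedUpBehind (S.traj z) z (4 * n) ∧ S.Survives z} := by
  obtain ⟨ε, hε, h⟩ := exists_strategy_against_few ω hω
  refine ⟨?_, ε, hε, ?_⟩
  · filter_upwards [h, eventually_ge_atTop 1, hε.eventually (gt_mem_nhds (show (0 : ℝ≥0∞) < 1 / 2 by simp))]
      with n hn h1 hsmall
    have hne : NeZero n := ⟨by omega⟩
    by_contra! hlt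
    -- If the zombie number were below the threshold, the strategy could be applied with exactly
    -- that many zombies, although the survivor's chances are then at most `1/2`.
    obtain ⟨S, -, hS⟩ := hn _ hlt.le hne 0
    have hhalf : survivalProb (torusGrid n) (zombieNumber (torusGrid n)) ≤ 1 / 2 :=
      (Nat.sInf_mem (s := {k | copNumber (torusGrid n) ≤ k ∧ survivalProb (torusGrid n) k ≤ 1 / 2})
        (exists_survivalProb_le_half (torusGrid n) _)).2
    have h2 : 1 - ε n ≤ 1 / 2 := hS.trans ((measure_mono fun z hz => hz.2.2).trans
      ((le_iSup (fun S : SurvivorStrategy (torusGrid n) (zombieNumber (torusGrid n)) =>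
        S.law {z | S.Survives z}) S).trans hhalf))
    rw [tsub_le_iff_right] at h2
    have h3 : (1 : ℝ≥0∞) < 1 / 2 + 1 / 2 :=
      h2.trans_lt (ENNReal.add_lt_add_left (by simp) hsmall)
    rw [ENNReal.add_halves] at h3
    exact lt_irrefl _ h3
  · filter_upwards [h, hω.eventually_ge_atTop 0, eventually_ge_atTop 1] with n hn hw h1 hne p
    exact hn _ (Nat.floor_le (div_nonneg (Real.sqrt_nonneg _)
      (mul_nonneg hw (Real.log_nonneg (by exact_mod_cast h1))))) hne p
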